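/- Let $n,m\ge 1$, let $B_r\subset\mathbb R^n$ be the open ball of radius $r$ centred at the origin, and for a function $v$ write $v^+=\max(v,0)$. For $U=(u^1,\dots,u^m)\in C(B_1,\mathbb R^m)$ put $\Omega(U)=B_1\cap\{|U|>0\}$ and $F(U)=B_1\cap\partial\Omega(U)$. A function $\varphi$ touches $u$ by below (resp. by above) at $x_0$ if $\varphi(x_0)=u(x_0)$ and $\varphi\le u$ (resp. $\varphi\ge u$) in a neighborhood of $x_0$. We say that $U$ is a viscosity solution in $B_1$ of the one-phase problem $$\Delta U=0\ \text{ in }\Omega(U),\qquad |\nabla|U||=1\ \text{ on }F(U)$$ if $\Delta u^i=0$ in $\Omega(U)$ for $i=1,\dots,m$ (no sign condition is imposed on the $u^i$) and, for every $x_0\in F(U)$ and every $\varphi$ of class $C^2$ in a neighborhood of $x_0$ with $|\nabla\varphi|(x_0)\neq 0$: (i) if $|\nabla\varphi|(x_0)>1$, then for every unit vector $f\in\mathbb R^m$ the function $\langle U,f\rangle$ is not touched by below by $\varphi$ at $x_0$; (ii) if $|\nabla\varphi|(x_0)<1$, then $|U|$ is not touched by above by $\varphi^+$ at $x_0$. **Theorem.**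 There exist constants $\bar\varepsilon>0$ and $\alpha\in(0,1)$, depending only on $n$ and $m$, such that the following holds. Let $U$ be a viscosity solution in $B_1$ and suppose that, for some unit vectors $e\in\mathbb R^n$ and $f\in\mathbb R^m$, $$|U(x)-f\langle x,e\rangle^+|\le\bar\varepsilon\quad\text{for } x\in B_1,\qquad |U|\equiv 0\quad\text{in }B_1\cap\{\langle x,e\rangle<-\bar\varepsilon\}.$$ Then $F(U)$ is $C^{1,\alpha}$ in $B_{1/2}$: there is a function $g:e^\perp\to\mathbb R$ on the hyperplane $e^\perp=\{y\in\mathbb R^n:\langle y,e\rangle=0\}$, differentiable with $\alpha$-Hölder continuous derivative on $e^\perp\cap B_{1/2}$, such that $$F(U)\cap B_{1/2}=\{\,y+g(y)e : y\in e^\perp\,\}\cap B_{1/2}.$$ -/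

import Mathlib

open Set Filter Topology Metric
open scoped NNReal InnerProductSpace

/-- The positivity set `Ω(U) = Ω ∩ {|U| > 0}`. -/
def positivitySet {n m : ℕ} (Ω : Set (EuclideanSpace ℝ (Fin n)))
    (U : EuclideanSpace ℝ (Fin n) → EuclideanSpace ℝ (Fin m)) :
    Set (EuclideanSpace ℝ (Fin n)) :=
  Ω ∩ {x | 0 < ‖U x‖}

/-- The free boundary `F(U) = Ω ∩ ∂Ω(U)`. -/
def freeBoundary {n m : ℕ} (Ω : Set (EuclideanSpace ℝ (Fin n)))
    (U : EuclideanSpace ℝ (Fin n) → EuclideanSpace ℝ (Fin m)) :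
    Set (EuclideanSpace ℝ (Fin n)) :=
  Ω ∩ frontier (positivitySet Ω U)

/-- `φ` touches `u` by below at `x₀`. -/
def TouchesBelowAt {n : ℕ} (φ u : EuclideanSpace ℝ (Fin n) → ℝ)
    (x₀ : EuclideanSpace ℝ (Fin n)) : Prop :=
  φ x₀ = u x₀ ∧ ∀ᶠ x in 𝓝 x₀, φ x ≤ u x

/-- `φ` touches `u` by above at `x₀`. -/
def TouchesAboveAt {n : ℕ} (φ u : EuclideanSpace ℝ (Fin n) → ℝ)
    (x₀ : EuclideanSpace ℝ (Fin n)) : Prop :=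
  φ x₀ = u x₀ ∧ ∀ᶠ x in 𝓝 x₀, u x ≤ φ x

/-- Viscosity solutions in the open set `Ω` of the vectorial one-phase problem
`ΔU = 0` in `Ω(U)`, `|∇|U|| = 1` on `F(U)`.

In the condition `above`, the nonnegative function `|U|` is touched by the positive part `φ⁺` of
the test function, which amounts to `|U| ≤ φ` on `Ω(U) ∪ F(U)` near `x₀`. A `C²` function `φ` which
satisfies `|U| ≤ φ` in a full neighbourhood of a zero `x₀` of `|U|`, with equality at `x₀`, has a
minimum there, so its gradient vanishes and it is not an admissible test function. -/
structure IsViscositySolution {n m : ℕ} (Ω : Set (EuclideanSpace ℝ (Fin n)))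
    (U : EuclideanSpace ℝ (Fin n) → EuclideanSpace ℝ (Fin m)) : Prop where
  continuousOn : ContinuousOn U Ω
  harmonic : ∀ i : Fin m,
    InnerProductSpace.HarmonicOnNhd (fun x => U x i) (positivitySet Ω U)
  below : ∀ x₀ ∈ freeBoundary Ω U, ∀ φ : EuclideanSpace ℝ (Fin n) → ℝ,
    ContDiffAt ℝ 2 φ x₀ → 1 < ‖gradient φ x₀‖ →
      ∀ f : EuclideanSpace ℝ (Fin m), ‖f‖ = 1 →
        ¬ TouchesBelowAt φ (fun x => ⟪U x, f⟫_ℝ) x₀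
  above : ∀ x₀ ∈ freeBoundary Ω U, ∀ φ : EuclideanSpace ℝ (Fin n) → ℝ,
    ContDiffAt ℝ 2 φ x₀ → gradient φ x₀ ≠ 0 → ‖gradient φ x₀‖ < 1 →
      ¬ TouchesAboveAt (fun x => max (φ x) 0) (fun x => ‖U x‖) x₀

/-- `g` is of class `C^{1,α}` on the open set `s`: it is differentiable and its derivative is
`α`-Hölder continuous on `s`. -/
def IsC1AlphaOn {E : Type*} [NormedAddCommGroup E] [NormedSpace ℝ E]
    (α : ℝ≥0) (g : E → ℝ) (s : Set E) : Prop :=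
  DifferentiableOn ℝ g s ∧ ∃ C : ℝ≥0, HolderOnWith C α (fderiv ℝ g) s

/-- In the ball `B_r` centred at the origin, the set `S` is the graph, in the unit direction `e`,
of a `C^{1,α}` function of the variables in the hyperplane orthogonal to `e`. -/
def IsC1AlphaGraphInBall {n : ℕ} (α : ℝ≥0) (e : EuclideanSpace ℝ (Fin n))
    (S : Set (EuclideanSpace ℝ (Fin n))) (r : ℝ) : Prop :=
  ∃ g : (ℝ ∙ e)ᗮ → ℝ, IsC1AlphaOn α g (ball 0 r) ∧
    S ∩ ball 0 r =
      range (fun y : (ℝ ∙ e)ᗮ => (y : EuclideanSpace ℝ (Fin n)) + g y • e) ∩ ball 0 r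

open InnerProductSpace Laplacian Module
set_option linter.unusedSectionVars false

/-! ### Laplacian calculus: extrema, similarities, quadratic functions. -/

section HarmonicTools

variable {E : Type*} [NormedAddCommGroup E] [InnerProductSpace ℝ E] [FiniteDimensional ℝ E]
  {F : Type*} [NormedAddCommGroup F] [InnerProductSpace ℝ F]

/-! The proof is an improvement of flatness. A flat solution is `⟨·, e⟩⁺ f` plus a correction of
size `ε`. To first order in `ε`, the component of the correction along `f` is harmonic in a half
ball with zero Neumann data on the hyperplane orthogonal to `e` (this is the linearised condition
`|∇|U|| = 1`), and the components orthogonal to `f` are harmonic with zero Dirichlet data. Even and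
odd reflection turn these into harmonic functions in a full ball, with universal derivative bounds.
At a small scale `r` they equal their linear parts up to `O(r²)`, and the linear parts are absorbed
by tilting `e` and `f`. Flatness `ε` in the unit ball thus becomes flatness `ε / 2` in the ball of
radius `r`, rescaled: this is `exists_improvement_of_flatness`. Iterating it at every free boundary
point makes the normals converge geometrically (`exists_normal_of_flat`), and a set with such
tangent planes is a `C^{1,α}` graph (`isC1AlphaGraphInBall_of_normal`).

The linearisation is quantitative and uses no compactness of solutions. `exists_harmonic_approx`
gives, for sphere data of small oscillation at a fixed scale, a nearby harmonic function whose
derivative bounds depend only on that scale and on the tolerance. The small oscillation comes from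
the partial Harnack inequality `exists_trapped_of_flat` for the main component, and from the linear
growth bound `IsFlat.norm_orthPart_le_linear` for the orthogonal one. Closeness on the sphere then
propagates inward, by viscosity comparison (`IsFlat.squeeze_of_sphere`) and by the maximum principle
(`exists_odd_approx`).

No sign condition is needed, because lower barriers are compared with `⟨U, f⟩` and upper barriers
with `|U|`. Away from the free boundary these two differ only quadratically in the orthogonal part
(`norm_le_inner_add_of_unit`). -/

theorem laplacian_eq_sum_fderiv_fderiv {G : Type*} [NormedAddCommGroup G] [NormedSpace ℝ G]
    {ι : Type*} [Fintype ι] (b : OrthonormalBasis ι ℝ E) (h : E → G) (x : E) :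
    Δ h x = ∑ i, fderiv ℝ (fderiv ℝ h) x (b i) (b i) := by
  simp [laplacian_eq_iteratedFDeriv_orthonormalBasis h b, iteratedFDeriv_two_apply]

theorem laplacian_eq_of_hasFDerivAt {ι : Type*} [Fintype ι] (b : OrthonormalBasis ι ℝ E)
    {h : E → ℝ} {h' : E → E →L[ℝ] ℝ} {h'' : E →L[ℝ] E →L[ℝ] ℝ} {x : E}
    (h1 : ∀ᶠ y in 𝓝 x, HasFDerivAt h (h' y) y) (h2 : HasFDerivAt h' h'' x) :
    Δ h x = ∑ i, h'' (b i) (b i) := by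
  have h3 : fderiv ℝ h =ᶠ[𝓝 x] h' := h1.mono fun y hy => hy.fderiv
  rw [laplacian_eq_sum_fderiv_fderiv b, h3.fderiv_eq, h2.fderiv]

theorem sum_inner_sq {ι : Type*} [Fintype ι] (b : OrthonormalBasis ι ℝ E) (y : E) :
    ∑ i, ⟪y, b i⟫_ℝ ^ 2 = ‖y‖ ^ 2 := by
  rw [← b.sum_sq_norm_inner_left y]
  simp

/-- Restrict to the line in direction `v`. A negative second derivative would make the minimum also
a local maximum, so the restriction would be locally constant and its second derivative zero. -/
theorem IsLocalMin.fderiv_fderiv_nonneg {h : E → ℝ} {x : E} (hc : ContDiffAt ℝ 2 h x)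
    (hm : IsLocalMin h x) (v : E) : 0 ≤ fderiv ℝ (fderiv ℝ h) x v v := by
  set g : ℝ → ℝ := fun s => h (x + s • v) with hg
  have hline : ∀ s : ℝ, HasDerivAt (fun s : ℝ => x + s • v) v s := fun s => by
    simpa using ((hasDerivAt_id s).smul_const v).const_add x
  have hcont : ContinuousAt (fun s : ℝ => x + s • v) 0 := (hline 0).continuousAt
  have hx0 : x + (0 : ℝ) • v = x := by simp
  have htend : Tendsto (fun s : ℝ => x + s • v) (𝓝 0) (𝓝 x) := by
    have := hcont.tendsto; rwa [hx0] at this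
  have hd1 : ∀ᶠ y in 𝓝 x, DifferentiableAt ℝ h y :=
    (hc.eventually (by simp)).mono fun y hy => hy.differentiableAt (by norm_num)
  have hg1 : deriv g =ᶠ[𝓝 0] fun s => fderiv ℝ h (x + s • v) v := by
    filter_upwards [htend.eventually hd1] with s hs
    exact (hs.hasFDerivAt.comp_hasDerivAt s (hline s)).deriv
  have hd2 : DifferentiableAt ℝ (fderiv ℝ h) x :=
    (hc.fderiv_right (m := 1) (by norm_num)).differentiableAt (by norm_num)
  have hg2 : deriv (deriv g) 0 = fderiv ℝ (fderiv ℝ h) x v v := by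
    rw [hg1.deriv_eq]
    have h1 : HasFDerivAt (fderiv ℝ h) (fderiv ℝ (fderiv ℝ h) x) (x + (0 : ℝ) • v) := by
      rw [hx0]; exact hd2.hasFDerivAt
    have h2 := h1.comp_hasDerivAt (0 : ℝ) (hline 0)
    exact (h2.clm_apply (hasDerivAt_const (0 : ℝ) v)).deriv.trans (by simp)
  have hgm : IsLocalMin g 0 := by
    have : ∀ᶠ s in 𝓝 (0 : ℝ), h x ≤ h (x + s • v) := htend.eventually hm
    simpa [IsLocalMin, IsMinFilter, hg] using this
  have hgc : ContinuousAt g 0 := by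
    have h0 : ContinuousAt h (x + (0 : ℝ) • v) := by
      rw [hx0]; exact hc.continuousAt
    exact ContinuousAt.comp (f := fun s : ℝ => x + s • v) h0 hcont
  rw [← hg2]
  by_contra hneg
  push Not at hneg
  have hmax := isLocalMax_of_deriv_deriv_neg hneg hgm.deriv_eq_zero hgc
  have hconst : g =ᶠ[𝓝 0] fun _ => g 0 := by
    filter_upwards [hgm, hmax] with s h1 h2
    exact le_antisymm h2 h1
  have h3 : deriv g =ᶠ[𝓝 0] fun _ => (0 : ℝ) := by
    have := hconst.deriv
    simpa using this
  rw [h3.deriv_eq] at hneg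
  simp at hneg

theorem IsLocalMin.laplacian_nonneg {h : E → ℝ} {x : E} (hc : ContDiffAt ℝ 2 h x)
    (hm : IsLocalMin h x) : 0 ≤ Δ h x := by
  rw [laplacian_eq_sum_fderiv_fderiv (stdOrthonormalBasis ℝ E)]
  exact Finset.sum_nonneg fun i _ => hm.fderiv_fderiv_nonneg hc _

theorem IsLocalMax.laplacian_nonpos {h : E → ℝ} {x : E} (hc : ContDiffAt ℝ 2 h x)
    (hm : IsLocalMax h x) : Δ h x ≤ 0 := by
  have h1 := (IsLocalMax.neg hm).laplacian_nonneg hc.neg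
  have h2 : Δ (fun x => -h x) x = - Δ h x := by
    have := laplacian_neg (f := h)
    exact congrFun this x
  rw [h2] at h1; linarith

/-- The chain rule, together with the freedom to compute the Laplacian at the image point in the
rotated basis `b.map σ`. -/
theorem fderiv_fderiv_comp_similarity {G : Type*} [NormedAddCommGroup G] [NormedSpace ℝ G]
    {h : E → G} (σ : E ≃ₗᵢ[ℝ] E) (z : E) (c : ℝ) {x : E}
    (hc : ContDiffAt ℝ 2 h (z + c • σ x)) :
    Δ (fun y => h (z + c • σ y)) x = c ^ 2 • Δ h (z + c • σ x) := by
  set A : E → E := fun y => z + c • σ y with hA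
  set L : E →L[ℝ] E := c • (σ : E ≃L[ℝ] E).toContinuousLinearMap with hL
  have hAd : ∀ y, HasFDerivAt A L y := fun y => by
    have : HasFDerivAt (fun y => L y) L y := L.hasFDerivAt
    exact this.const_add z
  have hd1 : ∀ᶠ y in 𝓝 x, DifferentiableAt ℝ h (A y) :=
    (hAd x).continuousAt.eventually
      ((hc.eventually (by simp)).mono fun y hy => hy.differentiableAt (by norm_num))
  have h1 : fderiv ℝ (fun y => h (A y)) =ᶠ[𝓝 x] fun y => (fderiv ℝ h (A y)).comp L := by
    filter_upwards [hd1] with y hy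
    exact (hy.hasFDerivAt.comp y (hAd y)).fderiv
  have hd2 : HasFDerivAt (fderiv ℝ h) (fderiv ℝ (fderiv ℝ h) (A x)) (A x) :=
    ((hc.fderiv_right (m := 1) (by norm_num)).differentiableAt (by norm_num)).hasFDerivAt
  have h2 : HasFDerivAt (fun y => (fderiv ℝ h (A y)).comp L)
      (((ContinuousLinearMap.compL ℝ E E G).flip L).comp
        ((fderiv ℝ (fderiv ℝ h) (A x)).comp L)) x := by
    have h3 := ((ContinuousLinearMap.compL ℝ E E G).flip L).hasFDerivAt.comp x
      (hd2.comp x (hAd x))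
    exact h3
  set b := stdOrthonormalBasis ℝ E
  rw [laplacian_eq_sum_fderiv_fderiv b, h1.fderiv_eq, h2.fderiv,
    laplacian_eq_sum_fderiv_fderiv (b.map σ), Finset.smul_sum]
  refine Finset.sum_congr rfl fun i _ => ?_
  simp [hL, smul_smul, sq, hA]

theorem ContDiffAt.comp_similarity {G : Type*} [NormedAddCommGroup G] [NormedSpace ℝ G]
    {h : E → G} (σ : E ≃ₗᵢ[ℝ] E) (z : E) (c : ℝ) {x : E}
    (hc : ContDiffAt ℝ 2 h (z + c • σ x)) :
    ContDiffAt ℝ 2 (fun y => h (z + c • σ y)) x :=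
  ContDiffAt.comp (f := fun y => z + c • σ y) (g := h) x hc
    (contDiffAt_const.add (contDiffAt_const.smul (σ : E ≃L[ℝ] E).contDiff.contDiffAt))

theorem InnerProductSpace.HarmonicAt.comp_similarity
    {G : Type*} [NormedAddCommGroup G] [NormedSpace ℝ G]
    {h : E → G} (σ : E ≃ₗᵢ[ℝ] E) (z : E) (c : ℝ) {x : E}
    (hh : HarmonicAt h (z + c • σ x)) : HarmonicAt (fun y => h (z + c • σ y)) x := by
  refine ⟨hh.1.comp_similarity σ z c, ?_⟩
  have hcont : ContinuousAt (fun y : E => z + c • σ y) x := by fun_prop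
  filter_upwards [hcont.eventually hh.eventually] with y hy
  rw [fderiv_fderiv_comp_similarity σ z c hy.1, hy.2.self_of_nhds]
  simp

theorem InnerProductSpace.HarmonicAt.comp_add_left
    {G : Type*} [NormedAddCommGroup G] [NormedSpace ℝ G] {h : E → G} (z : E) {x : E}
    (hh : HarmonicAt h (z + x)) : HarmonicAt (fun y => h (z + y)) x := by
  simpa using HarmonicAt.comp_similarity (LinearIsometryEquiv.refl ℝ E) z 1 (by simpa using hh)

theorem InnerProductSpace.HarmonicAt.inner_const {h : E → F} {x : E} (hh : HarmonicAt h x)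
    (g : F) : HarmonicAt (fun y => ⟪h y, g⟫_ℝ) x := by
  have := hh.comp_CLM (innerSL ℝ g)
  refine (harmonicAt_congr_nhds (Eventually.of_forall fun y => ?_)).1 this
  simp [real_inner_comm]

/-- The quadratic function `c + ⟨l, x⟩ + a |x - x₀|² + d ⟨x - x₀, e⟩²`. -/
noncomputable def quadFun (c a d : ℝ) (l x₀ e : E) (x : E) : ℝ :=
  c + ⟪l, x⟫_ℝ + a * ‖x - x₀‖ ^ 2 + d * ⟪e, x - x₀⟫_ℝ ^ 2

theorem contDiff_quadFun (c a d : ℝ) (l x₀ e : E) {k : WithTop ℕ∞} :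
    ContDiff ℝ k (quadFun c a d l x₀ e) := by
  unfold quadFun
  have h1 : ContDiff ℝ k fun x : E => x - x₀ := contDiff_id.sub contDiff_const
  exact ((contDiff_const.add (contDiff_const.inner ℝ contDiff_id)).add
    (contDiff_const.mul (h1.norm_sq ℝ))).add (contDiff_const.mul ((contDiff_const.inner ℝ h1).pow 2))

theorem hasFDerivAt_quadFun (c a d : ℝ) (l x₀ e : E) (x : E) :
    HasFDerivAt (quadFun c a d l x₀ e)
      (innerSL ℝ l + (2 * a) • innerSL ℝ (x - x₀) + (2 * d * ⟪e, x - x₀⟫_ℝ) • innerSL ℝ e) x := by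
  have h0 : HasFDerivAt (fun x : E => x - x₀) (ContinuousLinearMap.id ℝ E) x :=
    (hasFDerivAt_id x).sub_const x₀
  have h1 : HasFDerivAt (fun x : E => ⟪l, x⟫_ℝ) (innerSL ℝ l) x := (innerSL ℝ l).hasFDerivAt
  have h2 : HasFDerivAt (fun x : E => ⟪e, x - x₀⟫_ℝ) (innerSL ℝ e) x := by
    exact (innerSL ℝ e).hasFDerivAt.comp x h0
  have h3 : HasFDerivAt (fun x : E => ‖x - x₀‖ ^ 2) (2 • (innerSL ℝ (x - x₀)).comp
    (ContinuousLinearMap.id ℝ E)) x := h0.norm_sq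
  have := ((h1.const_add c).add (h3.const_mul a)).add ((h2.pow 2).const_mul d)
  refine this.congr_fderiv ?_
  ext v
  simp
  ring

theorem laplacian_quadFun (c a d : ℝ) (l x₀ e : E) (x : E) :
    Δ (quadFun c a d l x₀ e) x = 2 * a * finrank ℝ E + 2 * d * ‖e‖ ^ 2 := by
  set B : E →L[ℝ] E →L[ℝ] ℝ := innerSL ℝ (E := E) with hB
  have hBv : ∀ v w, B v w = ⟪v, w⟫_ℝ := fun v w => rfl
  have h2 : HasFDerivAt (fun x => innerSL ℝ l + (2 * a) • innerSL ℝ (x - x₀) +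
      (2 * d * ⟪e, x - x₀⟫_ℝ) • innerSL ℝ e)
      ((2 * a) • B + ((2 * d) • innerSL ℝ e).smulRight (innerSL ℝ e)) x := by
    have h0 : HasFDerivAt (fun x : E => x - x₀) (ContinuousLinearMap.id ℝ E) x :=
      (hasFDerivAt_id x).sub_const x₀
    have h1 : HasFDerivAt (fun x : E => innerSL ℝ (x - x₀)) B x :=
      B.hasFDerivAt.comp x h0
    have h3 : HasFDerivAt (fun x : E => 2 * d * ⟪e, x - x₀⟫_ℝ) ((2 * d) • innerSL ℝ e) x :=
      ((innerSL ℝ e).hasFDerivAt.comp x h0).const_mul (2 * d)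
    have h4 : HasFDerivAt (fun x : E => (2 * d * ⟪e, x - x₀⟫_ℝ) • (innerSL ℝ e : E →L[ℝ] ℝ))
        (((2 * d) • innerSL ℝ e).smulRight (innerSL ℝ e)) x := h3.smul_const (innerSL ℝ e)
    exact ((h1.const_smul (2 * a)).const_add _).add h4
  rw [laplacian_eq_of_hasFDerivAt (stdOrthonormalBasis ℝ E)
    (Eventually.of_forall fun y => hasFDerivAt_quadFun c a d l x₀ e y) h2]
  have h3 : ∀ i, ((2 * a) • B + ((2 * d) • innerSL ℝ e).smulRight (innerSL ℝ e))
      (stdOrthonormalBasis ℝ E i) (stdOrthonormalBasis ℝ E i) =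
      2 * a + 2 * d * ⟪e, stdOrthonormalBasis ℝ E i⟫_ℝ ^ 2 := fun i => by
    simp [hBv]; ring
  simp only [h3, Finset.sum_add_distrib, ← Finset.mul_sum, sum_inner_sq]
  simp; ring

end HarmonicTools

/-! ### Maximum principle, half-ball barrier and interior derivative estimates. -/

section MaximumPrinciple

variable {E : Type*} [NormedAddCommGroup E] [InnerProductSpace ℝ E] [FiniteDimensional ℝ E]
  {F : Type*} [NormedAddCommGroup F] [InnerProductSpace ℝ F]

theorem nontrivial_of_norm_eq_one {e : E} (he : ‖e‖ = 1) : Nontrivial E :=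
  ⟨e, 0, fun h => by simp [h] at he⟩

/-- The weak maximum principle. -/
theorem le_of_harmonic_or_le [Nontrivial E] {K : Set E} (hK : IsCompact K) {h : E → ℝ}
    (hc : ContinuousOn h K) {M : ℝ}
    (hh : ∀ x ∈ K, h x ≤ M ∨ (x ∈ interior K ∧ HarmonicAt h x)) : ∀ x ∈ K, h x ≤ M := by
  intro y hy
  by_contra hlt
  push Not at hlt
  obtain ⟨R, hR⟩ := hK.isBounded.exists_norm_le
  have hR0 : 0 ≤ R := (norm_nonneg y).trans (hR y hy)
  -- Adding `δ |x|²` makes `h` strictly subharmonic where it is harmonic, and `δ` is so small that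
  -- the maximum of the sum cannot lie where `h ≤ M`.
  obtain ⟨δ, hδ, hδR⟩ : ∃ δ > 0, δ * R ^ 2 < h y - M := by
    refine ⟨(h y - M) / (2 * (R ^ 2 + 1)), by have := sub_pos.2 hlt; positivity, ?_⟩
    rw [div_mul_eq_mul_div, div_lt_iff₀ (by positivity)]
    nlinarith [sub_pos.2 hlt, sq_nonneg R, mul_nonneg (sub_pos.2 hlt).le (sq_nonneg R)]
  have hcont : ContinuousOn (fun x => h x + quadFun 0 δ 0 0 0 (0 : E) x) K :=
    hc.add (contDiff_quadFun (k := 2) _ _ _ _ _ _).continuous.continuousOn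
  have hq : ∀ x : E, quadFun 0 δ 0 0 0 (0 : E) x = δ * ‖x‖ ^ 2 := fun x => by simp [quadFun]
  obtain ⟨x₁, hx₁, hmax⟩ := hK.exists_isMaxOn ⟨y, hy⟩ hcont
  have h1 := hmax hy
  simp only [mem_ofPred_eq, hq] at h1
  have h2 : δ * ‖x₁‖ ^ 2 ≤ δ * R ^ 2 := by
    have := hR x₁ hx₁; gcongr
  have h3 : 0 ≤ δ * ‖y‖ ^ 2 := by positivity
  rcases hh x₁ hx₁ with h4 | ⟨h4, h5⟩
  · linarith
  · have hloc : IsLocalMax (fun x => h x + quadFun 0 δ 0 0 0 (0 : E) x) x₁ :=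
      hmax.isLocalMax (mem_interior_iff_mem_nhds.1 h4)
    have h6 := hloc.laplacian_nonpos (h5.1.add (contDiff_quadFun _ _ _ _ _ _).contDiffAt)
    have h7 := h5.1.laplacian_add (contDiff_quadFun 0 δ 0 0 0 (0 : E)).contDiffAt (x := x₁)
    have h8 : Δ (fun x => h x + quadFun 0 δ 0 0 0 (0 : E) x) x₁ = _ := h7
    rw [h8, laplacian_quadFun, h5.2.self_of_nhds] at h6
    have h9 : (0 : ℝ) < finrank ℝ E := by exact_mod_cast Module.finrank_pos (R := ℝ) (M := E)
    simp at h6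
    nlinarith

theorem isCompact_halfBall (x₀ e : E) (R s : ℝ) :
    IsCompact {x : E | ‖x - x₀‖ ≤ R ∧ s ≤ ⟪e, x - x₀⟫_ℝ} := by
  refine (isCompact_closedBall x₀ R).of_isClosed_subset ?_ fun x hx => ?_
  · have h1 : IsClosed {x : E | ‖x - x₀‖ ≤ R} := isClosed_le (by fun_prop) (by fun_prop)
    have h2 : IsClosed {x : E | s ≤ ⟪e, x - x₀⟫_ℝ} := isClosed_le (by fun_prop) (by fun_prop)
    exact h1.and h2
  · simpa [dist_eq_norm] using hx.1

theorem mem_interior_halfBall {x₀ e : E} {R s : ℝ} {x : E} (h1 : ‖x - x₀‖ < R)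
    (h2 : s < ⟪e, x - x₀⟫_ℝ) :
    x ∈ interior {x : E | ‖x - x₀‖ ≤ R ∧ s ≤ ⟪e, x - x₀⟫_ℝ} := by
  have ho : IsOpen {x : E | ‖x - x₀‖ < R ∧ s < ⟪e, x - x₀⟫_ℝ} := by
    have h1 : IsOpen {x : E | ‖x - x₀‖ < R} := isOpen_lt (by fun_prop) (by fun_prop)
    have h2 : IsOpen {x : E | s < ⟪e, x - x₀⟫_ℝ} := isOpen_lt (by fun_prop) (by fun_prop)
    exact h1.and h2
  have hs : {x : E | ‖x - x₀‖ < R ∧ s < ⟪e, x - x₀⟫_ℝ} ⊆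
      {x : E | ‖x - x₀‖ ≤ R ∧ s ≤ ⟪e, x - x₀⟫_ℝ} := fun y hy => ⟨hy.1.le, hy.2.le⟩
  exact interior_maximal hs ho ⟨h1, h2⟩

/-- A function on a half ball which is harmonic where positive, and nonpositive on the flat part of
the boundary, grows at most linearly away from it. -/
theorem le_halfBall_barrier {D : E → ℝ} {x₀ e : E} (he : ‖e‖ = 1) {R M : ℝ} (hR : 0 < R)
    (hM : 0 ≤ M) (hc : ContinuousOn D {x | ‖x - x₀‖ ≤ R ∧ 0 ≤ ⟪e, x - x₀⟫_ℝ})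
    (hle : ∀ x, ‖x - x₀‖ ≤ R → 0 ≤ ⟪e, x - x₀⟫_ℝ → D x ≤ M)
    (h0 : ∀ x, ‖x - x₀‖ ≤ R → ⟪e, x - x₀⟫_ℝ = 0 → D x ≤ 0)
    (hh : ∀ x, ‖x - x₀‖ < R → 0 < ⟪e, x - x₀⟫_ℝ → D x ≤ 0 ∨ HarmonicAt D x)
    {x : E} (hx : ‖x - x₀‖ ≤ R) (hx' : 0 ≤ ⟪e, x - x₀⟫_ℝ) :
    D x ≤ M * (‖x - x₀‖ ^ 2 / R ^ 2 + finrank ℝ E * ⟪e, x - x₀⟫_ℝ / R) := by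
  have := nontrivial_of_norm_eq_one he
  set n : ℝ := ((finrank ℝ E : ℕ) : ℝ) with hn
  have hn0 : 0 ≤ n := by positivity
  -- With `t = ⟨e, y - x₀⟩ / R` this is `M (|y - x₀|² / R² + n t - n t²)`. The last term cancels the
  -- Laplacian of the first, and `0 ≤ t ≤ 1` gives `Φ ≥ M` on the curved part of the boundary and `Φ
  -- ≥ 0` on the flat part.
  set Φ := quadFun (-(n * M / R) * ⟪e, x₀⟫_ℝ) (M / R ^ 2) (-(n * M / R ^ 2)) ((n * M / R) • e) x₀ e
    with hΦ
  have hΦv : ∀ y, Φ y = M * (‖y - x₀‖ ^ 2 / R ^ 2 + n * (⟪e, y - x₀⟫_ℝ / R)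
      - n * (⟪e, y - x₀⟫_ℝ / R) ^ 2) := fun y => by
    simp only [hΦ, quadFun, inner_smul_left, inner_sub_right]
    simp
    field_simp
    ring
  have hΦh : ∀ y, HarmonicAt Φ y := fun y =>
    ⟨(contDiff_quadFun _ _ _ _ _ _).contDiffAt, Eventually.of_forall fun z => by
      rw [hΦ, laplacian_quadFun, he, ← hn]
      simp; field_simp; ring⟩
  have ht : ∀ y, ‖y - x₀‖ ≤ R → ⟪e, y - x₀⟫_ℝ / R ≤ 1 := fun y hy => by
    rw [div_le_one hR]
    calc ⟪e, y - x₀⟫_ℝ ≤ ‖e‖ * ‖y - x₀‖ := real_inner_le_norm _ _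
      _ ≤ R := by rw [he]; linarith
  have hΦ0 : ∀ y, ‖y - x₀‖ ≤ R → 0 ≤ ⟪e, y - x₀⟫_ℝ →
      M * (‖y - x₀‖ ^ 2 / R ^ 2) ≤ Φ y := fun y hy hy' => by
    rw [hΦv]
    have h1 := ht y hy
    have h2 : 0 ≤ ⟪e, y - x₀⟫_ℝ / R := by positivity
    refine mul_le_mul_of_nonneg_left ?_ hM
    nlinarith [mul_nonneg hn0 (mul_nonneg h2 (sub_nonneg.2 h1))]
  have key : ∀ y ∈ {x | ‖x - x₀‖ ≤ R ∧ 0 ≤ ⟪e, x - x₀⟫_ℝ}, (D - Φ) y ≤ 0 := by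
    refine le_of_harmonic_or_le (isCompact_halfBall x₀ e R 0)
      (hc.sub (contDiff_quadFun (k := 2) _ _ _ _ _ _).continuous.continuousOn) ?_
    rintro y ⟨hy, hy'⟩
    have hp := hΦ0 y hy hy'
    have hp0 : 0 ≤ M * (‖y - x₀‖ ^ 2 / R ^ 2) := by positivity
    simp only [Pi.sub_apply]
    rcases hy.eq_or_lt with h1 | h1
    · left
      have := hle y hy hy'
      rw [h1, div_self (by positivity), mul_one] at hp
      linarith
    rcases hy'.eq_or_lt with h2 | h2
    · left
      linarith [h0 y hy h2.symm]
    rcases hh y h1 h2 with h3 | h3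
    · left; linarith
    · right
      exact ⟨mem_interior_halfBall h1 h2, h3.sub (hΦh y)⟩
  have h1 := key x ⟨hx, hx'⟩
  rw [Pi.sub_apply, hΦv] at h1
  have h2 : 0 ≤ M * (n * (⟪e, x - x₀⟫_ℝ / R) ^ 2) := by positivity
  have h3 : n * (⟪e, x - x₀⟫_ℝ / R) = n * ⟪e, x - x₀⟫_ℝ / R := by ring
  rw [← h3]
  nlinarith

/-- The reflection across the hyperplane orthogonal to `e`. -/
noncomputable def hyperplaneReflection (e : E) : E ≃ₗᵢ[ℝ] E := (ℝ ∙ e)ᗮ.reflection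

theorem hyperplaneReflection_apply {e : E} (he : ‖e‖ = 1) (x : E) :
    hyperplaneReflection e x = x - (2 * ⟪e, x⟫_ℝ) • e := by
  rw [hyperplaneReflection, Submodule.reflection_orthogonal_apply,
    Submodule.reflection_singleton_apply, he]
  simp
  module

/-- The interior gradient estimate for harmonic functions, in Lipschitz form. -/
theorem norm_sub_le_of_harmonic {h : E → F} {x₀ : E} {R M : ℝ} (hR : 0 < R)
    (hh : ∀ x ∈ ball x₀ R, HarmonicAt h x) (hM : ∀ x ∈ ball x₀ R, ‖h x‖ ≤ M)
    {x y : E} (hx : x ∈ closedBall x₀ (R / 2)) (hy : y ∈ closedBall x₀ (R / 2)) :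
    ‖h x - h y‖ ≤ 4 * (finrank ℝ E + 1) * M / R * ‖x - y‖ := by
  have hM0 : 0 ≤ M := (norm_nonneg _).trans (hM x₀ (mem_ball_self hR))
  set n : ℝ := ((finrank ℝ E : ℕ) : ℝ) with hn
  have hn0 : 0 ≤ n := by positivity
  have hsub : closedBall x₀ (R / 2) ⊆ ball x₀ R := closedBall_subset_ball (by linarith)
  by_cases hxy : x = y
  · simp [hxy]
  have hpos : 0 < ‖x - y‖ := norm_pos_iff.2 (sub_ne_zero.2 hxy)
  set s : ℝ := ‖x - y‖ / 2 with hs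
  have hs0 : 0 < s := by positivity
  by_cases hsR : R / 4 < s
  · have h1 : ‖h x - h y‖ ≤ 2 * M := by
      calc ‖h x - h y‖ ≤ ‖h x‖ + ‖h y‖ := norm_sub_le _ _
        _ ≤ 2 * M := by linarith [hM x (hsub hx), hM y (hsub hy)]
    refine h1.trans ?_
    rw [div_mul_eq_mul_div, le_div_iff₀ hR]
    have h2 : R ≤ 2 * ‖x - y‖ := by linarith
    have h3 : 2 * M * R ≤ 2 * M * (2 * ‖x - y‖) := by gcongr
    have h4 : 0 ≤ n * M * ‖x - y‖ := by positivity
    nlinarith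
  push Not at hsR
  by_cases hz0 : h x - h y = 0
  · rw [hz0, norm_zero]; positivity
  set g : F := ‖h x - h y‖⁻¹ • (h x - h y) with hg
  have hgn : ‖g‖ = 1 := by
    rw [hg, norm_smul, norm_inv, norm_norm, inv_mul_cancel₀ (norm_ne_zero_iff.2 hz0)]
  set e : E := ‖x - y‖⁻¹ • (x - y) with he'
  have he : ‖e‖ = 1 := by
    rw [he', norm_smul, norm_inv, norm_norm, inv_mul_cancel₀ hpos.ne']
  have hse : s • e = (1 / 2 : ℝ) • (x - y) := by
    rw [hs, he', smul_smul]; congr 1; field_simp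
  set z : E := (1 / 2 : ℝ) • (x + y) with hz
  have hzx : z + s • e = x := by rw [hse, hz]; module
  have hzy : z - s • e = y := by rw [hse, hz]; module
  have hzb : z ∈ closedBall x₀ (R / 2) := by
    have := (convex_closedBall x₀ (R / 2)) hx hy (by norm_num : (0 : ℝ) ≤ 1 / 2)
      (by norm_num : (0 : ℝ) ≤ 1 / 2) (by norm_num)
    rwa [← smul_add] at this
  have hin : ∀ ξ : E, ‖ξ‖ ≤ R / 4 → z + ξ ∈ ball x₀ R := fun ξ hξ => by
    rw [mem_closedBall, dist_eq_norm] at hzb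
    rw [mem_ball, dist_eq_norm]
    calc ‖z + ξ - x₀‖ = ‖(z - x₀) + ξ‖ := by congr 1; abel
      _ ≤ ‖z - x₀‖ + ‖ξ‖ := norm_add_le _ _
      _ < R := by linarith
  set σ := hyperplaneReflection e with hσ
  have hσn : ∀ ξ, ‖σ ξ‖ = ‖ξ‖ := σ.norm_map
  -- Odd under the reflection exchanging `x` and `y`, hence zero on the mirror hyperplane. The
  -- half-ball barrier therefore bounds its value at `s • e`, which is `‖h x - h y‖`.
  set D : E → ℝ := fun ξ => ⟪h (z + ξ) - h (z + σ ξ), g⟫_ℝ with hD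
  have hDh : ∀ ξ, ‖ξ‖ ≤ R / 4 → HarmonicAt D ξ := fun ξ hξ => by
    have h1 := HarmonicAt.comp_add_left z (hh _ (hin ξ hξ))
    have h2 := HarmonicAt.comp_similarity σ z 1 (x := ξ) (h := h)
      (by simpa using hh _ (hin (σ ξ) (by rwa [hσn])))
    simp only [one_smul] at h2
    exact (h1.sub h2).inner_const g
  have hDle : ∀ ξ, ‖ξ‖ ≤ R / 4 → D ξ ≤ 2 * M := fun ξ hξ => by
    calc D ξ ≤ ‖h (z + ξ) - h (z + σ ξ)‖ * ‖g‖ := real_inner_le_norm _ _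
      _ ≤ ‖h (z + ξ)‖ + ‖h (z + σ ξ)‖ := by rw [hgn, mul_one]; exact norm_sub_le _ _
      _ ≤ 2 * M := by linarith [hM _ (hin ξ hξ), hM _ (hin (σ ξ) (by rwa [hσn]))]
  have hse' : ‖s • e‖ = s := by rw [norm_smul, he, Real.norm_of_nonneg hs0.le, mul_one]
  have hes : ⟪e, s • e⟫_ℝ = s := by
    rw [inner_smul_right, real_inner_self_eq_norm_sq, he]; ring
  have key := le_halfBall_barrier (D := D) (x₀ := 0) he (R := R / 4) (M := 2 * M) (by positivity)
    (by positivity)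
    (fun ξ hξ => ((hDh ξ (by simpa using hξ.1)).1.continuousAt).continuousWithinAt)
    (fun ξ hξ _ => hDle ξ (by simpa using hξ))
    (fun ξ hξ h0 => by
      have h0 : ⟪e, ξ⟫_ℝ = 0 := by simpa using h0
      have : σ ξ = ξ := by rw [hσ, hyperplaneReflection_apply he, h0]; simp
      simp [hD, this])
    (fun ξ hξ _ => Or.inr (hDh ξ (by simpa using hξ.le)))
    (x := s • e) (by simpa [hse'] using hsR) (by simp only [sub_zero, hes]; exact hs0.le)
  have hσse : σ (s • e) = -(s • e) := by
    rw [hσ, hyperplaneReflection_apply he, hes, mul_smul, two_smul]; abel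
  simp only [hD, hσse, ← sub_eq_add_neg, hzx, hzy, sub_zero, hse', hes, ← hn] at key
  have hgv : ⟪h x - h y, g⟫_ℝ = ‖h x - h y‖ := by
    rw [hg, inner_smul_right, real_inner_self_eq_norm_sq, sq, ← mul_assoc,
      inv_mul_cancel₀ (norm_ne_zero_iff.2 hz0), one_mul]
  rw [hgv] at key
  refine key.trans ?_
  have h5 : s ^ 2 / (R / 4) ^ 2 ≤ s / (R / 4) := by
    rw [← div_pow]
    have h6 : s / (R / 4) ≤ 1 := (div_le_one (by positivity)).2 hsR
    have h7 : 0 ≤ s / (R / 4) := by positivity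
    nlinarith
  calc 2 * M * (s ^ 2 / (R / 4) ^ 2 + n * s / (R / 4))
      ≤ 2 * M * (s / (R / 4) + n * s / (R / 4)) := by gcongr
    _ = 4 * (n + 1) * M / R * ‖x - y‖ := by
      rw [hs]; field_simp; ring

/-- Harmonic functions have locally Lipschitz derivative, with universal constants. -/
theorem norm_fderiv_sub_fderiv_le_of_harmonic {h : E → F} {x₀ : E} {R M : ℝ} (hR : 0 < R)
    (hh : ∀ x ∈ ball x₀ R, HarmonicAt h x) (hM : ∀ x ∈ ball x₀ R, ‖h x‖ ≤ M)
    {x : E} (hx : x ∈ closedBall x₀ (R / 8)) :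
    ‖fderiv ℝ h x - fderiv ℝ h x₀‖ ≤
      4 * (4 * (finrank ℝ E + 1)) ^ 2 * M / R ^ 2 * ‖x - x₀‖ := by
  set L : ℝ := 4 * (finrank ℝ E + 1) with hL
  have hL0 : 0 ≤ L := by positivity
  have hM0 : 0 ≤ M := (norm_nonneg _).trans (hM x₀ (mem_ball_self hR))
  have hd : ∀ y ∈ ball x₀ R, HasFDerivAt h (fderiv ℝ h y) y := fun y hy =>
    ((hh y hy).1.differentiableAt (by norm_num)).hasFDerivAt
  have hxb : x ∈ ball x₀ R := closedBall_subset_ball (by linarith) hx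
  refine ContinuousLinearMap.opNorm_le_of_unit_norm (by positivity) fun v hv => ?_
  have hq : ∀ s : ℝ, 0 < s → s < R / 4 →
      ‖(h (x + s • v) - h x) - (h (x₀ + s • v) - h x₀)‖ ≤
        4 * L ^ 2 * M / R ^ 2 * ‖x - x₀‖ * s := by
    intro s hs hs'
    have hsv : ‖s • v‖ = s := by rw [norm_smul, hv, Real.norm_of_nonneg hs.le, mul_one]
    have hin : ∀ y ∈ ball x₀ (R / 4), y + s • v ∈ closedBall x₀ (R / 2) := fun y hy => by
      rw [mem_ball, dist_eq_norm] at hy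
      rw [mem_closedBall, dist_eq_norm]
      calc ‖y + s • v - x₀‖ = ‖(y - x₀) + s • v‖ := by congr 1; abel
        _ ≤ ‖y - x₀‖ + ‖s • v‖ := norm_add_le _ _
        _ ≤ R / 2 := by linarith
    have hsub : closedBall x₀ (R / 2) ⊆ ball x₀ R := closedBall_subset_ball (by linarith)
    have hsub' : ball x₀ (R / 4) ⊆ closedBall x₀ (R / 2) :=
      ball_subset_closedBall.trans (closedBall_subset_closedBall (by linarith))
    -- The increment is itself harmonic and of size `L M s / R` by the Lipschitz estimate; the same
    -- estimate applied to it yields the second order bound.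
    have := norm_sub_le_of_harmonic (h := fun y => h (s • v + y) - h y) (x₀ := x₀) (R := R / 4)
      (M := L * M / R * s) (by positivity)
      (fun y hy => (HarmonicAt.comp_add_left (s • v)
        (hh _ (by rw [add_comm]; exact hsub (hin y hy)))).sub (hh y (hsub (hsub' hy))))
      (fun y hy => by
        have := norm_sub_le_of_harmonic hR hh hM (x := s • v + y) (y := y)
          (by rw [add_comm]; exact hin y hy) (hsub' hy)
        rw [← hL] at this
        simpa [hsv] using this)
      (x := x) (y := x₀) (by rwa [show R / 4 / 2 = R / 8 by ring])
      (mem_closedBall_self (by positivity))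
    rw [add_comm x, add_comm x₀]
    refine this.trans (le_of_eq ?_)
    rw [← hL]; field_simp
  have hlim : ∀ y ∈ ball x₀ R, Tendsto (fun s : ℝ => s⁻¹ • (h (y + s • v) - h y)) (𝓝[>] 0)
      (𝓝 (fderiv ℝ h y v)) := fun y hy => by
    have h1 := ((hd y hy).hasLineDerivAt v).tendsto_slope_zero
    exact h1.mono_left (nhdsWithin_mono _ fun s hs => ne_of_gt hs)
  have h1 := ((hlim x hxb).sub (hlim x₀ (mem_ball_self hR))).norm
  refine le_of_tendsto h1 ?_
  filter_upwards [Ioo_mem_nhdsGT (show (0 : ℝ) < R / 4 by positivity)] with s hs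
  rw [← smul_sub, norm_smul, norm_inv, Real.norm_of_nonneg hs.1.le, inv_mul_le_iff₀ hs.1]
  refine (hq s hs.1 hs.2).trans (le_of_eq ?_)
  ring

/-- Mean value inequality on the ball of radius `‖x - x₀‖`, where the derivative is close to its
value at the centre. -/
theorem norm_sub_fderiv_le_of_harmonic {h : E → F} {x₀ : E} {R M : ℝ} (hR : 0 < R)
    (hh : ∀ x ∈ ball x₀ R, HarmonicAt h x) (hM : ∀ x ∈ ball x₀ R, ‖h x‖ ≤ M)
    {x : E} (hx : x ∈ closedBall x₀ (R / 8)) :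
    ‖h x - h x₀ - fderiv ℝ h x₀ (x - x₀)‖ ≤
      4 * (4 * (finrank ℝ E + 1)) ^ 2 * M / R ^ 2 * ‖x - x₀‖ ^ 2 := by
  have hM0 : 0 ≤ M := (norm_nonneg _).trans (hM x₀ (mem_ball_self hR))
  have hsub : closedBall x₀ (‖x - x₀‖) ⊆ closedBall x₀ (R / 8) :=
    closedBall_subset_closedBall (by simpa [dist_eq_norm] using hx)
  have hsub' : closedBall x₀ (R / 8) ⊆ ball x₀ R := closedBall_subset_ball (by linarith)
  have := (convex_closedBall x₀ (‖x - x₀‖)).norm_image_sub_le_of_norm_fderiv_le' (𝕜 := ℝ)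
    (f := h) (φ := fderiv ℝ h x₀)
    (C := 4 * (4 * (finrank ℝ E + 1)) ^ 2 * M / R ^ 2 * ‖x - x₀‖)
    (fun y hy => (hh y (hsub' (hsub hy))).1.differentiableAt (by norm_num))
    (fun y hy => (norm_fderiv_sub_fderiv_le_of_harmonic hR hh hM (hsub hy)).trans (by
      have : ‖y - x₀‖ ≤ ‖x - x₀‖ := by simpa [dist_eq_norm] using hy
      gcongr))
    (mem_closedBall_self (norm_nonneg _)) (by simp [dist_eq_norm] : x ∈ closedBall x₀ ‖x - x₀‖)
  rw [sq ‖x - x₀‖, ← mul_assoc]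
  exact this

theorem norm_fderiv_le_of_harmonic {h : E → F} {x₀ : E} {R M : ℝ} (hR : 0 < R)
    (hh : ∀ x ∈ ball x₀ R, HarmonicAt h x) (hM : ∀ x ∈ ball x₀ R, ‖h x‖ ≤ M) :
    ‖fderiv ℝ h x₀‖ ≤ 4 * (finrank ℝ E + 1) * M / R := by
  have hM0 : 0 ≤ M := (norm_nonneg _).trans (hM x₀ (mem_ball_self hR))
  refine ((hh x₀ (mem_ball_self hR)).1.differentiableAt (by norm_num)).hasFDerivAt.le_of_lip'
    (by positivity) ?_
  filter_upwards [closedBall_mem_nhds x₀ (show 0 < R / 2 by positivity)] with y hy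
  exact norm_sub_le_of_harmonic hR hh hM hy (mem_closedBall_self (by positivity))

end MaximumPrinciple

/-! ### Approximation of sphere data by harmonic functions with uniform derivative bounds. -/

section PolynomialApproximation

variable {n : ℕ} {F : Type*} [NormedAddCommGroup F] [InnerProductSpace ℝ F]

/-- The function on Euclidean space defined by a polynomial. -/
noncomputable def polyFun (p : MvPolynomial (Fin n) ℝ) (x : EuclideanSpace ℝ (Fin n)) : ℝ :=
  MvPolynomial.eval (fun i => x i) p

theorem contDiff_polyFun (p : MvPolynomial (Fin n) ℝ) {k : WithTop ℕ∞} :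
    ContDiff ℝ k (polyFun p) := by
  induction p using MvPolynomial.induction_on with
  | C a =>
    have : polyFun (MvPolynomial.C a : MvPolynomial (Fin n) ℝ) = fun _ => a := by
      ext; simp [polyFun]
    rw [this]; exact contDiff_const
  | add p q hp hq =>
    have : polyFun (p + q) = fun x => polyFun p x + polyFun q x := by ext; simp [polyFun]
    rw [this]; exact hp.add hq
  | mul_X p i hp =>
    have : polyFun (p * MvPolynomial.X i) = fun x => polyFun p x * x i := by ext; simp [polyFun]
    rw [this]
    exact hp.mul (EuclideanSpace.proj (𝕜 := ℝ) i).contDiff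

theorem fderiv_polyFun_single (p : MvPolynomial (Fin n) ℝ) (x : EuclideanSpace ℝ (Fin n))
    (i : Fin n) :
    fderiv ℝ (polyFun p) x (EuclideanSpace.single i 1) = polyFun (MvPolynomial.pderiv i p) x := by
  have hd : ∀ p : MvPolynomial (Fin n) ℝ, DifferentiableAt ℝ (polyFun p) x := fun p =>
    ((contDiff_polyFun p (k := 1)).differentiable (by norm_num)) x
  induction p using MvPolynomial.induction_on with
  | C a =>
    have : polyFun (MvPolynomial.C a : MvPolynomial (Fin n) ℝ) = fun _ => a := by
      ext; simp [polyFun]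
    rw [this]; simp [polyFun]
  | add p q hp hq =>
    have : polyFun (p + q) = fun x => polyFun p x + polyFun q x := by ext; simp [polyFun]
    rw [this, fderiv_fun_add (hd p) (hd q), add_apply, hp, hq]
    simp [polyFun]
  | mul_X p j hp =>
    have : polyFun (p * MvPolynomial.X j) = fun x => polyFun p x * x j := by ext; simp [polyFun]
    have hj : HasFDerivAt (fun x : EuclideanSpace ℝ (Fin n) => x j)
      (EuclideanSpace.proj (𝕜 := ℝ) j) x := (EuclideanSpace.proj (𝕜 := ℝ) j).hasFDerivAt
    rw [this, ((hd p).hasFDerivAt.fun_mul hj).fderiv]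
    simp only [add_apply, smul_apply, hp,
      MvPolynomial.pderiv_mul, polyFun]
    by_cases hij : i = j
    · subst hij
      simp; ring
    · simp [MvPolynomial.pderiv_X_of_ne (Ne.symm hij), Ne.symm hij]; ring

/-- The Laplacian of a polynomial. -/
noncomputable def polyLaplacian : MvPolynomial (Fin n) ℝ →ₗ[ℝ] MvPolynomial (Fin n) ℝ :=
  ∑ i, (MvPolynomial.pderiv i).toLinearMap ∘ₗ (MvPolynomial.pderiv i).toLinearMap

theorem laplacian_polyFun (p : MvPolynomial (Fin n) ℝ) (x : EuclideanSpace ℝ (Fin n)) :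
    Δ (polyFun p) x = polyFun (polyLaplacian p) x := by
  rw [laplacian_eq_sum_fderiv_fderiv (EuclideanSpace.basisFun (Fin n) ℝ)]
  have : polyFun (polyLaplacian p) x =
      ∑ i, polyFun (MvPolynomial.pderiv i (MvPolynomial.pderiv i p)) x := by
    simp [polyLaplacian, polyFun, LinearMap.sum_apply]
  rw [this]
  refine Finset.sum_congr rfl fun i _ => ?_
  rw [EuclideanSpace.basisFun_apply, ← fderiv_polyFun_single]
  have h1 : (fun y => fderiv ℝ (polyFun p) y (EuclideanSpace.single i 1)) =
      polyFun (MvPolynomial.pderiv i p) := by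
    ext y; exact fderiv_polyFun_single p y i
  rw [← h1]
  have h2 : DifferentiableAt ℝ (fderiv ℝ (polyFun p)) x :=
    ((contDiff_polyFun p (k := 2)).fderiv_right (m := 1) (by norm_num)).differentiable
      (by norm_num) x
  rw [fderiv_clm_apply h2 (differentiableAt_const _)]
  simp

theorem harmonicAt_polyFun {p : MvPolynomial (Fin n) ℝ} (hp : polyLaplacian p = 0)
    (x : EuclideanSpace ℝ (Fin n)) : HarmonicAt (polyFun p) x :=
  ⟨(contDiff_polyFun p).contDiffAt, Eventually.of_forall fun y => by
    rw [laplacian_polyFun, hp]; simp [polyFun]⟩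

theorem totalDegree_pderiv_le {p : MvPolynomial (Fin n) ℝ} {k : ℕ} (hp : p.totalDegree ≤ k + 1)
    (i : Fin n) : (MvPolynomial.pderiv i p).totalDegree ≤ k := by
  rw [MvPolynomial.totalDegree]
  refine Finset.sup_le fun s hs => ?_
  rw [MvPolynomial.mem_support_iff, MvPolynomial.coeff_pderiv] at hs
  have h1 : s + Finsupp.single i 1 ∈ p.support :=
    MvPolynomial.mem_support_iff.2 fun h => hs (by simp [h])
  have h2 := (MvPolynomial.le_totalDegree h1).trans hp
  rw [Finsupp.sum_add_index' (by simp) (by simp), Finsupp.sum_single_index rfl] at h2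
  omega

/-- The ball contains a product of intervals, and a polynomial vanishing on a product of infinite
sets is zero. -/
theorem eq_zero_of_polyFun_eq_zero_on_ball {p : MvPolynomial (Fin n) ℝ} {R : ℝ} (hR : 0 < R)
    (h : ∀ x ∈ ball (0 : EuclideanSpace ℝ (Fin n)) R, polyFun p x = 0) : p = 0 := by
  have hU : (WithLp.toLp 2 : (Fin n → ℝ) → EuclideanSpace ℝ (Fin n)) ⁻¹' ball 0 R ∈
      𝓝 (0 : Fin n → ℝ) := by
    refine (PiLp.continuous_toLp 2 _).continuousAt.preimage_mem_nhds ?_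
    exact ball_mem_nhds _ hR
  obtain ⟨r, hr, hrs⟩ := Metric.mem_nhds_iff.1 hU
  refine MvPolynomial.funext_set (fun _ => ball (0 : ℝ) r) (fun _ => ?_) fun x hx => ?_
  · rw [Real.ball_eq_Ioo]; exact Set.Ioo_infinite (by linarith)
  · have hx' : x ∈ ball (0 : Fin n → ℝ) r := by
      rw [ball_pi _ hr]; exact hx
    have := h _ (hrs hx')
    simpa [polyFun] using this

theorem polyFun_sphere_factor (R : ℝ) (x : EuclideanSpace ℝ (Fin n)) :
    polyFun (MvPolynomial.C (R ^ 2) - ∑ i, MvPolynomial.X i ^ 2) x = R ^ 2 - ‖x‖ ^ 2 := by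
  simp [polyFun, EuclideanSpace.norm_sq_eq]

/-- On a sphere every polynomial coincides with a harmonic polynomial. -/
theorem exists_harmonic_polynomial_eq_on_sphere [Nonempty (Fin n)] {R : ℝ} (hR : 0 < R)
    (p : MvPolynomial (Fin n) ℝ) : ∃ q : MvPolynomial (Fin n) ℝ, polyLaplacian q = 0 ∧
      ∀ x ∈ sphere (0 : EuclideanSpace ℝ (Fin n)) R, polyFun q x = polyFun p x := by
  set w : MvPolynomial (Fin n) ℝ := MvPolynomial.C (R ^ 2) - ∑ i, MvPolynomial.X i ^ 2 with hw
  set k := p.totalDegree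
  set V := MvPolynomial.restrictTotalDegree (Fin n) ℝ k with hV
  have hwd : w.totalDegree ≤ 2 := by
    refine (MvPolynomial.totalDegree_sub _ _).trans (max_le (by rw [MvPolynomial.totalDegree_C]; omega) ?_)
    exact MvPolynomial.totalDegree_finsetSum_le fun i _ => by simp
  have hlap : ∀ q : MvPolynomial (Fin n) ℝ, ∀ j, q.totalDegree ≤ j + 2 →
      (polyLaplacian q).totalDegree ≤ j := fun q j hq => by
    simp only [polyLaplacian, LinearMap.sum_apply]
    exact MvPolynomial.totalDegree_finsetSum_le fun i _ =>
      totalDegree_pderiv_le (totalDegree_pderiv_le hq i) i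
  -- Multiplication by `w = R² - |x|²` raises the degree by two and the Laplacian lowers it back, so
  -- `T` acts on the finite-dimensional `V`. By the maximum principle `T` is injective, hence
  -- surjective; subtracting a suitable `w * q` from `p` removes its Laplacian and keeps its values
  -- on the sphere.
  set T : MvPolynomial (Fin n) ℝ →ₗ[ℝ] MvPolynomial (Fin n) ℝ :=
    polyLaplacian ∘ₗ LinearMap.mulLeft ℝ w with hT
  have hTV : ∀ q ∈ V, T q ∈ V := fun q hq => by
    rw [hV, MvPolynomial.mem_restrictTotalDegree] at hq ⊢
    refine hlap _ _ ((MvPolynomial.totalDegree_mul _ _).trans ?_)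
    omega
  set T' : V →ₗ[ℝ] V := T.restrict hTV
  have hwv : ∀ q (x : EuclideanSpace ℝ (Fin n)),
      polyFun (w * q) x = (R ^ 2 - ‖x‖ ^ 2) * polyFun q x := fun q x => by
    rw [← polyFun_sphere_factor]; simp [polyFun, hw]
  have hinj : Function.Injective T' := by
    rw [← LinearMap.ker_eq_bot, LinearMap.ker_eq_bot']
    rintro ⟨q, hq⟩ h0
    have h0 : polyLaplacian (w * q) = 0 := congrArg Subtype.val h0
    have hle : ∀ s : ℝ, ∀ x ∈ closedBall (0 : EuclideanSpace ℝ (Fin n)) R,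
        (s • polyFun (w * q)) x ≤ 0 := by
      intro s
      refine le_of_harmonic_or_le (isCompact_closedBall _ _)
        ((contDiff_polyFun (w * q) (k := 2)).continuous.const_smul s).continuousOn fun x hx => ?_
      rcases (mem_closedBall.1 hx).eq_or_lt with h1 | h1
      · left
        rw [dist_zero_right] at h1
        simp [hwv, h1]
      · right
        exact ⟨ball_subset_interior_closedBall h1, (harmonicAt_polyFun h0 x).const_smul⟩
    have hq0 : q = 0 := by
      refine eq_zero_of_polyFun_eq_zero_on_ball hR fun x hx => ?_
      have h1 := hle 1 x (ball_subset_closedBall hx)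
      have h2 := hle (-1) x (ball_subset_closedBall hx)
      simp only [Pi.smul_apply, smul_eq_mul] at h1 h2
      have h3 : polyFun (w * q) x = 0 := by linarith
      rw [hwv] at h3
      rw [mem_ball, dist_zero_right] at hx
      have h4 : R ^ 2 - ‖x‖ ^ 2 ≠ 0 := by nlinarith [norm_nonneg x]
      exact (mul_eq_zero.1 h3).resolve_left h4
    simp [hq0]
  obtain ⟨⟨q, hq⟩, hqT⟩ := LinearMap.surjective_of_injective hinj
    (⟨polyLaplacian p, by
      rw [hV, MvPolynomial.mem_restrictTotalDegree]; exact hlap _ _ (by omega)⟩ : V)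
  have hqT : polyLaplacian (w * q) = polyLaplacian p := congrArg Subtype.val hqT
  refine ⟨p - w * q, by rw [map_sub, hqT, sub_self], fun x hx => ?_⟩
  have h1 : polyFun (p - w * q) x = polyFun p x - polyFun (w * q) x := by simp [polyFun]
  rw [h1, hwv, mem_sphere_zero_iff_norm.1 hx]
  ring

/-- Harmonic polynomials are dense in the continuous functions on a sphere. -/
theorem exists_harmonic_polynomial_near [Nonempty (Fin n)] {R δ : ℝ} (hR : 0 < R) (hδ : 0 < δ)
    (ψ : sphere (0 : EuclideanSpace ℝ (Fin n)) R → ℝ) (hψ : Continuous ψ) :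
    ∃ q : MvPolynomial (Fin n) ℝ, polyLaplacian q = 0 ∧ ∀ x : sphere (0 : EuclideanSpace ℝ (Fin n)) R, |polyFun q x - ψ x| ≤ δ := by
  let c : Fin n → C(sphere (0 : EuclideanSpace ℝ (Fin n)) R, ℝ) := fun i =>
    ⟨fun x => (x : EuclideanSpace ℝ (Fin n)) i, by fun_prop⟩
  let A := (MvPolynomial.aeval (R := ℝ) c).range
  have hA : A.SeparatesPoints := by
    intro x y hxy
    have : ∃ i, (x : EuclideanSpace ℝ (Fin n)) i ≠ (y : EuclideanSpace ℝ (Fin n)) i := by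
      by_contra! h
      exact hxy (Subtype.ext (by ext i; exact h i))
    obtain ⟨i, hi⟩ := this
    exact ⟨c i, ⟨c i, ⟨MvPolynomial.X i, by simp⟩, rfl⟩, hi⟩
  -- Stone–Weierstrass for the algebra generated by the coordinates; afterwards the polynomial is
  -- exchanged for a harmonic one with the same values on the sphere.
  obtain ⟨⟨g, p, rfl⟩, hg⟩ :=
    ContinuousMap.exists_mem_subalgebra_near_continuous_of_separatesPoints A hA ψ hψ δ hδ
  have hp : ∀ x, (MvPolynomial.aeval (R := ℝ) c p) x = polyFun p (x : EuclideanSpace ℝ (Fin n)) := fun x => by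
    have : (MvPolynomial.aeval (R := ℝ) c p) x =
        (ContinuousMap.evalAlgHom ℝ ℝ x) (MvPolynomial.aeval (R := ℝ) c p) := rfl
    rw [this, ← AlgHom.comp_apply, MvPolynomial.comp_aeval]
    rw [polyFun, ← MvPolynomial.coe_aeval_eq_eval]
    rfl
  obtain ⟨q, hq, hqp⟩ := exists_harmonic_polynomial_eq_on_sphere hR p
  refine ⟨q, hq, fun x => ?_⟩
  rw [hqp x x.2, ← hp]
  exact (hg x).le

theorem exists_fderiv_bound_on_closedBall {G : Type*} [NormedAddCommGroup G] [NormedSpace ℝ G]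
    {h : EuclideanSpace ℝ (Fin n) → G} (hh : ContDiff ℝ 1 h) (R : ℝ) :
    ∃ K : ℝ, ∀ x ∈ closedBall 0 R, ‖fderiv ℝ h x‖ ≤ K := by
  obtain ⟨K, hK⟩ := (isCompact_closedBall (0 : EuclideanSpace ℝ (Fin n)) R).bddAbove_image
    (hh.fderiv_right (m := 0) (by norm_num)).continuous.norm.continuousOn
  exact ⟨K, fun x hx => hK (mem_image_of_mem _ hx)⟩

theorem exists_fderiv_bounds_on_closedBall {G : Type*} [NormedAddCommGroup G] [NormedSpace ℝ G]
    {h : EuclideanSpace ℝ (Fin n) → G} (hh : ContDiff ℝ 2 h) (R : ℝ) :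
    ∃ K : ℝ, 0 ≤ K ∧ (∀ x ∈ closedBall 0 R, ‖fderiv ℝ h x‖ ≤ K) ∧
      ∀ x ∈ closedBall 0 R, ∀ y ∈ closedBall 0 R,
        ‖fderiv ℝ h x - fderiv ℝ h y‖ ≤ K * ‖x - y‖ := by
  have h1 : ContDiff ℝ 1 (fderiv ℝ h) := hh.fderiv_right (by norm_num)
  obtain ⟨K₁, hK₁⟩ := exists_fderiv_bound_on_closedBall (hh.of_le (by norm_num)) R
  obtain ⟨K₂, hK₂⟩ := exists_fderiv_bound_on_closedBall h1 R
  refine ⟨max 0 (max K₁ K₂), le_max_left _ _, fun x hx => (hK₁ x hx).trans (by simp), ?_⟩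
  intro x hx y hy
  exact (convex_closedBall _ _).norm_image_sub_le_of_norm_fderiv_le (𝕜 := ℝ)
    (fun z _ => h1.differentiable (by norm_num) z)
    (fun z hz => (hK₂ z hz).trans (by simp)) hy hx

theorem InnerProductSpace.HarmonicAt.sum {E G ι : Type*} [NormedAddCommGroup E]
    [InnerProductSpace ℝ E] [FiniteDimensional ℝ E] [NormedAddCommGroup G] [NormedSpace ℝ G]
    {h : ι → E → G} {x : E} (s : Finset ι) (hh : ∀ i ∈ s, HarmonicAt (h i) x) :
    HarmonicAt (fun y => ∑ i ∈ s, h i y) x := by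
  classical
  induction s using Finset.induction_on with
  | empty => simp
  | insert a s ha ih =>
    simp only [Finset.sum_insert ha]
    exact (hh a (Finset.mem_insert_self _ _)).add
      (ih fun i hi => hh i (Finset.mem_insert_of_mem hi))

/-- Functions on a sphere which oscillate little at a fixed scale are close to harmonic functions
with a bound on the first two derivatives that depends on the scale only. -/
theorem exists_harmonic_approx [Nonempty (Fin n)] {R δ ρ : ℝ} (hR : 0 < R) (hδ : 0 < δ)
    (hρ : 0 < ρ) :
    ∃ K : ℝ, 0 ≤ K ∧ ∀ W : EuclideanSpace ℝ (Fin n) → F, (∀ x ∈ sphere 0 R, ‖W x‖ ≤ 1) →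
      (∀ x ∈ sphere 0 R, ∀ y ∈ sphere 0 R, ‖x - y‖ < ρ → ‖W x - W y‖ ≤ δ) →
      ∃ P : EuclideanSpace ℝ (Fin n) → F, (∀ x, HarmonicAt P x) ∧
        (∀ x ∈ sphere 0 R, ‖P x - W x‖ ≤ 2 * δ) ∧
        (∀ x ∈ closedBall 0 R, ‖fderiv ℝ P x‖ ≤ K) ∧
        ∀ x ∈ closedBall 0 R, ∀ y ∈ closedBall 0 R,
          ‖fderiv ℝ P x - fderiv ℝ P y‖ ≤ K * ‖x - y‖ := by
  -- The net, the partition of unity `χ z / S` and its harmonic approximations `q z` are all fixed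
  -- before `W`, which enters only through its values at the net points. This is why `K` does not
  -- depend on `W`.
  obtain ⟨t, hts, htf, hcov⟩ :=
    (isCompact_sphere (0 : EuclideanSpace ℝ (Fin n)) R).finite_cover_balls hρ
  set T := htf.toFinset with hT
  have hTs : ∀ z ∈ T, z ∈ sphere (0 : EuclideanSpace ℝ (Fin n)) R := fun z hz =>
    hts (htf.mem_toFinset.1 hz)
  set χ : EuclideanSpace ℝ (Fin n) → EuclideanSpace ℝ (Fin n) → ℝ :=
    fun z x => max (ρ - ‖x - z‖) 0 with hχ
  have hχ0 : ∀ z x, 0 ≤ χ z x := fun z x => le_max_right _ _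
  have hχc : ∀ z, Continuous (χ z) := fun z => by
    simp only [hχ]; fun_prop
  set S : EuclideanSpace ℝ (Fin n) → ℝ := fun x => ∑ z ∈ T, χ z x with hS
  have hSpos : ∀ x ∈ sphere (0 : EuclideanSpace ℝ (Fin n)) R, 0 < S x := fun x hx => by
    obtain ⟨z, hz, hxz⟩ := mem_iUnion₂.1 (hcov hx)
    refine Finset.sum_pos' (fun _ _ => hχ0 _ _) ⟨z, htf.mem_toFinset.2 hz, ?_⟩
    rw [mem_ball, dist_eq_norm] at hxz
    exact lt_max_of_lt_left (by linarith)
  -- Replacing all the weights by polynomials then costs at most `δ` in total; the other `δ` is the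
  -- oscillation of `W` at scale `ρ`.
  set η : ℝ := δ / (T.card + 1) with hη
  have hη0 : 0 < η := by positivity
  have hψ : ∀ z, ∃ q : MvPolynomial (Fin n) ℝ, polyLaplacian q = 0 ∧
      ∀ x : sphere (0 : EuclideanSpace ℝ (Fin n)) R, |polyFun q x - χ z x / S x| ≤ η := fun z => by
    refine exists_harmonic_polynomial_near hR hη0
      (fun x : sphere (0 : EuclideanSpace ℝ (Fin n)) R => χ z x / S x) ?_
    refine ((hχc z).comp continuous_subtype_val).div₀ ?_ fun x => (hSpos x x.2).ne'
    exact (continuous_finsetSum _ fun z _ => hχc z).comp continuous_subtype_val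
  choose q hq hqψ using hψ
  have hb : ∀ z, ∃ K : ℝ, 0 ≤ K ∧ (∀ x ∈ closedBall 0 R, ‖fderiv ℝ (polyFun (q z)) x‖ ≤ K) ∧
      ∀ x ∈ closedBall 0 R, ∀ y ∈ closedBall 0 R,
        ‖fderiv ℝ (polyFun (q z)) x - fderiv ℝ (polyFun (q z)) y‖ ≤ K * ‖x - y‖ := fun z =>
    exists_fderiv_bounds_on_closedBall (contDiff_polyFun (q z)) R
  choose K hK0 hK1 hK2 using hb
  refine ⟨∑ z ∈ T, K z, Finset.sum_nonneg fun z _ => hK0 z, fun W hW1 hW2 => ?_⟩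
  set P : EuclideanSpace ℝ (Fin n) → F := fun x => ∑ z ∈ T, polyFun (q z) x • W z with hP
  have hPd : ∀ x, fderiv ℝ P x = ∑ z ∈ T, (fderiv ℝ (polyFun (q z)) x).smulRight (W z) := fun x =>
    (HasFDerivAt.fun_sum fun z _ =>
      (((contDiff_polyFun (q z) (k := 1)).differentiable (by norm_num)) x).hasFDerivAt.smul_const
        (W z)).fderiv
  refine ⟨P, fun x => ?_, fun x hx => ?_, fun x hx => ?_, fun x hx y hy => ?_⟩
  · refine HarmonicAt.sum T fun z _ => ?_
    exact (harmonicAt_polyFun (hq z) x).comp_CLM ((ContinuousLinearMap.id ℝ ℝ).smulRight (W z))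
  · have hSx := hSpos x hx
    have h1 : W x = ∑ z ∈ T, (χ z x / S x) • W x := by
      rw [← Finset.sum_smul, ← Finset.sum_div, div_self hSx.ne', one_smul]
    have h2 : P x - W x = ∑ z ∈ T, ((polyFun (q z) x - χ z x / S x) • W z) +
        ∑ z ∈ T, (χ z x / S x) • (W z - W x) := by
      conv_lhs => rw [h1]
      simp only [hP, smul_sub, sub_smul, Finset.sum_sub_distrib]
      abel
    have h3 : ‖∑ z ∈ T, ((polyFun (q z) x - χ z x / S x) • W z)‖ ≤ δ := by
      refine (norm_sum_le _ _).trans ?_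
      calc ∑ z ∈ T, ‖(polyFun (q z) x - χ z x / S x) • W z‖ ≤ ∑ z ∈ T, η := by
            refine Finset.sum_le_sum fun z hz => ?_
            rw [norm_smul, Real.norm_eq_abs]
            calc _ ≤ η * 1 := mul_le_mul (hqψ z ⟨x, hx⟩) (hW1 z (hTs z hz)) (norm_nonneg _) hη0.le
              _ = η := mul_one _
        _ = T.card * η := by rw [Finset.sum_const, nsmul_eq_mul]
        _ ≤ δ := by
          rw [hη, mul_div_assoc', div_le_iff₀ (Nat.cast_add_one_pos _)]
          nlinarith
    have h4 : ‖∑ z ∈ T, (χ z x / S x) • (W z - W x)‖ ≤ δ := by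
      refine (norm_sum_le _ _).trans ?_
      calc ∑ z ∈ T, ‖(χ z x / S x) • (W z - W x)‖ ≤ ∑ z ∈ T, (χ z x / S x) * δ := by
            refine Finset.sum_le_sum fun z hz => ?_
            rw [norm_smul, Real.norm_of_nonneg (div_nonneg (hχ0 _ _) hSx.le)]
            by_cases hzx : ‖x - z‖ < ρ
            · refine mul_le_mul_of_nonneg_left ?_ (div_nonneg (hχ0 _ _) hSx.le)
              rw [norm_sub_rev] at hzx
              exact hW2 z (hTs z hz) x hx hzx
            · have : χ z x = 0 := max_eq_right (by linarith)
              simp [this]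
        _ = δ := by rw [← Finset.sum_mul, ← Finset.sum_div, div_self hSx.ne', one_mul]
    rw [h2]
    exact (norm_add_le _ _).trans (by linarith)
  · rw [hPd]
    refine (norm_sum_le _ _).trans (Finset.sum_le_sum fun z hz => ?_)
    rw [ContinuousLinearMap.norm_smulRight_apply]
    calc _ ≤ K z * 1 := mul_le_mul (hK1 z x hx) (hW1 z (hTs z hz)) (norm_nonneg _) (hK0 z)
      _ = K z := mul_one _
  · rw [hPd, hPd, ← Finset.sum_sub_distrib, Finset.sum_mul]
    refine (norm_sum_le _ _).trans (Finset.sum_le_sum fun z hz => ?_)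
    have : (fderiv ℝ (polyFun (q z)) x).smulRight (W z) -
        (fderiv ℝ (polyFun (q z)) y).smulRight (W z) =
        (fderiv ℝ (polyFun (q z)) x - fderiv ℝ (polyFun (q z)) y).smulRight (W z) := by
      ext v
      simp only [sub_apply, ContinuousLinearMap.smulRight_apply, sub_smul]
    rw [this, ContinuousLinearMap.norm_smulRight_apply]
    calc _ ≤ (K z * ‖x - y‖) * 1 := mul_le_mul (hK2 z x hx y hy) (hW1 z (hTs z hz))
          (norm_nonneg _) (mul_nonneg (hK0 z) (norm_nonneg _))
      _ = _ := mul_one _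

end PolynomialApproximation

/-! ### Comparison principles for viscosity solutions, and rescaling. -/

section Viscosity

variable {n m : ℕ} {U : EuclideanSpace ℝ (Fin n) → EuclideanSpace ℝ (Fin m)}

theorem norm_gradient_eq {φ : EuclideanSpace ℝ (Fin n) → ℝ} {x : EuclideanSpace ℝ (Fin n)} :
    ‖gradient φ x‖ = ‖fderiv ℝ φ x‖ := by
  simp [gradient]

theorem isOpen_positivitySet (hU : ContinuousOn U (ball 0 1)) :
    IsOpen (positivitySet (ball 0 1) U) :=
  hU.norm.isOpen_inter_preimage isOpen_ball isOpen_Ioi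

theorem mem_positivitySet_iff {x : EuclideanSpace ℝ (Fin n)} :
    x ∈ positivitySet (ball 0 1) U ↔ x ∈ ball (0 : EuclideanSpace ℝ (Fin n)) 1 ∧ U x ≠ 0 := by
  simp [positivitySet]

theorem mem_freeBoundary_iff (hU : ContinuousOn U (ball 0 1)) {x : EuclideanSpace ℝ (Fin n)} :
    x ∈ freeBoundary (ball 0 1) U ↔ x ∈ ball (0 : EuclideanSpace ℝ (Fin n)) 1 ∧ U x = 0 ∧
      x ∈ closure (positivitySet (ball 0 1) U) := by
  rw [freeBoundary, (isOpen_positivitySet hU).frontier_eq]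
  simp only [mem_inter_iff, Set.mem_sdiff, mem_positivitySet_iff]
  tauto

theorem eventually_eq_zero_of_notMem_closure {x : EuclideanSpace ℝ (Fin n)}
    (hx : x ∈ ball (0 : EuclideanSpace ℝ (Fin n)) 1)
    (hxc : x ∉ closure (positivitySet (ball 0 1) U)) : ∀ᶠ y in 𝓝 x, U y = 0 := by
  filter_upwards [isClosed_closure.isOpen_compl.mem_nhds hxc, isOpen_ball.mem_nhds hx] with y hy hyb
  by_contra h
  exact hy (subset_closure (mem_positivitySet_iff.2 ⟨hyb, h⟩))

theorem IsViscositySolution.harmonicAt (hU : IsViscositySolution (ball 0 1) U)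
    {x : EuclideanSpace ℝ (Fin n)} (hx : x ∈ ball (0 : EuclideanSpace ℝ (Fin n)) 1)
    (hx0 : U x ≠ 0) : HarmonicAt U x := by
  have h1 : HarmonicAt (fun y => ∑ i, U y i • (EuclideanSpace.single i (1 : ℝ) :
      EuclideanSpace ℝ (Fin m))) x := by
    refine HarmonicAt.sum _ fun i _ => ?_
    exact (hU.harmonic i x (mem_positivitySet_iff.2 ⟨hx, hx0⟩)).comp_CLM
      ((ContinuousLinearMap.id ℝ ℝ).smulRight (EuclideanSpace.single i (1 : ℝ)))
  refine (harmonicAt_congr_nhds (Eventually.of_forall fun y => ?_)).1 h1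
  ext j
  simp [Finset.sum_apply, Pi.single_apply]

/-- A negative minimum of `⟨U, f⟩ - φ` is interior, and three cases arise. On the free boundary a
translate of `φ` with slope above one touches from below; inside the zero set `φ` itself has a local
maximum; where `U ≠ 0` the difference is strictly superharmonic. All three are impossible. -/
theorem IsViscositySolution.le_inner (hU : IsViscositySolution (ball 0 1) U)
    {f : EuclideanSpace ℝ (Fin m)} (hf : ‖f‖ = 1) {K : Set (EuclideanSpace ℝ (Fin n))}
    (hK : IsCompact K) (hKb : K ⊆ ball 0 1) {φ : EuclideanSpace ℝ (Fin n) → ℝ}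
    (hφc : ContinuousOn φ K)
    (hφ : ∀ x ∈ interior K, ContDiffAt ℝ 2 φ x ∧ 0 < Δ φ x ∧
      (x ∈ freeBoundary (ball 0 1) U → 1 < ‖fderiv ℝ φ x‖))
    (hb : ∀ x ∈ K, x ∉ interior K → φ x ≤ ⟪U x, f⟫_ℝ) :
    ∀ x ∈ K, φ x ≤ ⟪U x, f⟫_ℝ := by
  intro y hy
  by_contra hlt
  push Not at hlt
  have hcont : ContinuousOn (fun x => ⟪U x, f⟫_ℝ - φ x) K :=
    ((hU.continuousOn.mono hKb).inner continuousOn_const).sub hφc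
  obtain ⟨x, hxK, hmin⟩ := hK.exists_isMinOn ⟨y, hy⟩ hcont
  set s : ℝ := ⟪U x, f⟫_ℝ - φ x with hs
  have hs0 : s < 0 := by
    have : ⟪U x, f⟫_ℝ - φ x ≤ ⟪U y, f⟫_ℝ - φ y := hmin hy
    linarith
  have hxi : x ∈ interior K := by
    by_contra h
    linarith [hb x hxK h]
  have hnear : ∀ᶠ z in 𝓝 x, φ z + s ≤ ⟪U z, f⟫_ℝ := by
    filter_upwards [mem_interior_iff_mem_nhds.1 hxi] with z hz
    have : ⟪U x, f⟫_ℝ - φ x ≤ ⟪U z, f⟫_ℝ - φ z := hmin hz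
    linarith
  obtain ⟨hφ2, hφΔ, hφF⟩ := hφ x hxi
  by_cases hUx : U x = 0
  · by_cases hxc : x ∈ closure (positivitySet (ball 0 1) U)
    · have hxF := (mem_freeBoundary_iff hU.continuousOn).2 ⟨hKb hxK, hUx, hxc⟩
      refine hU.below x hxF (fun z => φ z + s) (hφ2.add contDiffAt_const) ?_ f hf ⟨by ring, hnear⟩
      rw [norm_gradient_eq, fderiv_add_const]
      exact hφF hxF
    · have h0 := eventually_eq_zero_of_notMem_closure (hKb hxK) hxc
      have hmax : IsLocalMax φ x := by
        filter_upwards [hnear, h0] with z hz hz0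
        rw [hz0, inner_zero_left] at hz
        rw [hUx, inner_zero_left] at hs
        linarith
      linarith [hmax.laplacian_nonpos hφ2]
  · have hh := (hU.harmonicAt (hKb hxK) hUx).inner_const f
    have hmin' : IsLocalMin ((fun z => ⟪U z, f⟫_ℝ) - φ) x :=
      hmin.isLocalMin (mem_interior_iff_mem_nhds.1 hxi)
    have h1 : 0 ≤ Δ ((fun z => ⟪U z, f⟫_ℝ) - φ) x := hmin'.laplacian_nonneg (hh.1.sub hφ2)
    rw [hh.1.laplacian_sub hφ2, hh.2.self_of_nhds] at h1
    simp at h1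
    linarith

/-- The maximum of `|U| - φ` is taken over the closure of the positivity set only, since elsewhere
any positive part dominates `|U| = 0`. If it is positive and attained at a zero of `U`, the
translate of `φ` vanishes there and its positive part touches `|U|` from above. -/
theorem IsViscositySolution.norm_le (hU : IsViscositySolution (ball 0 1) U)
    {K : Set (EuclideanSpace ℝ (Fin n))}
    (hK : IsCompact K) (hKb : K ⊆ ball 0 1) {φ : EuclideanSpace ℝ (Fin n) → ℝ}
    (hφc : ContinuousOn φ K)
    (hφ : ∀ x ∈ interior K, ContDiffAt ℝ 2 φ x ∧ Δ φ x < 0 ∧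
      (x ∈ freeBoundary (ball 0 1) U → fderiv ℝ φ x ≠ 0 ∧ ‖fderiv ℝ φ x‖ < 1))
    (hb : ∀ x ∈ K, x ∉ interior K → x ∈ closure (positivitySet (ball 0 1) U) → ‖U x‖ ≤ φ x) :
    ∀ x ∈ K, x ∈ closure (positivitySet (ball 0 1) U) → ‖U x‖ ≤ φ x := by
  intro y hy hyc
  by_contra hlt
  push Not at hlt
  set C := closure (positivitySet (ball 0 1) U) with hC
  have hcont : ContinuousOn (fun x => ‖U x‖ - φ x) K :=
    (hU.continuousOn.mono hKb).norm.sub hφc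
  obtain ⟨x, ⟨hxK, hxc⟩, hmax⟩ := (hK.inter_right isClosed_closure).exists_isMaxOn ⟨y, hy, hyc⟩
    (hcont.mono inter_subset_left)
  set s : ℝ := ‖U x‖ - φ x with hs
  have hs0 : 0 < s := by
    have : ‖U y‖ - φ y ≤ ‖U x‖ - φ x := hmax ⟨hy, hyc⟩
    linarith
  have hxi : x ∈ interior K := by
    by_contra h
    linarith [hb x hxK h hxc]
  have hnear : ∀ᶠ z in 𝓝 x, U z ≠ 0 → ‖U z‖ ≤ φ z + s := by
    filter_upwards [mem_interior_iff_mem_nhds.1 hxi] with z hz hz0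
    have : ‖U z‖ - φ z ≤ ‖U x‖ - φ x :=
      hmax ⟨hz, subset_closure (mem_positivitySet_iff.2 ⟨hKb hz, hz0⟩)⟩
    linarith
  obtain ⟨hφ2, hφΔ, hφF⟩ := hφ x hxi
  by_cases hUx : U x = 0
  · have hxF := (mem_freeBoundary_iff hU.continuousOn).2 ⟨hKb hxK, hUx, hxc⟩
    obtain ⟨h1, h2⟩ := hφF hxF
    have hval : φ x + s = 0 := by rw [hs, hUx, norm_zero]; ring
    refine hU.above x hxF (fun z => φ z + s) (hφ2.add contDiffAt_const) ?_ ?_ ⟨?_, ?_⟩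
    · rw [← norm_ne_zero_iff, norm_gradient_eq, fderiv_add_const]
      exact norm_ne_zero_iff.2 h1
    · rwa [norm_gradient_eq, fderiv_add_const]
    · simp [hval, hUx]
    · filter_upwards [hnear] with z hz
      by_cases hz0 : U z = 0
      · simp [hz0]
      · exact (hz hz0).trans (le_max_left _ _)
  -- `⟨U, g⟩` is harmonic, lies below `|U|` and equals it at `x`, so the norm never has to be
  -- differentiated.
  · set g : EuclideanSpace ℝ (Fin m) := ‖U x‖⁻¹ • U x with hg
    have hUn : ‖U x‖ ≠ 0 := norm_ne_zero_iff.2 hUx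
    have hgn : ‖g‖ = 1 := by rw [hg, norm_smul, norm_inv, norm_norm, inv_mul_cancel₀ hUn]
    have hgx : ⟪U x, g⟫_ℝ = ‖U x‖ := by
      rw [hg, inner_smul_right, real_inner_self_eq_norm_sq, sq, ← mul_assoc, inv_mul_cancel₀ hUn,
        one_mul]
    have hh := (hU.harmonicAt (hKb hxK) hUx).inner_const g
    have hne : ∀ᶠ z in 𝓝 x, U z ≠ 0 :=
      (hU.continuousOn.continuousAt (isOpen_ball.mem_nhds (hKb hxK))).eventually_ne hUx
    have hmax' : IsLocalMax ((fun z => ⟪U z, g⟫_ℝ) - φ) x := by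
      filter_upwards [hnear, hne] with z hz hz0
      have h1 : ⟪U z, g⟫_ℝ ≤ ‖U z‖ := by
        have := real_inner_le_norm (U z) g
        rwa [hgn, mul_one] at this
      simp only [Pi.sub_apply, hgx]
      linarith [hz hz0]
    have h1 : Δ ((fun z => ⟪U z, g⟫_ℝ) - φ) x ≤ 0 := hmax'.laplacian_nonpos (hh.1.sub hφ2)
    rw [hh.1.laplacian_sub hφ2, hh.2.self_of_nhds] at h1
    simp at h1
    linarith

theorem contDiffAt_affine_add {e : EuclideanSpace ℝ (Fin n)} {a η : ℝ}
    {w : EuclideanSpace ℝ (Fin n) → ℝ} {x : EuclideanSpace ℝ (Fin n)} (hw : ContDiffAt ℝ 2 w x) :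
    ContDiffAt ℝ 2 (fun y => ⟪e, y⟫_ℝ + a + η * w y) x :=
  ((contDiffAt_const.inner ℝ contDiffAt_id).add contDiffAt_const).add (contDiffAt_const.mul hw)

theorem fderiv_affine_add {e : EuclideanSpace ℝ (Fin n)} {a η : ℝ}
    {w : EuclideanSpace ℝ (Fin n) → ℝ} {x : EuclideanSpace ℝ (Fin n)} (hw : ContDiffAt ℝ 2 w x) :
    fderiv ℝ (fun y => ⟪e, y⟫_ℝ + a + η * w y) x = innerSL ℝ e + η • fderiv ℝ w x := by
  have h1 : HasFDerivAt (fun y : EuclideanSpace ℝ (Fin n) => ⟪e, y⟫_ℝ) (innerSL ℝ e) x :=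
    (innerSL ℝ e).hasFDerivAt
  exact ((h1.add_const a).add ((hw.differentiableAt (by norm_num)).hasFDerivAt.const_mul η)).fderiv

theorem laplacian_affine_add {e : EuclideanSpace ℝ (Fin n)} {a η : ℝ}
    {w : EuclideanSpace ℝ (Fin n) → ℝ} {x : EuclideanSpace ℝ (Fin n)} (hw : ContDiffAt ℝ 2 w x) :
    Δ (fun y => ⟪e, y⟫_ℝ + a + η * w y) x = η * Δ w x := by
  have h1 : (fun y => ⟪e, y⟫_ℝ + a + η * w y) = quadFun a 0 0 e 0 0 + η • w := by
    ext y; simp [quadFun]; ring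
  have h2 : ContDiffAt ℝ 2 (η • w) x := hw.const_smul η
  rw [h1, (contDiff_quadFun _ _ _ _ _ _).contDiffAt.laplacian_add h2,
    laplacian_quadFun, laplacian_smul η hw]
  simp

/-- Comparison from below with a perturbation of an affine function. -/
theorem IsViscositySolution.affine_add_le_inner (hU : IsViscositySolution (ball 0 1) U)
    {e : EuclideanSpace ℝ (Fin n)} (he : ‖e‖ = 1)
    {f : EuclideanSpace ℝ (Fin m)} (hf : ‖f‖ = 1) {K : Set (EuclideanSpace ℝ (Fin n))}
    (hK : IsCompact K) (hKb : K ⊆ ball 0 1) {w : EuclideanSpace ℝ (Fin n) → ℝ}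
    (hw : ContDiff ℝ 2 w) {a η : ℝ} (hη : 0 < η)
    (hΔ : ∀ x ∈ interior K, 0 < Δ w x)
    (hF : ∀ x ∈ interior K, x ∈ freeBoundary (ball 0 1) U → 0 < fderiv ℝ w x e)
    (hb : ∀ x ∈ K, x ∉ interior K → ⟪e, x⟫_ℝ + a + η * w x ≤ ⟪U x, f⟫_ℝ) :
    ∀ x ∈ K, ⟪e, x⟫_ℝ + a + η * w x ≤ ⟪U x, f⟫_ℝ := by
  refine hU.le_inner hf hK hKb ?_ (fun x hx => ⟨contDiffAt_affine_add hw.contDiffAt, ?_, ?_⟩) hb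
  · have := hw.continuous
    exact Continuous.continuousOn (by fun_prop)
  · rw [laplacian_affine_add hw.contDiffAt]
    exact mul_pos hη (hΔ x hx)
  · intro hxF
    rw [fderiv_affine_add hw.contDiffAt]
    have h1 : (innerSL ℝ e + η • fderiv ℝ w x) e = 1 + η * fderiv ℝ w x e := by
      simp [he]
    have h2 := (innerSL ℝ e + η • fderiv ℝ w x).le_opNorm e
    rw [h1, he, mul_one] at h2
    have h3 := mul_pos hη (hF x hx hxF)
    linarith [le_abs_self (1 + η * fderiv ℝ w x e), Real.norm_eq_abs (1 + η * fderiv ℝ w x e)]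

/-- Comparison from above with a perturbation of an affine function. -/
theorem IsViscositySolution.norm_le_affine_sub (hU : IsViscositySolution (ball 0 1) U)
    {e : EuclideanSpace ℝ (Fin n)} (he : ‖e‖ = 1) {K : Set (EuclideanSpace ℝ (Fin n))}
    (hK : IsCompact K) (hKb : K ⊆ ball 0 1) {w : EuclideanSpace ℝ (Fin n) → ℝ}
    (hw : ContDiff ℝ 2 w) {b η : ℝ} (hη : 0 < η)
    (hΔ : ∀ x ∈ interior K, 0 < Δ w x)
    (hF : ∀ x ∈ interior K, x ∈ freeBoundary (ball 0 1) U →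
      η * ‖fderiv ℝ w x‖ ^ 2 < 2 * fderiv ℝ w x e ∧ η * fderiv ℝ w x e < 1)
    (hb : ∀ x ∈ K, x ∉ interior K → x ∈ closure (positivitySet (ball 0 1) U) →
      ‖U x‖ ≤ ⟪e, x⟫_ℝ + b - η * w x) :
    ∀ x ∈ K, x ∈ closure (positivitySet (ball 0 1) U) → ‖U x‖ ≤ ⟪e, x⟫_ℝ + b - η * w x := by
  have heq : (fun y => ⟪e, y⟫_ℝ + b - η * w y) = fun y => ⟪e, y⟫_ℝ + b + (-η) * w y := by
    ext y; ring
  refine hU.norm_le (φ := fun y => ⟪e, y⟫_ℝ + b - η * w y) hK hKb ?_ (fun x hx => ?_) hb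
  · have := hw.continuous
    exact Continuous.continuousOn (by fun_prop)
  rw [heq]
  refine ⟨contDiffAt_affine_add hw.contDiffAt, ?_, fun hxF => ?_⟩
  · rw [laplacian_affine_add hw.contDiffAt]
    linarith [mul_pos hη (hΔ x hx)]
  · obtain ⟨h1, h2⟩ := hF x hx hxF
    rw [fderiv_affine_add hw.contDiffAt]
    set T := fderiv ℝ w x with hT
    -- With the gradient as a vector, `|e - η v|² = 1 - 2 η ⟨e, v⟩ + η² |v|²`. The first half of
    -- `hF` makes this less than one, the second keeps the component along `e` positive.
    set v := (InnerProductSpace.toDual ℝ (EuclideanSpace ℝ (Fin n))).symm T with hv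
    have hTv : T = innerSL ℝ v := by
      ext y
      rw [innerSL_apply_apply, hv, InnerProductSpace.toDual_symm_apply]
    have hTe : T e = ⟪e, v⟫_ℝ := by rw [hTv, innerSL_apply_apply, real_inner_comm]
    have hTn : ‖T‖ = ‖v‖ := by rw [hTv, innerSL_apply_norm]
    have hsum : innerSL ℝ e + (-η) • T = innerSL ℝ (e - η • v) := by
      ext y; rw [hTv]; simp; ring
    rw [hsum]
    rw [hTe] at h1 h2
    rw [hTn] at h1
    constructor
    · intro h0
      have h3 : (innerSL ℝ (e - η • v)) e = 0 := by rw [h0]; simp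
      rw [innerSL_apply_apply, inner_sub_left, inner_smul_left, real_inner_self_eq_norm_sq, he,
        real_inner_comm] at h3
      simp at h3
      linarith
    · rw [innerSL_apply_norm]
      have h3 : ‖e - η • v‖ ^ 2 < 1 := by
        rw [norm_sub_sq_real, inner_smul_right, norm_smul, Real.norm_of_nonneg hη.le, he]
        nlinarith
      nlinarith [norm_nonneg (e - η • v)]

/-- The rescaling `r⁻¹ U(x₀ + r x)`. -/
noncomputable def rescale (U : EuclideanSpace ℝ (Fin n) → EuclideanSpace ℝ (Fin m))
    (x₀ : EuclideanSpace ℝ (Fin n)) (r : ℝ) (x : EuclideanSpace ℝ (Fin n)) :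
    EuclideanSpace ℝ (Fin m) :=
  r⁻¹ • U (x₀ + r • x)

theorem rescale_ne_zero_iff {x₀ x : EuclideanSpace ℝ (Fin n)} {r : ℝ} (hr : 0 < r) :
    rescale U x₀ r x ≠ 0 ↔ U (x₀ + r • x) ≠ 0 := by
  simp [rescale, hr.ne']

theorem add_smul_mem_ball {x₀ x : EuclideanSpace ℝ (Fin n)} {r : ℝ} (hr : 0 < r)
    (hx : x ∈ ball (0 : EuclideanSpace ℝ (Fin n)) 1) : x₀ + r • x ∈ ball x₀ r := by
  rw [mem_ball_zero_iff] at hx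
  rw [mem_ball, dist_eq_norm, add_sub_cancel_left, norm_smul, Real.norm_of_nonneg hr.le]
  nlinarith

theorem add_smul_mem_closure {x₀ x : EuclideanSpace ℝ (Fin n)} {r : ℝ} (hr : 0 < r)
    (hb : ball x₀ r ⊆ ball 0 1)
    (hx : x ∈ closure (positivitySet (ball 0 1) (rescale U x₀ r))) :
    x₀ + r • x ∈ closure (positivitySet (ball 0 1) U) := by
  have hc : Continuous fun x : EuclideanSpace ℝ (Fin n) => x₀ + r • x := by fun_prop
  refine map_mem_closure (f := fun x => x₀ + r • x) hc hx fun y hy => ?_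
  rw [mem_positivitySet_iff] at hy ⊢
  exact ⟨hb (add_smul_mem_ball hr hy.1), (rescale_ne_zero_iff hr).1 hy.2⟩

theorem continuousOn_rescale (hU : ContinuousOn U (ball 0 1)) {x₀ : EuclideanSpace ℝ (Fin n)}
    {r : ℝ} (hr : 0 < r) (hb : ball x₀ r ⊆ ball 0 1) :
    ContinuousOn (rescale U x₀ r) (ball 0 1) := by
  refine ContinuousOn.const_smul ?_ r⁻¹
  exact hU.comp (f := fun x => x₀ + r • x)
    (Continuous.continuousOn (by fun_prop)) fun x hx => hb (add_smul_mem_ball hr hx)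

theorem add_smul_mem_freeBoundary (hU : ContinuousOn U (ball 0 1))
    {x₀ x : EuclideanSpace ℝ (Fin n)} {r : ℝ} (hr : 0 < r) (hb : ball x₀ r ⊆ ball 0 1)
    (hx : x ∈ freeBoundary (ball 0 1) (rescale U x₀ r)) :
    x₀ + r • x ∈ freeBoundary (ball 0 1) U := by
  rw [mem_freeBoundary_iff (continuousOn_rescale hU hr hb)] at hx
  rw [mem_freeBoundary_iff hU]
  refine ⟨hb (add_smul_mem_ball hr hx.1), ?_, add_smul_mem_closure hr hb hx.2.2⟩
  by_contra h
  exact (rescale_ne_zero_iff hr).2 h hx.2.1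

/-- The test function transported by a dilation. -/
theorem exists_rescaled_test {x₀ x : EuclideanSpace ℝ (Fin n)} {r : ℝ} (hr : 0 < r)
    {φ : EuclideanSpace ℝ (Fin n) → ℝ} (hφ : ContDiffAt ℝ 2 φ x) :
    ∃ ψ : EuclideanSpace ℝ (Fin n) → ℝ, (∀ y, ψ (x₀ + r • y) = r * φ y) ∧
      ContDiffAt ℝ 2 ψ (x₀ + r • x) ∧ fderiv ℝ ψ (x₀ + r • x) = fderiv ℝ φ x := by
  set A : EuclideanSpace ℝ (Fin n) → EuclideanSpace ℝ (Fin n) := fun z => r⁻¹ • (z - x₀) with hA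
  have hAx : ∀ y, A (x₀ + r • y) = y := fun y => by
    simp [hA, smul_smul, hr.ne']
  have hAd : HasFDerivAt A (r⁻¹ • ContinuousLinearMap.id ℝ (EuclideanSpace ℝ (Fin n)))
      (x₀ + r • x) := ((hasFDerivAt_id _).sub_const x₀).const_smul r⁻¹
  have hφA : ContDiffAt ℝ 2 φ (A (x₀ + r • x)) := by rwa [hAx]
  refine ⟨fun z => r * φ (A z), fun y => by simp only [hAx], ?_, ?_⟩
  · have hAc : ContDiffAt ℝ 2 A (x₀ + r • x) :=
      (contDiffAt_id.sub contDiffAt_const).const_smul r⁻¹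
    exact contDiffAt_const.mul (hφA.comp _ hAc)
  · have h1 : HasFDerivAt φ (fderiv ℝ φ x) (A (x₀ + r • x)) := by
      rw [hAx]; exact (hφ.differentiableAt (by norm_num)).hasFDerivAt
    refine ((h1.comp _ hAd).const_mul r).fderiv.trans ?_
    ext v
    simp [hr.ne']

theorem eventually_of_eventually_add_smul {x₀ x : EuclideanSpace ℝ (Fin n)} {r : ℝ} (hr : 0 < r)
    {p : EuclideanSpace ℝ (Fin n) → Prop} (hp : ∀ᶠ y in 𝓝 x, p (x₀ + r • y)) :
    ∀ᶠ z in 𝓝 (x₀ + r • x), p z := by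
  have hc : ContinuousAt (fun z : EuclideanSpace ℝ (Fin n) => r⁻¹ • (z - x₀)) (x₀ + r • x) := by
    fun_prop
  have h1 : r⁻¹ • ((x₀ + r • x) - x₀) = x := by simp [smul_smul, hr.ne']
  have h2 := hc.eventually (p := fun y => p (x₀ + r • y)) (by simpa only [h1] using hp)
  filter_upwards [h2] with z hz
  simpa [smul_smul, hr.ne'] using hz

/-- The factor `r⁻¹` leaves gradients unchanged, and with them the free boundary condition. -/
theorem IsViscositySolution.rescale (hU : IsViscositySolution (ball 0 1) U)
    {x₀ : EuclideanSpace ℝ (Fin n)} {r : ℝ} (hr : 0 < r) (hb : ball x₀ r ⊆ ball 0 1) :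
    IsViscositySolution (ball 0 1) (rescale U x₀ r) where
  continuousOn := continuousOn_rescale hU.continuousOn hr hb
  harmonic i x hx := by
    rw [mem_positivitySet_iff] at hx
    have h1 := hU.harmonicAt (hb (add_smul_mem_ball hr hx.1)) ((rescale_ne_zero_iff hr).1 hx.2)
    have h2 := HarmonicAt.comp_similarity (LinearIsometryEquiv.refl ℝ _) x₀ r h1
    exact (h2.comp_CLM (EuclideanSpace.proj (𝕜 := ℝ) i)).const_smul (c := r⁻¹)
  below x hx φ hφ hg f hf htouch := by
    obtain ⟨ψ, hψ, hψc, hψd⟩ := exists_rescaled_test (x₀ := x₀) hr hφ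
    refine hU.below _ (add_smul_mem_freeBoundary hU.continuousOn hr hb hx) ψ hψc ?_ f hf ⟨?_, ?_⟩
    · rwa [norm_gradient_eq, hψd, ← norm_gradient_eq]
    · have := htouch.1
      simp only [_root_.rescale, inner_smul_left] at this
      rw [hψ, this]
      simp [hr.ne']
    · refine eventually_of_eventually_add_smul hr ?_
      filter_upwards [htouch.2] with y hy
      simp only [_root_.rescale, inner_smul_left] at hy
      rw [hψ]
      rwa [conj_trivial, ← div_eq_inv_mul, le_div_iff₀' hr] at hy
  above x hx φ hφ hg0 hg htouch := by
    obtain ⟨ψ, hψ, hψc, hψd⟩ := exists_rescaled_test (x₀ := x₀) hr hφ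
    have hmax : ∀ t : ℝ, max (r * t) 0 = r * max t 0 := fun t => by
      rw [mul_max_of_nonneg _ _ hr.le, mul_zero]
    refine hU.above _ (add_smul_mem_freeBoundary hU.continuousOn hr hb hx) ψ hψc ?_ ?_ ⟨?_, ?_⟩
    · rwa [← norm_ne_zero_iff, norm_gradient_eq, hψd, ← norm_gradient_eq, norm_ne_zero_iff]
    · rwa [norm_gradient_eq, hψd, ← norm_gradient_eq]
    · have := htouch.1
      simp only [_root_.rescale, norm_smul, norm_inv, Real.norm_of_nonneg hr.le] at this
      simp only [hψ, hmax, this]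
      simp [hr.ne']
    · refine eventually_of_eventually_add_smul hr ?_
      filter_upwards [htouch.2] with y hy
      simp only [_root_.rescale, norm_smul, norm_inv, Real.norm_of_nonneg hr.le] at hy
      simp only [hψ, hmax]
      rwa [← div_eq_inv_mul, div_le_iff₀' hr] at hy

end Viscosity

/-! ### One step of the partial Harnack inequality. -/

section Harnack

variable {n m : ℕ} {U : EuclideanSpace ℝ (Fin n) → EuclideanSpace ℝ (Fin m)}

/-- The radial function `exp (-A |x - z|²) - d`. -/
noncomputable def expBarrier (A d : ℝ) (z x : EuclideanSpace ℝ (Fin n)) : ℝ :=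
  Real.exp (-A * ‖x - z‖ ^ 2) - d

theorem contDiff_expBarrier (A d : ℝ) (z : EuclideanSpace ℝ (Fin n)) :
    ContDiff ℝ 2 (expBarrier A d z) := by
  unfold expBarrier
  have h1 : ContDiff ℝ 2 fun x : EuclideanSpace ℝ (Fin n) => x - z := contDiff_id.sub contDiff_const
  exact ((contDiff_const.mul (h1.norm_sq ℝ)).exp).sub contDiff_const

theorem hasFDerivAt_exp_neg_norm_sq (A : ℝ) (z x : EuclideanSpace ℝ (Fin n)) :
    HasFDerivAt (fun x => Real.exp (-A * ‖x - z‖ ^ 2))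
      ((-2 * A * Real.exp (-A * ‖x - z‖ ^ 2)) • innerSL ℝ (x - z)) x := by
  have h0 : HasFDerivAt (fun x : EuclideanSpace ℝ (Fin n) => x - z)
    (ContinuousLinearMap.id ℝ _) x := (hasFDerivAt_id x).sub_const z
  refine (h0.norm_sq.const_mul (-A)).exp.congr_fderiv ?_
  ext v
  simp
  ring

theorem fderiv_expBarrier (A d : ℝ) (z x : EuclideanSpace ℝ (Fin n)) :
    fderiv ℝ (expBarrier A d z) x =
      (-2 * A * Real.exp (-A * ‖x - z‖ ^ 2)) • innerSL ℝ (x - z) :=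
  ((hasFDerivAt_exp_neg_norm_sq A z x).sub_const d).fderiv

theorem laplacian_expBarrier (A d : ℝ) (z x : EuclideanSpace ℝ (Fin n)) :
    Δ (expBarrier A d z) x =
      Real.exp (-A * ‖x - z‖ ^ 2) * (4 * A ^ 2 * ‖x - z‖ ^ 2 - 2 * A * n) := by
  set B : EuclideanSpace ℝ (Fin n) →L[ℝ] EuclideanSpace ℝ (Fin n) →L[ℝ] ℝ :=
    innerSL ℝ (E := EuclideanSpace ℝ (Fin n)) with hB
  have hBv : ∀ v w, B v w = ⟪v, w⟫_ℝ := fun v w => rfl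
  set E := Real.exp (-A * ‖x - z‖ ^ 2) with hE
  have h0 : HasFDerivAt (fun x : EuclideanSpace ℝ (Fin n) => x - z)
    (ContinuousLinearMap.id ℝ _) x := (hasFDerivAt_id x).sub_const z
  have h1 : HasFDerivAt (fun x : EuclideanSpace ℝ (Fin n) => innerSL ℝ (x - z)) B x :=
    B.hasFDerivAt.comp x h0
  have h2 := ((hasFDerivAt_exp_neg_norm_sq A z x).const_mul (-2 * A)).fun_smul h1
  refine (laplacian_eq_of_hasFDerivAt (h := expBarrier A d z) (EuclideanSpace.basisFun (Fin n) ℝ)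
    (Eventually.of_forall fun y => (hasFDerivAt_exp_neg_norm_sq A z y).sub_const d) h2).trans ?_
  set b := EuclideanSpace.basisFun (Fin n) ℝ with hb
  have h3 : ∀ i, ((-2 * A * E) • B + ((-2 * A) • (-2 * A * E) • innerSL ℝ (x - z)).smulRight
      (innerSL ℝ (x - z))) (b i) (b i) = -2 * A * E + 4 * A ^ 2 * E * ⟪x - z, b i⟫_ℝ ^ 2 := fun i => by
    have : ⟪b i, b i⟫_ℝ = 1 := by rw [real_inner_self_eq_norm_sq, b.norm_eq_one]; norm_num
    simp only [add_apply, smul_apply, hBv, this, ContinuousLinearMap.smulRight_apply,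
      innerSL_apply_apply, smul_eq_mul]
    ring
  refine (Finset.sum_congr rfl fun i _ => h3 i).trans ?_
  simp only [Finset.sum_add_distrib, ← Finset.mul_sum, sum_inner_sq]
  simp
  ring

theorem isCompact_annulus (z : EuclideanSpace ℝ (Fin n)) (r R : ℝ) :
    IsCompact {x : EuclideanSpace ℝ (Fin n) | r ≤ ‖x - z‖ ∧ ‖x - z‖ ≤ R} := by
  refine (isCompact_closedBall z R).of_isClosed_subset ?_ fun x hx => ?_
  · have h1 : IsClosed {x : EuclideanSpace ℝ (Fin n) | r ≤ ‖x - z‖} :=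
      isClosed_le (by fun_prop) (by fun_prop)
    have h2 : IsClosed {x : EuclideanSpace ℝ (Fin n) | ‖x - z‖ ≤ R} :=
      isClosed_le (by fun_prop) (by fun_prop)
    exact h1.and h2
  · simpa [dist_eq_norm] using hx.2

theorem eq_or_eq_of_notMem_interior_annulus {z x : EuclideanSpace ℝ (Fin n)} {r R : ℝ}
    (hx : x ∈ {x : EuclideanSpace ℝ (Fin n) | r ≤ ‖x - z‖ ∧ ‖x - z‖ ≤ R})
    (hxi : x ∉ interior {x : EuclideanSpace ℝ (Fin n) | r ≤ ‖x - z‖ ∧ ‖x - z‖ ≤ R}) :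
    ‖x - z‖ = r ∨ ‖x - z‖ = R := by
  by_contra! h
  have ho : IsOpen {x : EuclideanSpace ℝ (Fin n) | r < ‖x - z‖ ∧ ‖x - z‖ < R} := by
    have h1 : IsOpen {x : EuclideanSpace ℝ (Fin n) | r < ‖x - z‖} :=
      isOpen_lt (by fun_prop) (by fun_prop)
    have h2 : IsOpen {x : EuclideanSpace ℝ (Fin n) | ‖x - z‖ < R} :=
      isOpen_lt (by fun_prop) (by fun_prop)
    exact h1.and h2
  have hs : {x : EuclideanSpace ℝ (Fin n) | r < ‖x - z‖ ∧ ‖x - z‖ < R} ⊆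
      {x : EuclideanSpace ℝ (Fin n) | r ≤ ‖x - z‖ ∧ ‖x - z‖ ≤ R} := fun y hy => ⟨hy.1.le, hy.2.le⟩
  exact hxi (interior_maximal hs ho ⟨lt_of_le_of_ne hx.1 h.1.symm, lt_of_le_of_ne hx.2 h.2⟩)

/-- `U` is trapped in the set `s` between the translations `⟨·, e⟩ + a` and `(⟨·, e⟩ + b)⁺`. -/
def IsTrapped (U : EuclideanSpace ℝ (Fin n) → EuclideanSpace ℝ (Fin m))
    (e : EuclideanSpace ℝ (Fin n)) (f : EuclideanSpace ℝ (Fin m)) (a b : ℝ)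
    (s : Set (EuclideanSpace ℝ (Fin n))) : Prop :=
  ∀ x ∈ s, ⟪e, x⟫_ℝ + a ≤ ⟪U x, f⟫_ℝ ∧ ‖U x‖ ≤ max (⟪e, x⟫_ℝ + b) 0

theorem norm_sq_eq_inner_sq_add {f : EuclideanSpace ℝ (Fin m)} (hf : ‖f‖ = 1)
    (v : EuclideanSpace ℝ (Fin m)) :
    ‖v‖ ^ 2 = ⟪v, f⟫_ℝ ^ 2 + ‖v - ⟪v, f⟫_ℝ • f‖ ^ 2 := by
  rw [norm_sub_sq_real, inner_smul_right, norm_smul, hf, mul_one, Real.norm_eq_abs, sq_abs]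
  ring

theorem inner_le_norm_of_unit {f : EuclideanSpace ℝ (Fin m)} (hf : ‖f‖ = 1)
    (v : EuclideanSpace ℝ (Fin m)) : ⟪v, f⟫_ℝ ≤ ‖v‖ := by
  have := real_inner_le_norm v f
  rwa [hf, mul_one] at this

/-- By Pythagoras, the gap between `|v|` and `⟨v, f⟩` is quadratic in the orthogonal part once `⟨v,
f⟩` is bounded below. This transfers upper bounds from `⟨U, f⟩` to `|U|` away from the free
boundary. -/
theorem norm_le_inner_add_of_unit {f : EuclideanSpace ℝ (Fin m)} (hf : ‖f‖ = 1)
    {v : EuclideanSpace ℝ (Fin m)} {s t : ℝ} (hs : 0 ≤ s) (ht : 0 < t) (hvt : t ≤ ⟪v, f⟫_ℝ)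
    (h : ‖v - ⟪v, f⟫_ℝ • f‖ ^ 2 ≤ 2 * t * s) : ‖v‖ ≤ ⟪v, f⟫_ℝ + s := by
  have h1 := norm_sq_eq_inner_sq_add hf v
  refine abs_le_of_sq_le_sq' ?_ (by linarith) |>.2
  nlinarith

/-- Where `U ≠ 0` the upper bound cannot be zero, so the affine function is positive there;
nonnegativity passes to the closure and makes the positive part redundant. -/
theorem IsTrapped.norm_le_of_mem_closure {e : EuclideanSpace ℝ (Fin n)}
    {f : EuclideanSpace ℝ (Fin m)} {a b : ℝ} {s : Set (EuclideanSpace ℝ (Fin n))} (hs : IsOpen s)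
    (h : IsTrapped U e f a b s) {x : EuclideanSpace ℝ (Fin n)} (hx : x ∈ s)
    (hxc : x ∈ closure (positivitySet (ball 0 1) U)) :
    0 ≤ ⟪e, x⟫_ℝ + b ∧ ‖U x‖ ≤ ⟪e, x⟫_ℝ + b := by
  have hcl : IsClosed {x : EuclideanSpace ℝ (Fin n) | 0 ≤ ⟪e, x⟫_ℝ + b} :=
    isClosed_le (by fun_prop) (by fun_prop)
  have hsub : s ∩ positivitySet (ball 0 1) U ⊆
      {x : EuclideanSpace ℝ (Fin n) | 0 ≤ ⟪e, x⟫_ℝ + b} := by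
    intro y hy
    rw [mem_inter_iff, mem_positivitySet_iff] at hy
    by_contra hlt
    have hlt : ⟪e, y⟫_ℝ + b < 0 := not_le.1 hlt
    have := (h y hy.1).2
    rw [max_eq_right hlt.le] at this
    exact hy.2.2 (norm_le_zero_iff.1 this)
  have h0 : 0 ≤ ⟪e, x⟫_ℝ + b := closure_minimal hsub hcl (hs.inter_closure ⟨hx, hxc⟩)
  refine ⟨h0, ?_⟩
  have := (h x hx).2
  rwa [max_eq_left h0] at this

theorem norm_le_max_of_closure {x : EuclideanSpace ℝ (Fin n)} {t : ℝ}
    (hx : x ∈ ball (0 : EuclideanSpace ℝ (Fin n)) 1)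
    (h : x ∈ closure (positivitySet (ball 0 1) U) → ‖U x‖ ≤ t) : ‖U x‖ ≤ max t 0 := by
  by_cases h0 : U x = 0
  · simp [h0]
  · exact (h (subset_closure (mem_positivitySet_iff.2 ⟨hx, h0⟩))).trans (le_max_left _ _)

set_option maxHeartbeats 1000000 in
/-- One step of the partial Harnack inequality, for the exact oscillation. -/
theorem exists_harnack_improvement (n m : ℕ) : ∃ c c₀ : ℝ, 0 < c ∧ c ≤ 1 / 2 ∧ 0 < c₀ ∧
    ∀ (U : EuclideanSpace ℝ (Fin n) → EuclideanSpace ℝ (Fin m)) (e : EuclideanSpace ℝ (Fin n))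
      (f : EuclideanSpace ℝ (Fin m)) (a b : ℝ), IsViscositySolution (ball 0 1) U → ‖e‖ = 1 →
      ‖f‖ = 1 → |a| ≤ c₀ → |b| ≤ c₀ → 0 < b - a → IsTrapped U e f a b (ball 0 1) →
      (∀ x ∈ ball (0 : EuclideanSpace ℝ (Fin n)) 1,
        ‖U x - ⟪U x, f⟫_ℝ • f‖ ^ 2 ≤ 2 * c₀ * (b - a)) →
      ∃ a' b' : ℝ, a ≤ a' ∧ b' ≤ b ∧ b' - a' ≤ (1 - c) * (b - a) ∧
        IsTrapped U e f a' b' (ball 0 (1 / 20)) := by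
  -- Chosen so that the interior estimate on a ball of radius `1/10` leaves oscillation at most a
  -- quarter of the bound on radius `ρ`.
  set ρ : ℝ := 1 / (160 * (n + 1)) with hρ
  have hn0 : (0 : ℝ) ≤ n := Nat.cast_nonneg n
  have hρ0 : 0 < ρ := by positivity
  have hρ1 : ρ ≤ 1 / 160 := by
    rw [hρ]; gcongr; linarith
  -- `A ρ² = n + 1` makes the exponential strictly subharmonic outside the ball of radius `ρ`.
  set A : ℝ := (n + 1) / ρ ^ 2 with hA
  have hAρ : A * ρ ^ 2 = n + 1 := by rw [hA]; field_simp
  have hA0 : 0 < A := by positivity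
  set d : ℝ := Real.exp (-A * (3 / 4) ^ 2) with hd
  have hd0 : 0 < d := Real.exp_pos _
  set c₂ : ℝ := Real.exp (-A * (1 / 4) ^ 2) - d with hc₂
  have hc₂0 : 0 < c₂ := by
    rw [hc₂, hd, sub_pos, Real.exp_lt_exp]; nlinarith
  have hc₂1 : c₂ ≤ 1 := by
    have : Real.exp (-A * (1 / 4) ^ 2) ≤ 1 := Real.exp_le_one_iff.2 (by nlinarith)
    linarith
  -- The first bound keeps the free boundary well below `z` and the orthogonal part negligible; the
  -- second lets the linear term win over the quadratic one in the slope condition of the upper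
  -- barrier.
  set c₀ : ℝ := min (1 / 160) (Real.exp (-A) / (5 * A)) with hc₀
  have hc₀0 : 0 < c₀ := lt_min (by norm_num) (by positivity)
  have hc₀1 : c₀ ≤ 1 / 160 := min_le_left _ _
  have hc₀A : 5 * (c₀ * A) ≤ Real.exp (-A) := by
    have : c₀ ≤ Real.exp (-A) / (5 * A) := min_le_right _ _
    rw [le_div_iff₀ (by positivity)] at this
    linarith
  have hexpA : Real.exp (-A) ≤ 1 := Real.exp_le_one_iff.2 (by linarith)
  refine ⟨c₂ / 8, c₀, by positivity, by linarith, hc₀0, ?_⟩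
  intro U e f a b hU he hf ha hb hab hT hV
  rw [abs_le] at ha hb
  have := nontrivial_of_norm_eq_one he
  set η := b - a with hη
  have hη1 : η ≤ 2 * c₀ := by linarith
  -- A point inside the positivity set. The annulus about it with radii `ρ` and `3/4` stays in the
  -- unit ball and contains the ball of radius `1/20` about the origin.
  set z : EuclideanSpace ℝ (Fin n) := (1 / 5 : ℝ) • e with hz
  have hzn : ‖z‖ = 1 / 5 := by rw [hz, norm_smul, he]; norm_num
  have hez : ⟪e, z⟫_ℝ = 1 / 5 := by
    rw [hz, inner_smul_right, real_inner_self_eq_norm_sq, he]; norm_num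
  have hzx : ∀ x, ‖x - z‖ ≤ 3 / 4 → x ∈ ball (0 : EuclideanSpace ℝ (Fin n)) 1 := fun x hx => by
    rw [mem_ball_zero_iff]
    calc ‖x‖ = ‖(x - z) + z‖ := by congr 1; abel
      _ ≤ ‖x - z‖ + ‖z‖ := norm_add_le _ _
      _ < 1 := by linarith
  have hex : ∀ x, 1 / 5 - ‖x - z‖ ≤ ⟪e, x⟫_ℝ := fun x => by
    have h1 : ⟪e, x⟫_ℝ = 1 / 5 + ⟪e, x - z⟫_ℝ := by rw [inner_sub_right, hez]; ring
    have h2 := neg_le_of_abs_le (abs_real_inner_le_norm e (x - z))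
    rw [he, one_mul] at h2
    linarith
  have hposU : ∀ x, ‖x - z‖ < 1 / 10 → U x ≠ 0 := fun x hx h0 => by
    have h1 := (hT x (hzx x (by linarith))).1
    rw [h0, inner_zero_left] at h1
    linarith [hex x]
  set h : EuclideanSpace ℝ (Fin n) → ℝ := fun x => ⟪U x, f⟫_ℝ - quadFun a 0 0 e 0 0 x with hh
  have hhv : ∀ x, h x = ⟪U x, f⟫_ℝ - (⟪e, x⟫_ℝ + a) := fun x => by
    simp [hh, quadFun]; ring
  have hhh : ∀ x ∈ ball z (1 / 10), HarmonicAt h x := fun x hx => by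
    rw [mem_ball, dist_eq_norm] at hx
    refine ((hU.harmonicAt (hzx x (by linarith)) (hposU x hx)).inner_const f).sub
      ⟨(contDiff_quadFun _ _ _ _ _ _).contDiffAt, Eventually.of_forall fun y => ?_⟩
    rw [laplacian_quadFun]; simp
  have hhb : ∀ x ∈ ball z (1 / 10), ‖h x‖ ≤ η := fun x hx => by
    rw [mem_ball, dist_eq_norm] at hx
    obtain ⟨h1, h2⟩ := hT x (hzx x (by linarith))
    rw [max_eq_left (by linarith [hex x])] at h2
    have h3 := inner_le_norm_of_unit hf (U x)
    rw [Real.norm_eq_abs, hhv, abs_of_nonneg (by linarith)]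
    linarith
  have hosc : ∀ x, ‖x - z‖ ≤ ρ → |h x - h z| ≤ η / 4 := fun x hx => by
    have h1 := norm_sub_le_of_harmonic (by norm_num) hhh hhb (x := x) (y := z)
      (by rw [mem_closedBall, dist_eq_norm]; linarith) (mem_closedBall_self (by norm_num))
    rw [Real.norm_eq_abs, finrank_euclideanSpace_fin] at h1
    refine h1.trans ?_
    calc 4 * ((n : ℝ) + 1) * η / (1 / 10) * ‖x - z‖ ≤ 4 * (n + 1) * η / (1 / 10) * ρ := by gcongr
      _ = η / 4 := by rw [hρ]; field_simp; norm_num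
  set w := expBarrier A d z with hw
  set K := {x : EuclideanSpace ℝ (Fin n) | ρ ≤ ‖x - z‖ ∧ ‖x - z‖ ≤ 3 / 4} with hK
  have hKc : IsCompact K := isCompact_annulus z ρ (3 / 4)
  have hKb : K ⊆ ball 0 1 := fun x hx => hzx x hx.2
  have hwΔ : ∀ x ∈ interior K, 0 < Δ w x := fun x hx => by
    rw [hw, laplacian_expBarrier]
    have h1 := (interior_subset hx).1
    refine mul_pos (Real.exp_pos _) ?_
    have h2 : ρ ^ 2 ≤ ‖x - z‖ ^ 2 := by gcongr
    have h3 : A * ρ ^ 2 ≤ A * ‖x - z‖ ^ 2 := by gcongr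
    nlinarith
  have hexp1 : ∀ x, Real.exp (-A * ‖x - z‖ ^ 2) ≤ 1 := fun x =>
    Real.exp_le_one_iff.2 (by nlinarith [mul_nonneg hA0.le (sq_nonneg ‖x - z‖)])
  have hw1 : ∀ x, w x ≤ 1 := fun x => by
    have := hexp1 x
    simp only [hw, expBarrier]; linarith
  have hwouter : ∀ x, ‖x - z‖ = 3 / 4 → w x = 0 := fun x hx => by
    simp [hw, expBarrier, hx, hd]
  have hwF : ∀ x ∈ interior K, x ∈ freeBoundary (ball 0 1) U →
      A * Real.exp (-A) / 5 ≤ fderiv ℝ w x e ∧ ‖fderiv ℝ w x‖ ≤ 2 * A := fun x hx hxF => by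
    have hxK := interior_subset hx
    have hUx := ((mem_freeBoundary_iff hU.continuousOn).1 hxF).2.1
    have h1 := (hT x (hKb hxK)).1
    rw [hUx, inner_zero_left] at h1
    -- Free boundary points lie below `z`, so the radially decreasing barrier increases there in
    -- direction `e`.
    have h2 : ⟪x - z, e⟫_ℝ ≤ -(1 / 10) := by
      rw [real_inner_comm, inner_sub_right, hez]; linarith
    have h3 : Real.exp (-A) ≤ Real.exp (-A * ‖x - z‖ ^ 2) := by
      rw [Real.exp_le_exp]
      have : ‖x - z‖ ^ 2 ≤ 1 := by nlinarith [hxK.2, norm_nonneg (x - z)]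
      nlinarith
    rw [hw, fderiv_expBarrier]
    constructor
    · simp only [smul_apply, innerSL_apply_apply, smul_eq_mul]
      have h4 : A * Real.exp (-A) ≤ A * Real.exp (-A * ‖x - z‖ ^ 2) := by gcongr
      have h5 : 0 < A * Real.exp (-A * ‖x - z‖ ^ 2) := by positivity
      have h6 := mul_le_mul_of_nonneg_left h2 h5.le
      linarith
    · rw [norm_smul, innerSL_apply_norm, Real.norm_eq_abs, abs_mul, abs_mul, Real.abs_exp,
        abs_of_pos hA0, abs_neg, abs_two]
      calc 2 * A * Real.exp (-A * ‖x - z‖ ^ 2) * ‖x - z‖ ≤ 2 * A * 1 * 1 := by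
            gcongr
            · exact hexp1 x
            · linarith [hxK.2]
        _ = 2 * A := by ring
  have hwin : ∀ x ∈ ball (0 : EuclideanSpace ℝ (Fin n)) (1 / 20), x ∈ K ∧ c₂ ≤ w x := fun x hx => by
    rw [mem_ball_zero_iff] at hx
    have h1 : ‖x - z‖ ≤ 1 / 4 := (norm_sub_le x z).trans (by linarith)
    have h2 : 3 / 20 ≤ ‖x - z‖ := by
      have := norm_sub_norm_le z x
      rw [norm_sub_rev] at this; linarith
    refine ⟨⟨by linarith, by linarith⟩, ?_⟩
    simp only [hw, expBarrier, hc₂]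
    have h3 : ‖x - z‖ ^ 2 ≤ (1 / 4) ^ 2 := by gcongr
    have : Real.exp (-A * (1 / 4) ^ 2) ≤ Real.exp (-A * ‖x - z‖ ^ 2) := by
      rw [Real.exp_le_exp]; nlinarith
    linarith
  have hball : ∀ x ∈ ball (0 : EuclideanSpace ℝ (Fin n)) (1 / 20),
      x ∈ ball (0 : EuclideanSpace ℝ (Fin n)) 1 := fun x hx =>
    ball_subset_ball (by norm_num) hx
  have hwcd := contDiff_expBarrier A d z
  -- If `⟨U, f⟩` is far above the lower plane at `z`, it is so on the whole ball of radius `ρ`, and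
  -- the barrier carries the gain to the ball about the origin. Otherwise the upper plane is lowered
  -- in the same way.
  rcases le_or_gt (η / 2) (h z) with hcase | hcase
  · refine ⟨a + c₂ / 8 * η, b, by have := mul_pos hc₂0 hab; linarith, le_rfl, by linarith, ?_⟩
    have key := hU.affine_add_le_inner he hf hKc hKb hwcd (a := a) (η := η / 8) (by positivity) hwΔ
      (fun x hx hxF => lt_of_lt_of_le (by positivity) (hwF x hx hxF).1)
      (fun x hx hxi => by
        rcases eq_or_eq_of_notMem_interior_annulus hx hxi with h1 | h1
        · have h2 := (abs_le.1 (hosc x h1.le)).1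
          have h3 := hhv x
          have h4 : η / 8 * w x ≤ η / 8 * 1 := by gcongr; exact hw1 x
          change _ + η / 8 * w x ≤ _
          linarith
        · rw [show expBarrier A d z x = 0 from hwouter x h1]
          linarith [(hT x (hKb hx)).1])
    intro x hx
    obtain ⟨hxK, hxw⟩ := hwin x hx
    refine ⟨?_, (hT x (hball x hx)).2⟩
    have h1 := key x hxK
    have h2 : η / 8 * c₂ ≤ η / 8 * w x := by gcongr
    change _ + η / 8 * w x ≤ _ at h1
    linarith
  · refine ⟨a, b - c₂ / 8 * η, le_rfl, by have := mul_pos hc₂0 hab; linarith, by linarith, ?_⟩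
    have hηA : η * A ≤ 2 / 5 * Real.exp (-A) := by
      have : η * A ≤ 2 * c₀ * A := by gcongr
      linarith
    have key := hU.norm_le_affine_sub he hKc hKb hwcd (b := b) (η := η / 8) (by positivity) hwΔ
      (fun x hx hxF => by
        obtain ⟨h1, h2⟩ := hwF x hx hxF
        constructor
        · have h3 : ‖fderiv ℝ w x‖ ^ 2 ≤ (2 * A) ^ 2 := by gcongr
          have h4 : η / 8 * ‖fderiv ℝ w x‖ ^ 2 ≤ η / 8 * (2 * A) ^ 2 := by gcongr
          have h5 : η * A * A ≤ 2 / 5 * Real.exp (-A) * A := by gcongr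
          have h6 : 0 < A * Real.exp (-A) := by positivity
          change η / 8 * ‖fderiv ℝ w x‖ ^ 2 < 2 * fderiv ℝ w x e
          nlinarith
        · have h3 : fderiv ℝ w x e ≤ 2 * A := by
            have := (fderiv ℝ w x).le_opNorm e
            rw [he, mul_one] at this
            exact (le_abs_self _).trans (this.trans h2)
          have h4 : η / 8 * fderiv ℝ w x e ≤ η / 8 * (2 * A) := by gcongr
          change η / 8 * fderiv ℝ w x e < 1
          linarith)
      (fun x hx hxi hxc => by
        obtain ⟨h0, h0'⟩ := hT.norm_le_of_mem_closure isOpen_ball (hKb hx) hxc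
        rcases eq_or_eq_of_notMem_interior_annulus hx hxi with h1 | h1
        · have h2 := (abs_le.1 (hosc x h1.le)).2
          have h3 := hhv x
          have h4 : η / 8 * w x ≤ η / 8 * 1 := by gcongr; exact hw1 x
          -- The information at `z` concerns `⟨U, f⟩`, but the barrier must bound `|U|`. Passing to
          -- `|U|` costs `η / 8` on top of `3 η / 4`, which leaves exactly `η / 8` for the barrier.
          have h5 := norm_le_inner_add_of_unit hf (v := U x) (s := η / 8) (t := 1 / 20)
            (by positivity) (by norm_num) (by linarith [(hT x (hKb hx)).1, hex x])
            ((hV x (hKb hx)).trans (by nlinarith))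
          change _ ≤ _ - η / 8 * w x
          linarith
        · rw [show expBarrier A d z x = 0 from hwouter x h1]
          linarith)
    intro x hx
    obtain ⟨hxK, hxw⟩ := hwin x hx
    refine ⟨(hT x (hball x hx)).1, norm_le_max_of_closure (hball x hx) fun hxc => ?_⟩
    have h1 := key x hxK hxc
    have h2 : η / 8 * c₂ ≤ η / 8 * w x := by gcongr
    change _ ≤ _ - η / 8 * w x at h1
    linarith

end Harnack

/-! ### Iterated Harnack steps: small oscillation at a fixed scale. -/

section HarnackIteration

variable {n m : ℕ} {U : EuclideanSpace ℝ (Fin n) → EuclideanSpace ℝ (Fin m)}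
  {e : EuclideanSpace ℝ (Fin n)} {f : EuclideanSpace ℝ (Fin m)} {a b : ℝ}

theorem IsTrapped.mono {a' b' : ℝ} {s s' : Set (EuclideanSpace ℝ (Fin n))}
    (h : IsTrapped U e f a b s) (hs : s' ⊆ s) (ha : a' ≤ a) (hb : b ≤ b') :
    IsTrapped U e f a' b' s' := fun x hx =>
  ⟨by linarith [(h x (hs hx)).1], (h x (hs hx)).2.trans (max_le_max (by linarith) le_rfl)⟩

theorem IsTrapped.rescale {x₀ : EuclideanSpace ℝ (Fin n)} {r : ℝ} (hr : 0 < r)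
    (h : IsTrapped U e f a b (ball x₀ r)) :
    IsTrapped (rescale U x₀ r) e f (r⁻¹ * (⟪e, x₀⟫_ℝ + a)) (r⁻¹ * (⟪e, x₀⟫_ℝ + b))
      (ball 0 1) := fun x hx => by
  obtain ⟨h1, h2⟩ := h _ (add_smul_mem_ball hr hx)
  rw [inner_add_right, inner_smul_right] at h1 h2
  have hmax : ∀ t : ℝ, r⁻¹ * max t 0 = max (r⁻¹ * t) 0 := fun t => by
    rw [mul_max_of_nonneg _ _ (by positivity), mul_zero]
  have heq : ∀ c, ⟪e, x⟫_ℝ + r⁻¹ * (⟪e, x₀⟫_ℝ + c) =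
      r⁻¹ * (⟪e, x₀⟫_ℝ + r * ⟪e, x⟫_ℝ + c) := fun c => by field_simp; ring
  constructor
  · rw [_root_.rescale, inner_smul_left, heq, conj_trivial]
    gcongr
  · rw [_root_.rescale, norm_smul, Real.norm_of_nonneg (by positivity), heq, ← hmax]
    gcongr

theorem IsTrapped.of_rescale {x₀ : EuclideanSpace ℝ (Fin n)} {r ρ : ℝ} (hr : 0 < r)
    (h : IsTrapped (_root_.rescale U x₀ r) e f a b (ball 0 ρ)) :
    IsTrapped U e f (r * a - ⟪e, x₀⟫_ℝ) (r * b - ⟪e, x₀⟫_ℝ) (ball x₀ (r * ρ)) := fun x hx => by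
  have hx' : r⁻¹ • (x - x₀) ∈ ball (0 : EuclideanSpace ℝ (Fin n)) ρ := by
    rw [mem_ball, dist_eq_norm] at hx
    rw [mem_ball_zero_iff, norm_smul, Real.norm_of_nonneg (by positivity), inv_mul_lt_iff₀ hr]
    exact hx
  obtain ⟨h1, h2⟩ := h _ hx'
  have hxx : x₀ + r • r⁻¹ • (x - x₀) = x := by simp [smul_smul, hr.ne']
  rw [_root_.rescale, hxx, inner_smul_right, inner_sub_right] at h1 h2
  rw [inner_smul_left, conj_trivial] at h1
  rw [norm_smul, Real.norm_of_nonneg (by positivity)] at h2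
  have hmax : ∀ t : ℝ, r * max t 0 = max (r * t) 0 := fun t => by
    rw [mul_max_of_nonneg _ _ (by positivity), mul_zero]
  have heq : ∀ c, ⟪e, x⟫_ℝ + (r * c - ⟪e, x₀⟫_ℝ) =
      r * (r⁻¹ * (⟪e, x⟫_ℝ - ⟪e, x₀⟫_ℝ) + c) := fun c => by field_simp; ring
  rw [heq, heq, ← hmax]
  have h3 := mul_le_mul_of_nonneg_left h1 hr.le
  have h4 := mul_le_mul_of_nonneg_left h2 hr.le
  rw [← mul_assoc, mul_inv_cancel₀ hr.ne', one_mul] at h4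
  rw [mul_inv_cancel_left₀ hr.ne'] at h3
  exact ⟨h3, h4⟩

theorem norm_sub_rescale {x₀ x : EuclideanSpace ℝ (Fin n)} {r : ℝ} (hr : 0 < r) :
    ‖rescale U x₀ r x - ⟪rescale U x₀ r x, f⟫_ℝ • f‖ =
      r⁻¹ * ‖U (x₀ + r • x) - ⟪U (x₀ + r • x), f⟫_ℝ • f‖ := by
  rw [rescale, inner_smul_left, conj_trivial, mul_smul, ← smul_sub, norm_smul,
    Real.norm_of_nonneg (by positivity)]

/-- The flatness condition: `U` is `ε`-close to `⟨·, e⟩⁺ f` in the unit ball. -/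
def IsFlat (U : EuclideanSpace ℝ (Fin n) → EuclideanSpace ℝ (Fin m))
    (e : EuclideanSpace ℝ (Fin n)) (f : EuclideanSpace ℝ (Fin m)) (ε : ℝ) : Prop :=
  IsTrapped U e f (-ε) ε (ball 0 1) ∧
    ∀ x ∈ ball (0 : EuclideanSpace ℝ (Fin n)) 1, ‖U x - ⟪U x, f⟫_ℝ • f‖ ≤ ε

/-- The iteration knows only an upper bound `η` for the oscillation. Either `b - a` is already at
most `(1 - c) * η`, or `b - a ≥ η / 2` because `c ≤ 1 / 2`, and then a bound of the orthogonal part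
by `η` is also one by `b - a`. -/
theorem exists_harnack_step (n m : ℕ) : ∃ c c₀ : ℝ, 0 < c ∧ c ≤ 1 / 2 ∧ 0 < c₀ ∧ c₀ ≤ 1 / 4 ∧
    ∀ (U : EuclideanSpace ℝ (Fin n) → EuclideanSpace ℝ (Fin m)) (e : EuclideanSpace ℝ (Fin n))
      (f : EuclideanSpace ℝ (Fin m)) (a b η : ℝ), IsViscositySolution (ball 0 1) U → ‖e‖ = 1 →
      ‖f‖ = 1 → |a| ≤ c₀ → |b| ≤ c₀ → 0 < η → b - a ≤ η → IsTrapped U e f a b (ball 0 1) →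
      (∀ x ∈ ball (0 : EuclideanSpace ℝ (Fin n)) 1, ‖U x - ⟪U x, f⟫_ℝ • f‖ ^ 2 ≤ c₀ * η) →
      ∃ a' b' : ℝ, a ≤ a' ∧ b' ≤ b ∧ b' - a' ≤ (1 - c) * η ∧
        IsTrapped U e f a' b' (ball 0 (1 / 20)) := by
  obtain ⟨c, c₀, hc, hc2, hc₀, H⟩ := exists_harnack_improvement n m
  refine ⟨c, min c₀ (1 / 4), hc, hc2, by positivity, min_le_right _ _, ?_⟩
  intro U e f a b η hU he hf ha hb hη hab hT hV
  by_cases hcase : b - a ≤ (1 - c) * η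
  · exact ⟨a, b, le_rfl, le_rfl, hcase, hT.mono (ball_subset_ball (by norm_num)) le_rfl le_rfl⟩
  push Not at hcase
  have h1 : η / 2 ≤ b - a := by nlinarith
  obtain ⟨a', b', ha', hb', hab', hT'⟩ := H U e f a b hU he hf (ha.trans (min_le_left _ _))
    (hb.trans (min_le_left _ _)) (by linarith) hT (fun x hx => (hV x hx).trans (by
      have h2 : min c₀ (1 / 4) * η ≤ c₀ * η := by gcongr; exact min_le_left _ _
      nlinarith))
  exact ⟨a', b', ha', hb', hab'.trans (by gcongr; linarith), hT'⟩

/-- The missing one-sided bounds hold because the band cannot be empty: at `x₀` this limits `a` from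
above, and at `x₀ + (s / 2) • e`, higher than `ε`, the positive part is inactive, so `a ≤ b`. -/
theorem IsTrapped.bounds {x₀ : EuclideanSpace ℝ (Fin n)} {s ε : ℝ} (he : ‖e‖ = 1) (hf : ‖f‖ = 1)
    (hx₀ : ⟪e, x₀⟫_ℝ = 0) (hε : 0 ≤ ε) (hεs : 2 * ε < s)
    (h : IsTrapped U e f a b (ball x₀ s)) (ha : -ε ≤ a) (hb : b ≤ ε) : |a| ≤ ε ∧ |b| ≤ ε := by
  have hs : 0 < s := by linarith
  have h1 := h x₀ (mem_ball_self hs)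
  have h2 := h (x₀ + (s / 2) • e) (by
    rw [mem_ball, dist_eq_norm, add_sub_cancel_left, norm_smul, he,
      Real.norm_of_nonneg (by positivity)]
    linarith)
  rw [inner_add_right, inner_smul_right, real_inner_self_eq_norm_sq, he, hx₀] at h2
  rw [hx₀] at h1
  have h3 := h1.1.trans ((inner_le_norm_of_unit hf _).trans h1.2)
  have h4 := h2.1.trans ((inner_le_norm_of_unit hf _).trans h2.2)
  have h5 : max (0 + b) 0 ≤ ε := max_le (by linarith) hε
  refine ⟨abs_le.2 ⟨ha, by linarith⟩, abs_le.2 ⟨?_, hb⟩⟩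
  rcases le_max_iff.1 h4 with h6 | h6 <;> linarith

/-- Each step shrinks the ball by `20` and the bound on the band by `1 - c`. The bound `ε` on the
orthogonal part never improves, and its rescaled square must stay below `c₀` times the rescaled
oscillation; hence the smallness of `ε` depends on the number `k` of steps. -/
theorem exists_trapped_iterate (n m : ℕ) : ∃ c c₀ : ℝ, 0 < c ∧ c ≤ 1 / 2 ∧ 0 < c₀ ∧ ∀ (k : ℕ)
    (U : EuclideanSpace ℝ (Fin n) → EuclideanSpace ℝ (Fin m)) (e : EuclideanSpace ℝ (Fin n))
      (f : EuclideanSpace ℝ (Fin m)) (ε : ℝ), IsViscositySolution (ball 0 1) U → ‖e‖ = 1 →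
      ‖f‖ = 1 → 0 < ε → ε ≤ c₀ * ((1 / 2) * (1 / 20) ^ k) * (1 - c) ^ k → IsFlat U e f ε →
      ∀ x₀ : EuclideanSpace ℝ (Fin n), ⟪e, x₀⟫_ℝ = 0 → ‖x₀‖ ≤ 1 / 2 →
      ∃ a b : ℝ, -ε ≤ a ∧ b ≤ ε ∧ b - a ≤ (1 - c) ^ k * (2 * ε) ∧
        IsTrapped U e f a b (ball x₀ ((1 / 2) * (1 / 20) ^ k)) := by
  obtain ⟨c, c₀, hc, hc2, hc₀, hc₀4, H⟩ := exists_harnack_step n m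
  refine ⟨c, c₀, hc, hc2, hc₀, fun k => ?_⟩
  have hc1 : 0 < 1 - c := by linarith
  induction k with
  | zero =>
    intro U e f ε hU he hf hε hε' hflat x₀ hx₀ hx₀'
    refine ⟨-ε, ε, le_rfl, le_rfl, by simp; linarith, hflat.1.mono ?_ le_rfl le_rfl⟩
    exact ball_subset_ball' (by simp; linarith)
  | succ k ih =>
    intro U e f ε hU he hf hε hε' hflat x₀ hx₀ hx₀'
    set s : ℝ := (1 / 2) * (1 / 20) ^ k with hs
    have hs0 : 0 < s := by positivity
    have hsk : (1 / 2 : ℝ) * (1 / 20) ^ (k + 1) = s * (1 / 20) := by rw [hs, pow_succ]; ring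
    rw [hsk] at hε' ⊢
    have hq0 : 0 < (1 - c) ^ k := by positivity
    have hq1 : (1 - c) ^ k ≤ 1 := pow_le_one₀ hc1.le (by linarith)
    have hεk : ε ≤ c₀ * s * (1 - c) ^ k := by
      refine hε'.trans ?_
      rw [pow_succ]
      have h1 : (1 - c) ^ k * (1 - c) ≤ (1 - c) ^ k := mul_le_of_le_one_right hq0.le (by linarith)
      have h2 : s * (1 / 20) ≤ s := by linarith
      gcongr
    have hεs : ε ≤ c₀ * s := hεk.trans (mul_le_of_le_one_right (by positivity) hq1)
    have hs1 : s ≤ 1 / 2 := by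
      rw [hs]
      have : ((1 : ℝ) / 20) ^ k ≤ 1 := pow_le_one₀ (by norm_num) (by norm_num)
      linarith
    have hsb : ball x₀ s ⊆ ball 0 1 := ball_subset_ball' (by simp; linarith)
    obtain ⟨a, b, ha, hb, hab, hT⟩ := ih U e f ε hU he hf hε hεk hflat x₀ hx₀ hx₀'
    obtain ⟨ha', hb'⟩ := hT.bounds he hf hx₀ hε.le (by nlinarith) ha hb
    have habs : ∀ t : ℝ, |t| ≤ ε → |s⁻¹ * (⟪e, x₀⟫_ℝ + t)| ≤ c₀ := fun t ht => by
      rw [hx₀, zero_add, abs_mul, abs_of_pos (inv_pos.2 hs0), inv_mul_le_iff₀ hs0]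
      linarith
    set η : ℝ := s⁻¹ * ((1 - c) ^ k * (2 * ε)) with hη
    obtain ⟨a', b', haa, hbb, hab', hT'⟩ := H (rescale U x₀ s) e f _ _ η (hU.rescale hs0 hsb) he hf
      (habs a ha') (habs b hb') (by positivity)
      (by rw [← mul_sub, add_sub_add_left_eq_sub, hη]; gcongr) (hT.rescale hs0)
      (fun x hx => by
        rw [norm_sub_rescale hs0, mul_pow]
        have h1 := hflat.2 _ (hsb (add_smul_mem_ball hs0 hx))
        have h2 : ‖U (x₀ + s • x) - ⟪U (x₀ + s • x), f⟫_ℝ • f‖ ^ 2 ≤ ε ^ 2 := by gcongr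
        have h3 : ε ^ 2 ≤ s * (c₀ * ((1 - c) ^ k * (2 * ε))) := by nlinarith
        calc s⁻¹ ^ 2 * ‖U (x₀ + s • x) - ⟪U (x₀ + s • x), f⟫_ℝ • f‖ ^ 2
            ≤ s⁻¹ ^ 2 * (s * (c₀ * ((1 - c) ^ k * (2 * ε)))) := by gcongr; exact h2.trans h3
          _ = c₀ * η := by rw [hη]; field_simp)
    have hT'' := hT'.of_rescale hs0
    rw [hx₀, zero_add, inv_mul_le_iff₀ hs0] at haa
    rw [hx₀, zero_add, le_inv_mul_iff₀ hs0] at hbb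
    rw [hx₀, sub_zero, sub_zero] at hT''
    refine ⟨s * a', s * b', by linarith, by linarith, ?_, hT''⟩
    rw [← mul_sub]
    calc s * (b' - a') ≤ s * ((1 - c) * η) := by gcongr
      _ = (1 - c) ^ (k + 1) * (2 * ε) := by rw [hη, pow_succ]; field_simp

/-- The partial Harnack inequality: flat solutions oscillate little at a fixed scale. -/
theorem exists_trapped_of_flat (n m : ℕ) {δ : ℝ} (hδ : 0 < δ) : ∃ ρ ε₀ : ℝ, 0 < ρ ∧ ρ ≤ 1 / 2 ∧
    0 < ε₀ ∧
    ∀ (U : EuclideanSpace ℝ (Fin n) → EuclideanSpace ℝ (Fin m)) (e : EuclideanSpace ℝ (Fin n))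
      (f : EuclideanSpace ℝ (Fin m)) (ε : ℝ), IsViscositySolution (ball 0 1) U → ‖e‖ = 1 →
      ‖f‖ = 1 → 0 < ε → ε ≤ ε₀ → IsFlat U e f ε →
      ∀ x₀ : EuclideanSpace ℝ (Fin n), ⟪e, x₀⟫_ℝ = 0 → ‖x₀‖ ≤ 1 / 2 →
      ∃ a b : ℝ, -ε ≤ a ∧ b ≤ ε ∧ b - a ≤ δ * ε ∧ IsTrapped U e f a b (ball x₀ ρ) := by
  obtain ⟨c, c₀, hc, hc2, hc₀, H⟩ := exists_trapped_iterate n m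
  have hc1 : 0 < 1 - c := by linarith
  obtain ⟨k, hk⟩ := exists_pow_lt_of_lt_one (show 0 < δ / 2 by positivity)
    (show 1 - c < 1 by linarith)
  refine ⟨(1 / 2) * (1 / 20) ^ k, c₀ * ((1 / 2) * (1 / 20) ^ k) * (1 - c) ^ k, by positivity, ?_,
    by positivity, fun U e f ε hU he hf hε hε' hflat x₀ hx₀ hx₀' => ?_⟩
  · have : ((1 : ℝ) / 20) ^ k ≤ 1 := pow_le_one₀ (by norm_num) (by norm_num)
    linarith
  obtain ⟨a, b, ha, hb, hab, hT⟩ := H k U e f ε hU he hf hε hε' hflat x₀ hx₀ hx₀'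
  exact ⟨a, b, ha, hb, hab.trans (by nlinarith), hT⟩

end HarnackIteration

/-! ### Even and odd harmonic approximation of data on a hemisphere. -/

section ReflectedApproximation

variable {E : Type*} [NormedAddCommGroup E] [InnerProductSpace ℝ E] [FiniteDimensional ℝ E]
  {F : Type*} [NormedAddCommGroup F] [InnerProductSpace ℝ F]

/-- The scalar principle for `⟨h, g⟩`, with `g` the unit vector along the value of `h` at the given
point. -/
theorem norm_le_of_harmonic_or_le [Nontrivial E] {K : Set E} (hK : IsCompact K) {h : E → F}
    (hc : ContinuousOn h K) {M : ℝ} (hM : 0 ≤ M)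
    (hh : ∀ x ∈ K, ‖h x‖ ≤ M ∨ (x ∈ interior K ∧ HarmonicAt h x)) : ∀ x ∈ K, ‖h x‖ ≤ M := by
  intro x hx
  by_cases h0 : h x = 0
  · simpa [h0] using hM
  have hn : ‖h x‖ ≠ 0 := norm_ne_zero_iff.2 h0
  set g : F := ‖h x‖⁻¹ • h x with hg
  have hgn : ‖g‖ = 1 := by rw [hg, norm_smul, norm_inv, norm_norm, inv_mul_cancel₀ hn]
  have hgx : ⟪h x, g⟫_ℝ = ‖h x‖ := by
    rw [hg, inner_smul_right, real_inner_self_eq_norm_sq, sq, ← mul_assoc, inv_mul_cancel₀ hn,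
      one_mul]
  rw [← hgx]
  refine le_of_harmonic_or_le hK (h := fun y => ⟪h y, g⟫_ℝ) (hc.inner continuousOn_const)
    (fun y hy => ?_) x hx
  rcases hh y hy with h1 | ⟨h1, h2⟩
  · left
    have := real_inner_le_norm (h y) g
    rw [hgn, mul_one] at this
    exact this.trans h1
  · exact Or.inr ⟨h1, h2.inner_const g⟩

theorem inner_hyperplaneReflection {e : E} (he : ‖e‖ = 1) (x : E) :
    ⟪e, hyperplaneReflection e x⟫_ℝ = -⟪e, x⟫_ℝ := by
  rw [hyperplaneReflection_apply he, inner_sub_right, inner_smul_right, real_inner_self_eq_norm_sq,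
    he]
  ring

theorem hyperplaneReflection_hyperplaneReflection (e x : E) :
    hyperplaneReflection e (hyperplaneReflection e x) = x :=
  Submodule.reflection_reflection _ x

theorem hyperplaneReflection_eq_self {e x : E} (he : ‖e‖ = 1) (hx : ⟪e, x⟫_ℝ = 0) :
    hyperplaneReflection e x = x := by
  rw [hyperplaneReflection_apply he, hx]; simp

/-- Reflecting `y` to the side of `x` changes the squared distance by `4 ⟨e, x⟩ ⟨e, y⟩ ≤ 0`. -/
theorem norm_sub_hyperplaneReflection_le {e x y : E} (he : ‖e‖ = 1) (hx : 0 ≤ ⟪e, x⟫_ℝ)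
    (hy : ⟪e, y⟫_ℝ ≤ 0) : ‖x - hyperplaneReflection e y‖ ≤ ‖x - y‖ := by
  have h1 : x - hyperplaneReflection e y = (x - y) + (2 * ⟪e, y⟫_ℝ) • e := by
    rw [hyperplaneReflection_apply he]; abel
  have h2 : ‖x - hyperplaneReflection e y‖ ^ 2 = ‖x - y‖ ^ 2 + 4 * (⟪e, x⟫_ℝ * ⟪e, y⟫_ℝ) := by
    rw [h1, norm_add_sq_real, inner_smul_right, norm_smul, he, mul_one, Real.norm_eq_abs, sq_abs,
      inner_sub_left, real_inner_comm e x, real_inner_comm e y]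
    ring
  have h3 : ⟪e, x⟫_ℝ * ⟪e, y⟫_ℝ ≤ 0 := mul_nonpos_of_nonneg_of_nonpos hx hy
  exact le_of_sq_le_sq (by linarith) (norm_nonneg _)

theorem fderiv_comp_hyperplaneReflection {P : E → F} {e x : E}
    (hP : DifferentiableAt ℝ P (hyperplaneReflection e x)) :
    fderiv ℝ (fun y => P (hyperplaneReflection e y)) x =
      (fderiv ℝ P (hyperplaneReflection e x)).comp
        ((hyperplaneReflection e : E ≃L[ℝ] E) : E →L[ℝ] E) :=
  (hP.hasFDerivAt.comp x ((hyperplaneReflection e : E ≃L[ℝ] E) : E →L[ℝ] E).hasFDerivAt).fderiv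

theorem norm_comp_hyperplaneReflection_le (L : E →L[ℝ] F) (e : E) :
    ‖L.comp ((hyperplaneReflection e : E ≃L[ℝ] E) : E →L[ℝ] E)‖ ≤ ‖L‖ := by
  refine ContinuousLinearMap.opNorm_le_bound _ (norm_nonneg _) fun v => ?_
  have := L.le_opNorm (hyperplaneReflection e v)
  rw [(hyperplaneReflection e).norm_map] at this
  exact this

/-- Functions on the upper half of a sphere which oscillate little at a fixed scale are close to
even (`s = 1`) or odd (`s = -1`) harmonic functions. -/
theorem exists_symmetric_harmonic_approx {n : ℕ} [Nonempty (Fin n)] {R δ ρ : ℝ} (hR : 0 < R)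
    (hδ : 0 < δ) (hρ : 0 < ρ) :
    ∃ K : ℝ, 0 ≤ K ∧ ∀ (e : EuclideanSpace ℝ (Fin n)), ‖e‖ = 1 → ∀ s : ℝ, |s| = 1 →
      ∀ W : EuclideanSpace ℝ (Fin n) → F,
      (∀ x ∈ sphere 0 R, 0 ≤ ⟪e, x⟫_ℝ → ‖W x‖ ≤ 1) →
      (∀ x ∈ sphere 0 R, ∀ y ∈ sphere 0 R, 0 ≤ ⟪e, x⟫_ℝ → 0 ≤ ⟪e, y⟫_ℝ → ‖x - y‖ < ρ →
        ‖W x - W y‖ ≤ δ) →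
      (∀ x ∈ sphere 0 R, ∀ y ∈ sphere 0 R, 0 ≤ ⟪e, x⟫_ℝ → 0 ≤ ⟪e, y⟫_ℝ → ⟪e, x⟫_ℝ < ρ →
        ⟪e, y⟫_ℝ < ρ → ‖x - y‖ < ρ → ‖W x - s • W y‖ ≤ δ) →
      ∃ P : EuclideanSpace ℝ (Fin n) → F, (∀ x, HarmonicAt P x) ∧
        (∀ x, P (hyperplaneReflection e x) = s • P x) ∧
        (∀ x ∈ sphere 0 R, 0 ≤ ⟪e, x⟫_ℝ → ‖P x - W x‖ ≤ 3 * δ) ∧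
        (∀ x ∈ closedBall 0 R, ‖P x‖ ≤ 1 + 2 * δ) ∧
        (∀ x ∈ closedBall 0 R, ‖fderiv ℝ P x‖ ≤ K) ∧
        ∀ x ∈ closedBall 0 R, ∀ y ∈ closedBall 0 R,
          ‖fderiv ℝ P x - fderiv ℝ P y‖ ≤ K * ‖x - y‖ := by
  obtain ⟨K, hK, H⟩ := exists_harmonic_approx (n := n) (F := F) hR hδ hρ
  refine ⟨K, hK, fun e he s hs W hW1 hW2 hW3 => ?_⟩
  have := nontrivial_of_norm_eq_one he
  have hss : s * s = 1 := by rw [← abs_mul_abs_self, hs, one_mul]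
  have hns : ∀ v : F, ‖s • v‖ = ‖v‖ := fun v => by rw [norm_smul, Real.norm_eq_abs, hs, one_mul]
  set σ := hyperplaneReflection e with hσ
  have hσn : ∀ x, ‖σ x‖ = ‖x‖ := σ.norm_map
  have hσσ : ∀ x, σ (σ x) = x := hyperplaneReflection_hyperplaneReflection e
  have hσe : ∀ x, ⟪e, σ x⟫_ℝ = -⟪e, x⟫_ℝ := inner_hyperplaneReflection he
  have hσS : ∀ x ∈ sphere (0 : EuclideanSpace ℝ (Fin n)) R, σ x ∈ sphere 0 R := fun x hx => by
    rw [mem_sphere_zero_iff_norm] at hx ⊢; rw [hσn, hx]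
  have hσB : ∀ x ∈ closedBall (0 : EuclideanSpace ℝ (Fin n)) R, σ x ∈ closedBall 0 R :=
    fun x hx => by
      rw [mem_closedBall_zero_iff] at hx ⊢; rwa [hσn]
  -- Even or odd extension to the lower hemisphere. Its small oscillation across the equator is the
  -- third hypothesis on `W`, which for `s = -1` forces `W` to be small there.
  set W' : EuclideanSpace ℝ (Fin n) → F := fun x =>
    open Classical in if 0 ≤ ⟪e, x⟫_ℝ then W x else s • W (σ x) with hW'
  have hWu : ∀ x, 0 ≤ ⟪e, x⟫_ℝ → W' x = W x := fun x hx => by simp [hW', hx]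
  have hWl : ∀ x, ⟪e, x⟫_ℝ < 0 → W' x = s • W (σ x) := fun x hx => by
    simp [hW', not_le.2 hx]
  have hcross : ∀ x ∈ sphere (0 : EuclideanSpace ℝ (Fin n)) R, ∀ y ∈ sphere 0 R,
      0 ≤ ⟪e, x⟫_ℝ → ⟪e, y⟫_ℝ < 0 → ‖x - y‖ < ρ → ‖W' x - W' y‖ ≤ δ := by
    intro x hx y hy hx0 hy0 hxy
    rw [hWu x hx0, hWl y hy0]
    have h1 : ⟪e, x⟫_ℝ - ⟪e, y⟫_ℝ ≤ ‖x - y‖ := by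
      rw [← inner_sub_right]
      have := real_inner_le_norm e (x - y)
      rwa [he, one_mul] at this
    exact hW3 x hx (σ y) (hσS y hy) hx0 (by rw [hσe]; linarith) (by linarith)
      (by rw [hσe]; linarith)
      ((norm_sub_hyperplaneReflection_le he hx0 hy0.le).trans_lt hxy)
  obtain ⟨P, hPh, hPW, hP1, hP2⟩ := H W'
    (fun x hx => by
      rcases le_or_gt 0 ⟪e, x⟫_ℝ with h | h
      · rw [hWu x h]; exact hW1 x hx h
      · rw [hWl x h, hns]; exact hW1 _ (hσS x hx) (by rw [hσe]; linarith))
    (fun x hx y hy hxy => by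
      rcases le_or_gt 0 ⟪e, x⟫_ℝ with h | h <;> rcases le_or_gt 0 ⟪e, y⟫_ℝ with h' | h'
      · rw [hWu x h, hWu y h']; exact hW2 x hx y hy h h' hxy
      · exact hcross x hx y hy h h' hxy
      · rw [norm_sub_rev] at hxy ⊢
        exact hcross y hy x hx h' h hxy
      · rw [hWl x h, hWl y h', ← smul_sub, hns]
        exact hW2 _ (hσS x hx) _ (hσS y hy) (by rw [hσe]; linarith) (by rw [hσe]; linarith)
          (by rwa [← map_sub, hσn]))
  have hPd : Differentiable ℝ P := fun x => (hPh x).1.differentiableAt (by norm_num)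
  -- `P` is symmetric only approximately; averaging over the reflection makes it exactly so without
  -- worsening the derivative bounds.
  set Q : EuclideanSpace ℝ (Fin n) → F := fun x => (1 / 2 : ℝ) • (P x + s • P (σ x)) with hQ
  have hQh : ∀ x, HarmonicAt Q x := fun x => by
    have h1 := HarmonicAt.comp_similarity σ 0 1 (x := x) (h := P) (hPh _)
    simp only [zero_add, one_smul] at h1
    exact ((hPh x).add (h1.const_smul (c := s))).const_smul (c := (1 / 2 : ℝ))
  have hQd : ∀ x, fderiv ℝ Q x = (1 / 2 : ℝ) • (fderiv ℝ P x + s • (fderiv ℝ P (σ x)).comp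
      ((σ : EuclideanSpace ℝ (Fin n) ≃L[ℝ] EuclideanSpace ℝ (Fin n)) :
        EuclideanSpace ℝ (Fin n) →L[ℝ] EuclideanSpace ℝ (Fin n))) := fun x => by
    have h1 := (hPd (σ x)).hasFDerivAt.comp x
      ((σ : EuclideanSpace ℝ (Fin n) ≃L[ℝ] EuclideanSpace ℝ (Fin n)) :
        EuclideanSpace ℝ (Fin n) →L[ℝ] EuclideanSpace ℝ (Fin n)).hasFDerivAt
    exact (((hPd x).hasFDerivAt.add (h1.const_smul s)).const_smul (1 / 2 : ℝ)).fderiv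
  have hav : ∀ (u v : F) (t : ℝ), ‖u‖ ≤ t → ‖v‖ ≤ t → ‖(1 / 2 : ℝ) • (u + s • v)‖ ≤ t := by
    intro u v t hu hv
    rw [norm_smul, Real.norm_of_nonneg (by norm_num)]
    have := norm_add_le u (s • v)
    rw [hns] at this
    linarith
  have hav' : ∀ (u v : EuclideanSpace ℝ (Fin n) →L[ℝ] F) (t : ℝ), ‖u‖ ≤ t → ‖v‖ ≤ t →
      ‖(1 / 2 : ℝ) • (u + s • v)‖ ≤ t := by
    intro u v t hu hv
    rw [norm_smul, Real.norm_of_nonneg (by norm_num)]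
    have := norm_add_le u (s • v)
    rw [norm_smul s, Real.norm_eq_abs, hs, one_mul] at this
    linarith
  have hPS : ∀ x ∈ sphere (0 : EuclideanSpace ℝ (Fin n)) R, ‖P x‖ ≤ 1 + 2 * δ := fun x hx => by
    have h1 : ‖W' x‖ ≤ 1 := by
      rcases le_or_gt 0 ⟪e, x⟫_ℝ with h | h
      · rw [hWu x h]; exact hW1 x hx h
      · rw [hWl x h, hns]; exact hW1 _ (hσS x hx) (by rw [hσe]; linarith)
    have h2 := norm_add_le (P x - W' x) (W' x)
    rw [sub_add_cancel] at h2
    linarith [hPW x hx]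
  refine ⟨Q, hQh, fun x => ?_, fun x hx hx0 => ?_, ?_, fun x hx => ?_, fun x hx y hy => ?_⟩
  · simp only [hQ]
    rw [hσσ, smul_comm, smul_add s, smul_smul, hss, one_smul, add_comm]
  · have h1 := hPW x hx
    rw [hWu x hx0] at h1
    -- The third `δ` is spent on the equator, where `σ x = x` but `W x` and `s • W x` may differ by
    -- `δ`.
    have h2 : ‖s • P (σ x) - W x‖ ≤ 3 * δ := by
      rcases hx0.eq_or_lt with h3 | h3
      · have h4 : σ x = x := hyperplaneReflection_eq_self he h3.symm
        have h5 := hW3 x hx x hx hx0 hx0 (by rw [← h3]; exact hρ) (by rw [← h3]; exact hρ)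
          (by simpa using hρ)
        rw [h4]
        have h6 : s • P x - W x = s • (P x - W x) - (W x - s • W x) := by rw [smul_sub]; abel
        rw [h6]
        refine (norm_sub_le _ _).trans ?_
        rw [hns]; linarith
      · have h4 := hPW (σ x) (hσS x hx)
        rw [hWl (σ x) (by rw [hσe]; linarith), hσσ] at h4
        have h6 : s • P (σ x) - W x = s • (P (σ x) - s • W x) := by
          rw [smul_sub, smul_smul, hss, one_smul]
        rw [h6, hns]
        linarith
    have h7 : Q x - W x = (1 / 2 : ℝ) • ((P x - W x) + (s • P (σ x) - W x)) := by
      simp only [hQ]; module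
    rw [h7, norm_smul, Real.norm_of_nonneg (by norm_num)]
    have := norm_add_le (P x - W x) (s • P (σ x) - W x)
    linarith
  · refine norm_le_of_harmonic_or_le (isCompact_closedBall _ _)
      (fun x _ => (hQh x).1.continuousAt.continuousWithinAt) (by positivity) fun x hx => ?_
    rcases (mem_closedBall.1 hx).eq_or_lt with h1 | h1
    · left
      exact hav _ _ _ (hPS x h1) (hPS _ (hσS x h1))
    · exact Or.inr ⟨ball_subset_interior_closedBall h1, hQh x⟩
  · rw [hQd]
    exact hav' _ _ _ (hP1 x hx) ((norm_comp_hyperplaneReflection_le _ e).trans (hP1 _ (hσB x hx)))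
  · rw [hQd, hQd, ← smul_sub, add_sub_add_comm, ← smul_sub, ← ContinuousLinearMap.sub_comp]
    refine hav' _ _ _ (hP2 x hx y hy) ((norm_comp_hyperplaneReflection_le _ e).trans ?_)
    have := hP2 _ (hσB x hx) _ (hσB y hy)
    rwa [← map_sub, hσn] at this

end ReflectedApproximation

/-! ### The component orthogonal to `f`: linear growth and odd approximation. -/

section OrthogonalPart

variable {n m : ℕ} {U : EuclideanSpace ℝ (Fin n) → EuclideanSpace ℝ (Fin m)}
  {e : EuclideanSpace ℝ (Fin n)} {f : EuclideanSpace ℝ (Fin m)} {ε : ℝ}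

/-- The component orthogonal to the unit vector `f`. -/
noncomputable def orthPart (f : EuclideanSpace ℝ (Fin m)) :
    EuclideanSpace ℝ (Fin m) →L[ℝ] EuclideanSpace ℝ (Fin m) :=
  ContinuousLinearMap.id ℝ _ - (innerSL ℝ f).smulRight f

theorem orthPart_apply (f v : EuclideanSpace ℝ (Fin m)) :
    orthPart f v = v - ⟪v, f⟫_ℝ • f := by
  simp [orthPart, real_inner_comm]

theorem inner_eq_of_unit (he : ‖e‖ = 1) : ⟪e, e⟫_ℝ = 1 := by
  rw [real_inner_self_eq_norm_sq, he]; norm_num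

theorem inner_sub_smul_self (he : ‖e‖ = 1) (x : EuclideanSpace ℝ (Fin n)) (s : ℝ) :
    ⟪e, x - s • e⟫_ℝ = ⟪e, x⟫_ℝ - s := by
  rw [inner_sub_right, inner_smul_right, inner_eq_of_unit he, mul_one]

theorem inner_add_smul_self (he : ‖e‖ = 1) (x : EuclideanSpace ℝ (Fin n)) (s : ℝ) :
    ⟪e, x + s • e⟫_ℝ = ⟪e, x⟫_ℝ + s := by
  rw [inner_add_right, inner_smul_right, inner_eq_of_unit he, mul_one]

theorem norm_sub_inner_smul_le (he : ‖e‖ = 1) (x : EuclideanSpace ℝ (Fin n)) :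
    ‖x - ⟪e, x⟫_ℝ • e‖ ≤ ‖x‖ := by
  have h1 := norm_sq_eq_inner_sq_add he x
  rw [real_inner_comm] at h1
  exact le_of_sq_le_sq (by nlinarith [sq_nonneg ⟪e, x⟫_ℝ]) (norm_nonneg _)

theorem abs_inner_le_of_unit (he : ‖e‖ = 1) (x : EuclideanSpace ℝ (Fin n)) :
    |⟪e, x⟫_ℝ| ≤ ‖x‖ := by
  have := abs_real_inner_le_norm e x
  rwa [he, one_mul] at this

theorem IsFlat.eq_zero (h : IsFlat U e f ε) {x : EuclideanSpace ℝ (Fin n)}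
    (hx : x ∈ ball (0 : EuclideanSpace ℝ (Fin n)) 1) (hxe : ⟪e, x⟫_ℝ ≤ -ε) : U x = 0 := by
  have := (h.1 x hx).2
  rw [max_eq_right (by linarith)] at this
  exact norm_le_zero_iff.1 this

theorem IsFlat.ne_zero (h : IsFlat U e f ε) {x : EuclideanSpace ℝ (Fin n)}
    (hx : x ∈ ball (0 : EuclideanSpace ℝ (Fin n)) 1) (hxe : ε < ⟪e, x⟫_ℝ) : U x ≠ 0 := fun h0 => by
  have := (h.1 x hx).1
  rw [h0, inner_zero_left] at this
  linarith

theorem IsFlat.norm_orthPart_le (h : IsFlat U e f ε) {x : EuclideanSpace ℝ (Fin n)}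
    (hx : x ∈ ball (0 : EuclideanSpace ℝ (Fin n)) 1) : ‖orthPart f (U x)‖ ≤ ε := by
  rw [orthPart_apply]; exact h.2 x hx

theorem IsViscositySolution.harmonicAt_orthPart (hU : IsViscositySolution (ball 0 1) U)
    (f : EuclideanSpace ℝ (Fin m)) {x : EuclideanSpace ℝ (Fin n)}
    (hx : x ∈ ball (0 : EuclideanSpace ℝ (Fin n)) 1)
    (hx0 : U x ≠ 0) : HarmonicAt (fun y => orthPart f (U y)) x :=
  (hU.harmonicAt hx hx0).comp_CLM (orthPart f)

/-- The component of a flat solution orthogonal to the main direction grows at most linearly. -/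
theorem IsFlat.norm_orthPart_le_linear (h : IsFlat U e f ε) (hU : IsViscositySolution (ball 0 1) U)
    (he : ‖e‖ = 1) (hε : 0 < ε) (hε' : ε ≤ 1 / 16) {x : EuclideanSpace ℝ (Fin n)}
    (hx : ‖x‖ ≤ 1 / 2) (hxe : -ε ≤ ⟪e, x⟫_ℝ) :
    ‖orthPart f (U x)‖ ≤ 4 * (n + 1) * ε * (⟪e, x⟫_ℝ + ε) := by
  have hn0 : (0 : ℝ) ≤ n := Nat.cast_nonneg n
  set s := ⟪e, x⟫_ℝ + ε with hs
  have hs0 : 0 ≤ s := by linarith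
  by_cases hs4 : 1 / 4 < s
  · have h1 := h.norm_orthPart_le (x := x) (by rw [mem_ball_zero_iff]; linarith)
    have h2 : (1 : ℝ) ≤ 4 * (n + 1) * s := by nlinarith
    nlinarith
  push Not at hs4
  by_cases h0 : orthPart f (U x) = 0
  · rw [h0, norm_zero]; positivity
  have hn : ‖orthPart f (U x)‖ ≠ 0 := norm_ne_zero_iff.2 h0
  set g := ‖orthPart f (U x)‖⁻¹ • orthPart f (U x) with hg
  have hgn : ‖g‖ = 1 := by rw [hg, norm_smul, norm_inv, norm_norm, inv_mul_cancel₀ hn]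
  have hgx : ⟪orthPart f (U x), g⟫_ℝ = ‖orthPart f (U x)‖ := by
    rw [hg, inner_smul_right, real_inner_self_eq_norm_sq, sq, ← mul_assoc, inv_mul_cancel₀ hn,
      one_mul]
  -- The foot of `x` on the plane `⟨e, ·⟩ = -ε`, where `U` vanishes; the barrier is used on the half
  -- ball above it. There the tested component is harmonic where `U ≠ 0` and zero elsewhere.
  set z := x - s • e with hz
  have hez : ⟪e, z⟫_ℝ = -ε := by rw [hz, inner_sub_smul_self he, hs]; ring
  have hzn : ‖z‖ ≤ 1 / 2 + ε := by
    have h1 : z = (x - ⟪e, x⟫_ℝ • e) - ε • e := by rw [hz, hs, add_smul]; abel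
    rw [h1]
    refine (norm_sub_le _ _).trans ?_
    rw [norm_smul, he, Real.norm_of_nonneg hε.le]
    linarith [norm_sub_inner_smul_le he x]
  have hin : ∀ y, ‖y - z‖ ≤ 1 / 4 → y ∈ ball (0 : EuclideanSpace ℝ (Fin n)) 1 := fun y hy => by
    rw [mem_ball_zero_iff]
    have := norm_add_le (y - z) z
    rw [sub_add_cancel] at this
    linarith
  have hxz : x - z = s • e := by rw [hz]; abel
  have hxzn : ‖x - z‖ = s := by rw [hxz, norm_smul, he, Real.norm_of_nonneg hs0, mul_one]
  have hxze : ⟪e, x - z⟫_ℝ = s := by rw [inner_sub_right, hez, hs]; ring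
  have key := le_halfBall_barrier (D := fun y => ⟪orthPart f (U y), g⟫_ℝ) (x₀ := z) he (R := 1 / 4)
    (M := ε) (by norm_num) hε.le
    (((orthPart f).continuous.comp_continuousOn (hU.continuousOn.mono fun y hy => hin y hy.1)).inner
      continuousOn_const)
    (fun y hy _ => (inner_le_norm_of_unit hgn _).trans (h.norm_orthPart_le (hin y hy)))
    (fun y hy hy0 => by
      rw [inner_sub_right, hez] at hy0
      rw [h.eq_zero (hin y hy) (by linarith)]; simp)
    (fun y hy _ => by
      by_cases hy0 : U y = 0
      · left; rw [hy0]; simp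
      · exact Or.inr ((hU.harmonicAt_orthPart f (hin y hy.le) hy0).inner_const g))
    (x := x) (by rw [hxzn]; exact hs4) (by rw [hxze]; exact hs0)
  simp only [hgx, hxzn, hxze, finrank_euclideanSpace_fin] at key
  refine key.trans ?_
  have h1 : s ^ 2 / (1 / 4) ^ 2 ≤ 4 * s := by
    have h2 : s ^ 2 / (1 / 4) ^ 2 = 16 * s * s := by ring
    rw [h2]
    nlinarith
  calc ε * (s ^ 2 / (1 / 4) ^ 2 + n * s / (1 / 4)) ≤ ε * (4 * s + n * s / (1 / 4)) := by gcongr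
    _ = 4 * (n + 1) * ε * s := by ring

theorem norm_sub_le_of_hyperplane_eq_zero {G : Type*} [NormedAddCommGroup G] [NormedSpace ℝ G]
    {P : EuclideanSpace ℝ (Fin n) → G} {K R : ℝ} (he : ‖e‖ = 1) (hP : Differentiable ℝ P)
    (hK : ∀ x ∈ closedBall 0 R, ‖fderiv ℝ P x‖ ≤ K) {x : EuclideanSpace ℝ (Fin n)}
    (hx : x ∈ closedBall 0 R) : ‖P x - P (x - ⟪e, x⟫_ℝ • e)‖ ≤ K * |⟪e, x⟫_ℝ| := by
  have hx' : x - ⟪e, x⟫_ℝ • e ∈ closedBall (0 : EuclideanSpace ℝ (Fin n)) R := by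
    rw [mem_closedBall_zero_iff] at hx ⊢
    exact (norm_sub_inner_smul_le he x).trans hx
  have := (convex_closedBall (0 : EuclideanSpace ℝ (Fin n)) R).norm_image_sub_le_of_norm_fderiv_le
    (𝕜 := ℝ) (fun y _ => hP y) hK hx' hx
  rwa [sub_sub_cancel, norm_smul, he, mul_one, Real.norm_eq_abs] at this

theorem eq_zero_of_odd {G : Type*} [NormedAddCommGroup G] [NormedSpace ℝ G]
    {P : EuclideanSpace ℝ (Fin n) → G} (he : ‖e‖ = 1)
    (hP : ∀ x, P (hyperplaneReflection e x) = (-1 : ℝ) • P x) {x : EuclideanSpace ℝ (Fin n)}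
    (hx : ⟪e, x⟫_ℝ = 0) : P x = 0 := by
  have h1 := hP x
  rw [hyperplaneReflection_eq_self he hx, neg_smul, one_smul] at h1
  have h2 : (2 : ℝ) • P x = 0 := by rw [two_smul]; nth_rewrite 1 [h1]; simp
  exact (smul_eq_zero.1 h2).resolve_left (by norm_num)

/-- The component of a flat solution orthogonal to the main direction is close to an odd harmonic
function. -/
theorem exists_odd_approx (n m : ℕ) {δ : ℝ} (hδ : 0 < δ) : ∃ ε₀ : ℝ, 0 < ε₀ ∧
    ∀ (U : EuclideanSpace ℝ (Fin n) → EuclideanSpace ℝ (Fin m)) (e : EuclideanSpace ℝ (Fin n))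
      (f : EuclideanSpace ℝ (Fin m)) (ε : ℝ), IsViscositySolution (ball 0 1) U → ‖e‖ = 1 →
      0 < ε → ε ≤ ε₀ → IsFlat U e f ε →
      ∃ P : EuclideanSpace ℝ (Fin n) → EuclideanSpace ℝ (Fin m), (∀ x, HarmonicAt P x) ∧
        (∀ x, ⟪e, x⟫_ℝ = 0 → P x = 0) ∧ (∀ x ∈ closedBall 0 (1 / 2), ‖P x‖ ≤ 1 + δ) ∧
        ∀ x ∈ closedBall 0 (1 / 2), 0 ≤ ⟪e, x⟫_ℝ → ‖orthPart f (U x) - ε • P x‖ ≤ δ * ε := by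
  rcases isEmpty_or_nonempty (Fin n) with hn | hn
  · refine ⟨1, one_pos, fun U e f ε _ he => ?_⟩
    have := nontrivial_of_norm_eq_one he
    exact absurd this (not_nontrivial _)
  have hn0 : (0 : ℝ) ≤ n := Nat.cast_nonneg n
  set C : ℝ := 4 * (n + 1) with hC
  have hC4 : 4 ≤ C := by linarith
  set δ' := δ / 3 with hδ'
  have hδ'0 : 0 < δ' := by positivity
  -- Up to height `2 τ` linear growth makes the normalised orthogonal part at most `δ' / 2`; above
  -- height `τ` the interior estimate controls its oscillation at scale `ρ`.
  set τ := min (δ' / (6 * C)) (1 / 4) with hτ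
  have hτ0 : 0 < τ := by positivity
  have hτ4 : τ ≤ 1 / 4 := min_le_right _ _
  have hτC : C * (3 * τ) ≤ δ' / 2 := by
    have : τ ≤ δ' / (6 * C) := min_le_left _ _
    rw [le_div_iff₀ (by positivity)] at this
    linarith
  set ρ := min (τ / 4) (δ' * τ / (2 * C)) with hρ
  have hρ0 : 0 < ρ := by positivity
  have hρ1 : ρ ≤ τ / 4 := min_le_left _ _
  have hρ2 : C / (τ / 2) * ρ ≤ δ' := by
    have : ρ ≤ δ' * τ / (2 * C) := min_le_right _ _
    rw [le_div_iff₀ (by positivity)] at this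
    rw [div_mul_eq_mul_div, div_le_iff₀ (by positivity)]
    linarith
  obtain ⟨K, hK0, H⟩ := exists_symmetric_harmonic_approx (n := n)
    (F := EuclideanSpace ℝ (Fin m)) (R := 1 / 2) (by norm_num) hδ'0 hρ0
  refine ⟨min (τ / 4) (δ / (3 * C + 2 * K)), by positivity, fun U e f ε hU he hε hεε hflat => ?_⟩
  have := nontrivial_of_norm_eq_one he
  have hετ : ε ≤ τ / 4 := hεε.trans (min_le_left _ _)
  have hε16 : ε ≤ 1 / 16 := by linarith
  have hεδ : (3 * C + 2 * K) * ε ≤ δ := by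
    have := hεε.trans (min_le_right _ _)
    rw [le_div_iff₀ (by positivity)] at this
    linarith
  set V : EuclideanSpace ℝ (Fin n) → EuclideanSpace ℝ (Fin m) := fun x => orthPart f (U x) with hV
  have hin : ∀ x : EuclideanSpace ℝ (Fin n), ‖x‖ ≤ 1 / 2 → x ∈ ball 0 1 := fun x hx => by
    rw [mem_ball_zero_iff]; linarith
  have hVlin : ∀ x : EuclideanSpace ℝ (Fin n), ‖x‖ ≤ 1 / 2 → 0 ≤ ⟪e, x⟫_ℝ → ⟪e, x⟫_ℝ ≤ 2 * τ →
      ‖ε⁻¹ • V x‖ ≤ δ' / 2 := fun x hx hx0 hx1 => by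
    rw [norm_smul, norm_inv, Real.norm_of_nonneg hε.le, inv_mul_le_iff₀ hε]
    refine (hflat.norm_orthPart_le_linear hU he hε hε16 hx (by linarith)).trans ?_
    have h1 : C * (⟪e, x⟫_ℝ + ε) ≤ C * (3 * τ) := by gcongr; linarith
    calc C * ε * (⟪e, x⟫_ℝ + ε) = ε * (C * (⟪e, x⟫_ℝ + ε)) := by ring
      _ ≤ ε * (δ' / 2) := by gcongr; exact h1.trans hτC
  have hVint : ∀ x y : EuclideanSpace ℝ (Fin n), ‖x‖ ≤ 1 / 2 → τ ≤ ⟪e, x⟫_ℝ → ‖x - y‖ < ρ →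
      ‖ε⁻¹ • V x - ε⁻¹ • V y‖ ≤ δ' := fun x y hx hx0 hxy => by
    have hb : ∀ z ∈ ball x (τ / 2), z ∈ ball (0 : EuclideanSpace ℝ (Fin n)) 1 ∧ U z ≠ 0 := by
      intro z hz
      rw [mem_ball, dist_eq_norm] at hz
      have hz1 : z ∈ ball (0 : EuclideanSpace ℝ (Fin n)) 1 := by
        rw [mem_ball_zero_iff]
        have := norm_add_le (z - x) x
        rw [sub_add_cancel] at this
        linarith
      refine ⟨hz1, hflat.ne_zero hz1 ?_⟩
      have h1 := neg_le_of_abs_le (abs_inner_le_of_unit he (z - x))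
      rw [inner_sub_right] at h1
      linarith
    have h1 := norm_sub_le_of_harmonic (h := V) (x₀ := x) (R := τ / 2) (M := ε) (by positivity)
      (fun z hz => hU.harmonicAt_orthPart f (hb z hz).1 (hb z hz).2)
      (fun z hz => hflat.norm_orthPart_le (hb z hz).1) (x := x) (y := y)
      (mem_closedBall_self (by positivity))
      (by rw [mem_closedBall, dist_eq_norm, norm_sub_rev]; linarith)
    rw [← smul_sub, norm_smul, norm_inv, Real.norm_of_nonneg hε.le, inv_mul_le_iff₀ hε]
    refine h1.trans ?_
    rw [finrank_euclideanSpace_fin]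
    calc 4 * ((n : ℝ) + 1) * ε / (τ / 2) * ‖x - y‖ ≤ 4 * ((n : ℝ) + 1) * ε / (τ / 2) * ρ := by
          gcongr
      _ = ε * (C / (τ / 2) * ρ) := by rw [hC]; ring
      _ ≤ ε * δ' := by gcongr
  have hnear : ∀ x y : EuclideanSpace ℝ (Fin n), ‖x - y‖ < ρ → ⟪e, y⟫_ℝ ≤ ⟪e, x⟫_ℝ + ρ :=
    fun x y hxy => by
      have h1 := (le_abs_self _).trans (abs_inner_le_of_unit he (y - x))
      rw [inner_sub_right, norm_sub_rev] at h1
      linarith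
  obtain ⟨P, hPh, hPodd, hPW, hPb, hPd, -⟩ := H e he (-1) (by simp) (fun x => ε⁻¹ • V x)
    (fun x hx _ => by
      rw [norm_smul, norm_inv, Real.norm_of_nonneg hε.le, inv_mul_le_iff₀ hε, mul_one]
      exact hflat.norm_orthPart_le (hin x (mem_sphere_zero_iff_norm.1 hx).le))
    (fun x hx y hy hx0 hy0 hxy => by
      rw [mem_sphere_zero_iff_norm] at hx hy
      rcases le_or_gt τ ⟪e, x⟫_ℝ with h1 | h1
      · exact hVint x y hx.le h1 hxy
      · have h2 := hVlin x hx.le hx0 (by linarith)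
        have h3 := hVlin y hy.le hy0 (by linarith [hnear x y hxy])
        exact (norm_sub_le _ _).trans (by linarith))
    (fun x hx y hy hx0 hy0 hx1 hy1 hxy => by
      rw [mem_sphere_zero_iff_norm] at hx hy
      have h2 := hVlin x hx.le hx0 (by linarith)
      have h3 := hVlin y hy.le hy0 (by linarith)
      rw [neg_smul, one_smul, sub_neg_eq_add]
      exact (norm_add_le _ _).trans (by linarith))
  have hP0 : ∀ x, ⟪e, x⟫_ℝ = 0 → P x = 0 := fun x hx => eq_zero_of_odd he hPodd hx
  refine ⟨P, hPh, hP0, fun x hx => (hPb x hx).trans (by linarith), ?_⟩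
  have hPlin : ∀ x : EuclideanSpace ℝ (Fin n), ‖x‖ ≤ 1 / 2 → ‖P x‖ ≤ K * |⟪e, x⟫_ℝ| := fun x hx => by
    have := norm_sub_le_of_hyperplane_eq_zero he
      (fun y => (hPh y).1.differentiableAt (by norm_num)) hPd (mem_closedBall_zero_iff.2 hx)
    rwa [hP0 (x - ⟪e, x⟫_ℝ • e) (by rw [inner_sub_smul_self he, sub_self]), sub_zero] at this
  have hlow : ∀ x : EuclideanSpace ℝ (Fin n), ‖x‖ ≤ 1 / 2 → 0 ≤ ⟪e, x⟫_ℝ → ⟪e, x⟫_ℝ ≤ 2 * ε →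
      ‖V x - ε • P x‖ ≤ δ * ε := fun x hx hx0 hx1 => by
    have h1 := hflat.norm_orthPart_le_linear hU he hε hε16 hx (by linarith)
    have h2 := hPlin x hx
    rw [abs_of_nonneg hx0] at h2
    have h3 : C * ε * (⟪e, x⟫_ℝ + ε) ≤ C * ε * (3 * ε) := by gcongr; linarith
    have h4 : K * ⟪e, x⟫_ℝ ≤ K * (2 * ε) := by gcongr
    have h5 := norm_sub_le (V x) (ε • P x)
    rw [norm_smul, Real.norm_of_nonneg hε.le] at h5
    have h6 : ε * ‖P x‖ ≤ ε * (K * (2 * ε)) := by gcongr; exact h2.trans h4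
    have h7 : ε * ((3 * C + 2 * K) * ε) ≤ ε * δ := by gcongr
    have h8 : ‖V x‖ ≤ C * ε * (3 * ε) := h1.trans h3
    linarith
  intro x hx hx0
  rw [mem_closedBall_zero_iff] at hx
  rcases le_or_gt ⟪e, x⟫_ℝ (2 * ε) with h | h
  · exact hlow x hx hx0 h
  have hVc : ContinuousOn V (ball 0 1) := (orthPart f).continuous.comp_continuousOn hU.continuousOn
  have hPc : Continuous P := continuous_iff_continuousAt.2 fun y => (hPh y).1.continuousAt
  -- The comparison is made above height `2 ε`, where `U ≠ 0` and both functions are harmonic. On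
  -- the flat side both are of order `ε²`; on the sphere `P` was chosen close.
  refine norm_le_of_harmonic_or_le (isCompact_halfBall (0 : EuclideanSpace ℝ (Fin n)) e (1 / 2)
    (2 * ε)) (h := fun y => V y - ε • P y) ?_ (M := δ * ε) (by positivity) (fun y hy => ?_) x
    ⟨by rwa [sub_zero], by rw [sub_zero]; exact h.le⟩
  · refine ContinuousOn.sub (hVc.mono fun y hy => hin y ?_) (hPc.const_smul ε).continuousOn
    simpa using hy.1
  · obtain ⟨hy1, hy2⟩ := hy
    rw [sub_zero] at hy1 hy2
    rcases hy2.eq_or_lt with h1 | h1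
    · exact Or.inl (hlow y hy1 (by linarith) h1.symm.le)
    rcases hy1.eq_or_lt with h2 | h2
    · left
      have h3 := hPW y (mem_sphere_zero_iff_norm.2 h2) (by linarith)
      have h4 : V y - ε • P y = (-ε) • (P y - ε⁻¹ • V y) := by
        rw [smul_sub, smul_smul, neg_mul, mul_inv_cancel₀ hε.ne']; simp; abel
      rw [h4, norm_smul, norm_neg, Real.norm_of_nonneg hε.le]
      nlinarith
    · right
      refine ⟨mem_interior_halfBall (by rwa [sub_zero]) (by rwa [sub_zero]), ?_⟩
      exact (hU.harmonicAt_orthPart f (hin y hy1) (hflat.ne_zero (hin y hy1) (by linarith))).sub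
        ((hPh y).const_smul (c := ε))

end OrthogonalPart

/-! ### The component along `f`: the linearised Neumann problem. -/

section EvenApproximation

variable {n m : ℕ} {U : EuclideanSpace ℝ (Fin n) → EuclideanSpace ℝ (Fin m)}
  {e : EuclideanSpace ℝ (Fin n)} {f : EuclideanSpace ℝ (Fin m)} {ε : ℝ}

/-- The normal derivative of an even function is controlled by the distance to the hyperplane. -/
theorem abs_fderiv_apply_le_of_even {P : EuclideanSpace ℝ (Fin n) → ℝ} {K R : ℝ} (he : ‖e‖ = 1)
    (hP : Differentiable ℝ P) (hP' : ∀ x, P (hyperplaneReflection e x) = P x)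
    (hK : ∀ x ∈ closedBall 0 R, ∀ y ∈ closedBall 0 R, ‖fderiv ℝ P x - fderiv ℝ P y‖ ≤ K * ‖x - y‖)
    {x : EuclideanSpace ℝ (Fin n)} (hx : x ∈ closedBall 0 R) :
    |fderiv ℝ P x e| ≤ K * |⟪e, x⟫_ℝ| := by
  set z := x - ⟪e, x⟫_ℝ • e with hz
  have hze : ⟪e, z⟫_ℝ = 0 := by rw [hz, inner_sub_smul_self he, sub_self]
  have hzR : z ∈ closedBall (0 : EuclideanSpace ℝ (Fin n)) R := by
    rw [mem_closedBall_zero_iff] at hx ⊢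
    exact (norm_sub_inner_smul_le he x).trans hx
  have h1 : fderiv ℝ P z e = 0 := by
    have h2 := fderiv_comp_hyperplaneReflection (P := P) (e := e) (x := z) (hP _)
    rw [hyperplaneReflection_eq_self he hze] at h2
    simp only [hP'] at h2
    have h3 := congrArg (fun L => L e) h2
    have h4 : hyperplaneReflection e e = -e := by
      rw [hyperplaneReflection_apply he, inner_eq_of_unit he]; module
    simp only [ContinuousLinearMap.comp_apply, ContinuousLinearEquiv.coe_coe,
      LinearIsometryEquiv.coe_toContinuousLinearEquiv, h4, map_neg] at h3
    change fderiv ℝ P z e = - fderiv ℝ P z e at h3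
    linarith
  have h2 := (fderiv ℝ P x - fderiv ℝ P z).le_opNorm e
  rw [sub_apply, h1, sub_zero, he, mul_one, Real.norm_eq_abs] at h2
  refine (h2.trans (hK x hx z hzR)).trans_eq ?_
  rw [hz, sub_sub_cancel, norm_smul, he, mul_one, Real.norm_eq_abs]

/-- Adding a small quadratic polynomial makes a harmonic function strictly subharmonic and strictly
increasing in the direction `e`, near the hyperplane. -/
theorem exists_subharmonic_perturbation [Nonempty (Fin n)] {Q : EuclideanSpace ℝ (Fin n) → ℝ}
    {K δ : ℝ}
    (he : ‖e‖ = 1) (hδ : 0 < δ) (hQ : ∀ x, HarmonicAt Q x)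
    (hQK : ∀ x ∈ closedBall 0 (1 / 2), ‖fderiv ℝ Q x‖ ≤ K)
    (hQe : ∀ x ∈ closedBall 0 (1 / 2), |fderiv ℝ Q x e| ≤ K * |⟪e, x⟫_ℝ|) :
    ∃ w : EuclideanSpace ℝ (Fin n) → ℝ, ContDiff ℝ 2 w ∧ (∀ x, 0 < Δ w x) ∧
      (∀ x ∈ sphere 0 (1 / 2), w x ≤ Q x) ∧
      (∀ x ∈ closedBall 0 (1 / 2), Q x - 2 * δ ≤ w x) ∧
      (∀ x ∈ closedBall 0 (1 / 2), ‖fderiv ℝ w x‖ ≤ K + 2 * δ) ∧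
      ∀ x ∈ closedBall 0 (1 / 2), δ - (K + 2 * δ) * |⟪e, x⟫_ℝ| ≤ fderiv ℝ w x e := by
  have hn : (0 : ℝ) < n := Nat.cast_pos.2 Fin.pos'
  -- On the sphere of radius `1/2` the linear and quadratic terms are at most `δ / 2` and `δ / 4`;
  -- the constant makes the sum nonpositive.
  set q := quadFun (-(3 / 4) * δ) δ 0 (δ • e) (0 : EuclideanSpace ℝ (Fin n)) 0 with hq
  have hqx : ∀ x, q x = -(3 / 4) * δ + δ * ⟪e, x⟫_ℝ + δ * ‖x‖ ^ 2 := fun x => by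
    simp [hq, quadFun, real_inner_smul_left]
  have hqd : ∀ x, fderiv ℝ q x = δ • innerSL ℝ e + (2 * δ) • innerSL ℝ x := fun x => by
    rw [hq, (hasFDerivAt_quadFun _ _ _ _ _ _ _).fderiv]
    ext v; simp
  have hd : ∀ x, fderiv ℝ (fun y => Q y + q y) x =
      fderiv ℝ Q x + (δ • innerSL ℝ e + (2 * δ) • innerSL ℝ x) := fun x => by
    rw [← hqd]
    exact fderiv_fun_add ((hQ x).1.differentiableAt (by norm_num))
      (hasFDerivAt_quadFun _ _ _ _ _ _ _).differentiableAt
  refine ⟨fun y => Q y + q y, ?_, fun x => ?_, fun x hx => ?_, fun x hx => ?_, fun x hx => ?_,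
    fun x hx => ?_⟩
  · exact (contDiff_iff_contDiffAt.2 fun x => (hQ x).1).add (contDiff_quadFun _ _ _ _ _ _)
  · have h1 := (hQ x).1.laplacian_add (contDiff_quadFun (-(3 / 4) * δ) δ 0 (δ • e)
      (0 : EuclideanSpace ℝ (Fin n)) 0).contDiffAt (x := x)
    change 0 < Δ (Q + q) x
    rw [hq, h1, (hQ x).2.self_of_nhds, laplacian_quadFun, finrank_euclideanSpace_fin]
    simp
    positivity
  · rw [mem_sphere_zero_iff_norm] at hx
    have := (le_abs_self _).trans (abs_inner_le_of_unit he x)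
    simp only [hqx, hx] at this ⊢
    nlinarith
  · rw [mem_closedBall_zero_iff] at hx
    have := neg_le_of_abs_le (abs_inner_le_of_unit he x)
    simp only [hqx]
    nlinarith [sq_nonneg ‖x‖]
  · rw [hd]
    have h1 := hQK x hx
    rw [mem_closedBall_zero_iff] at hx
    have h2 : ‖δ • innerSL ℝ e + (2 * δ) • innerSL ℝ x‖ ≤ δ * 1 + 2 * δ * (1 / 2) := by
      refine (norm_add_le _ _).trans ?_
      rw [norm_smul, norm_smul, innerSL_apply_norm, innerSL_apply_norm, he,
        Real.norm_of_nonneg hδ.le, Real.norm_of_nonneg (by positivity)]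
      gcongr
    exact (norm_add_le _ _).trans (by linarith)
  · rw [hd]
    have h1 := neg_le_of_abs_le (hQe x hx)
    have h2 := neg_abs_le ⟪e, x⟫_ℝ
    simp only [add_apply, smul_apply, innerSL_apply_apply, smul_eq_mul, inner_eq_of_unit he]
    rw [real_inner_comm e x]
    nlinarith

theorem IsFlat.abs_inner_le (h : IsFlat U e f ε)
    (hU : IsViscositySolution (ball 0 1) U) {x : EuclideanSpace ℝ (Fin n)}
    (hx : x ∈ freeBoundary (ball 0 1) U) : |⟪e, x⟫_ℝ| ≤ ε := by
  obtain ⟨hxb, hx0, hxc⟩ := (mem_freeBoundary_iff hU.continuousOn).1 hx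
  have h1 := (h.1 x hxb).1
  have h2 := (h.1.norm_le_of_mem_closure isOpen_ball hxb hxc).1
  rw [hx0, inner_zero_left] at h1
  exact abs_le.2 ⟨by linarith, by linarith⟩

/-- A flat solution is squeezed between two translates of a harmonic perturbation of the linear
solution as soon as it is on the sphere. -/
theorem IsFlat.squeeze_of_sphere [Nonempty (Fin n)] (hflat : IsFlat U e f ε)
    (hU : IsViscositySolution (ball 0 1) U) (he : ‖e‖ = 1) (hf : ‖f‖ = 1) (hε : 0 < ε)
    {P : EuclideanSpace ℝ (Fin n) → ℝ} {K δ : ℝ} (hδ : 0 < δ)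
    (hP : ∀ x, HarmonicAt P x) (hPe : ∀ x, P (hyperplaneReflection e x) = P x)
    (hPK : ∀ x ∈ closedBall 0 (1 / 2), ‖fderiv ℝ P x‖ ≤ K)
    (hPL : ∀ x ∈ closedBall 0 (1 / 2), ∀ y ∈ closedBall 0 (1 / 2),
      ‖fderiv ℝ P x - fderiv ℝ P y‖ ≤ K * ‖x - y‖)
    (hε1 : (K + 2 * δ) * ε ≤ δ / 2) (hε2 : ε * (K + 2 * δ) ^ 2 < δ) (hε3 : ε * (K + 2 * δ) < 1)
    (hlow : ∀ x ∈ sphere 0 (1 / 2), ⟪e, x⟫_ℝ + ε * (P x - 6 * δ) ≤ ⟪U x, f⟫_ℝ)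
    (hupp : ∀ x ∈ sphere 0 (1 / 2), x ∈ closure (positivitySet (ball 0 1) U) →
      ‖U x‖ ≤ ⟪e, x⟫_ℝ + ε * (P x + 6 * δ)) :
    ∀ x ∈ closedBall 0 (1 / 2), ⟪e, x⟫_ℝ + ε * (P x - 8 * δ) ≤ ⟪U x, f⟫_ℝ ∧
      (x ∈ closure (positivitySet (ball 0 1) U) → ‖U x‖ ≤ ⟪e, x⟫_ℝ + ε * (P x + 8 * δ)) := by
  have hK0 : 0 ≤ K := (norm_nonneg _).trans (hPK 0 (mem_closedBall_self (by norm_num)))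
  have hKc := isCompact_closedBall (0 : EuclideanSpace ℝ (Fin n)) (1 / 2)
  have hKb : closedBall (0 : EuclideanSpace ℝ (Fin n)) (1 / 2) ⊆ ball 0 1 :=
    closedBall_subset_ball (by norm_num)
  have hsph : ∀ x ∈ closedBall (0 : EuclideanSpace ℝ (Fin n)) (1 / 2),
      x ∉ interior (closedBall (0 : EuclideanSpace ℝ (Fin n)) (1 / 2)) → x ∈ sphere 0 (1 / 2) := by
    intro x hx hxi
    rw [interior_closedBall _ (by norm_num)] at hxi
    rw [mem_closedBall] at hx
    rw [mem_ball, not_lt] at hxi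
    exact le_antisymm hx hxi
  have hPd : Differentiable ℝ P := fun y => (hP y).1.differentiableAt (by norm_num)
  have hPe' := fun x hx => abs_fderiv_apply_le_of_even he hPd hPe hPL (x := x) hx
  have hN : ∀ x, HarmonicAt (fun y => -P y) x := fun x => by
    have h1 := (hP x).const_smul (c := (-1 : ℝ))
    rwa [neg_one_smul] at h1
  have hNd : ∀ x, fderiv ℝ (fun y => -P y) x = -fderiv ℝ P x := fun x => fderiv_fun_neg
  -- The free boundary lies at height at most `ε`, where the normal derivative of an even function
  -- is `O(ε)`, so the added linear term decides its sign. Evenness enters here as the Neumann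
  -- condition.
  have hdir : ∀ w : EuclideanSpace ℝ (Fin n) → ℝ, (∀ x ∈ closedBall 0 (1 / 2),
      δ - (K + 2 * δ) * |⟪e, x⟫_ℝ| ≤ fderiv ℝ w x e) →
      ∀ x ∈ interior (closedBall (0 : EuclideanSpace ℝ (Fin n)) (1 / 2)),
        x ∈ freeBoundary (ball 0 1) U → δ / 2 ≤ fderiv ℝ w x e := fun w hw x hx hxF => by
    have h1 := hw x (interior_subset hx)
    have h2 : (K + 2 * δ) * |⟪e, x⟫_ℝ| ≤ (K + 2 * δ) * ε := by
      gcongr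
      exact hflat.abs_inner_le hU hxF
    linarith
  -- `w` perturbs `P` and gives the lower barrier; `v` perturbs `-P`, and subtracting it gives the
  -- upper one.
  obtain ⟨w, hwc, hwΔ, hws, hwb, hwn, hwe⟩ := exists_subharmonic_perturbation he hδ hP hPK hPe'
  obtain ⟨v, hvc, hvΔ, hvs, hvb, hvn, hve⟩ := exists_subharmonic_perturbation he hδ hN
    (fun x hx => by rw [hNd, norm_neg]; exact hPK x hx)
    (fun x hx => by rw [hNd, neg_apply, abs_neg]; exact hPe' x hx)
  have key1 := hU.affine_add_le_inner he hf hKc hKb hwc (a := -(6 * ε * δ)) hε (fun x _ => hwΔ x)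
    (fun x hx hxF => by linarith [hdir w hwe x hx hxF]) (fun x hx hxi => by
      have h1 := hlow x (hsph x hx hxi)
      have h2 := mul_le_mul_of_nonneg_left (hws x (hsph x hx hxi)) hε.le
      linarith)
  have key2 := hU.norm_le_affine_sub he hKc hKb hvc (b := 6 * ε * δ) hε (fun x _ => hvΔ x)
    (fun x hx hxF => by
      have h1 := hdir v hve x hx hxF
      have h2 := hvn x (interior_subset hx)
      have h3 : fderiv ℝ v x e ≤ ‖fderiv ℝ v x‖ := by
        have := (fderiv ℝ v x).le_opNorm e
        rw [he, mul_one] at this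
        exact (le_abs_self _).trans this
      constructor
      · have h4 : ε * ‖fderiv ℝ v x‖ ^ 2 ≤ ε * (K + 2 * δ) ^ 2 := by gcongr
        linarith
      · have h4 : ε * fderiv ℝ v x e ≤ ε * (K + 2 * δ) := by gcongr; exact h3.trans h2
        linarith) (fun x hx hxi hxc => by
      have h1 := hupp x (hsph x hx hxi) hxc
      have h2 := mul_le_mul_of_nonneg_left (hvs x (hsph x hx hxi)) hε.le
      linarith)
  intro x hx
  constructor
  · have h1 := key1 x hx
    have h2 := mul_le_mul_of_nonneg_left (hwb x hx) hε.le
    linarith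
  · intro hxc
    have h1 := key2 x hx hxc
    have h2 := mul_le_mul_of_nonneg_left (hvb x hx) hε.le
    linarith

/-- The main component of a flat solution is close to a perturbation of the linear solution by an even
harmonic function. -/
theorem exists_even_approx (n m : ℕ) {δ : ℝ} (hδ : 0 < δ) (hδ1 : δ ≤ 1) : ∃ ε₀ : ℝ, 0 < ε₀ ∧
    ∀ (U : EuclideanSpace ℝ (Fin n) → EuclideanSpace ℝ (Fin m)) (e : EuclideanSpace ℝ (Fin n))
      (f : EuclideanSpace ℝ (Fin m)) (ε : ℝ), IsViscositySolution (ball 0 1) U → ‖e‖ = 1 →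
      ‖f‖ = 1 → 0 < ε → ε ≤ ε₀ → IsFlat U e f ε →
      ∃ P : EuclideanSpace ℝ (Fin n) → ℝ, (∀ x, HarmonicAt P x) ∧
        (∀ x, P (hyperplaneReflection e x) = P x) ∧ (∀ x ∈ closedBall 0 (1 / 2), |P x| ≤ 2) ∧
        ∀ x ∈ closedBall 0 (1 / 2), ⟪e, x⟫_ℝ + ε * (P x - δ) ≤ ⟪U x, f⟫_ℝ ∧
          (x ∈ closure (positivitySet (ball 0 1) U) → ‖U x‖ ≤ ⟪e, x⟫_ℝ + ε * (P x + δ)) := by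
  rcases isEmpty_or_nonempty (Fin n) with hn | hn
  · refine ⟨1, one_pos, fun U e f ε _ he => ?_⟩
    have := nontrivial_of_norm_eq_one he
    exact absurd this (not_nontrivial _)
  have hn0 : (0 : ℝ) ≤ n := Nat.cast_nonneg n
  set C : ℝ := 4 * (n + 1) with hC
  have hC4 : 4 ≤ C := by linarith
  set d := δ / 8 with hd
  have hd0 : 0 < d := by positivity
  have hd1 : d ≤ 1 / 8 := by linarith
  obtain ⟨τ, ε₁, hτ0, hτ2, hε₁, HT⟩ := exists_trapped_of_flat n m hd0
  set ρ := min (τ / 16) (d * τ / (8 * C)) with hρ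
  have hρ0 : 0 < ρ := by positivity
  have hρ1 : ρ ≤ τ / 16 := min_le_left _ _
  have hρ2 : C / (τ / 8) * ρ ≤ d := by
    have : ρ ≤ d * τ / (8 * C) := min_le_right _ _
    rw [le_div_iff₀ (by positivity)] at this
    rw [div_mul_eq_mul_div, div_le_iff₀ (by positivity)]
    linarith
  obtain ⟨K, hK0, H⟩ := exists_symmetric_harmonic_approx (n := n) (F := ℝ) (R := 1 / 2)
    (by norm_num) hd0 hρ0
  have hKd : 0 < K + 2 * d := by positivity
  refine ⟨min (min ε₁ (min (ρ / 4) (τ * d / 16))) (min (d / (4 * (K + 2 * d)))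
    (min (d / (2 * (K + 2 * d) ^ 2)) (1 / (2 * (K + 2 * d))))), by positivity,
    fun U e f ε hU he hf hε hεε hflat => ?_⟩
  have := nontrivial_of_norm_eq_one he
  simp only [le_min_iff] at hεε
  obtain ⟨⟨hεε₁, hερ, hετd⟩, hεK1, hεK2, hεK3⟩ := hεε
  rw [le_div_iff₀ (by positivity)] at hεK1 hεK2 hεK3
  have hετ : ε ≤ τ / 64 := by linarith
  -- Trapping bounds `h` from both sides only at points higher than `ε`. The data on the upper
  -- hemisphere are therefore read at `x + (2 * ε) • e`.
  set h : EuclideanSpace ℝ (Fin n) → ℝ := fun x => ⟪U x, f⟫_ℝ - ⟪e, x⟫_ℝ with hh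
  have habs := fun x => abs_le.1 (abs_inner_le_of_unit he x)
  have hbd : ∀ x ∈ ball (0 : EuclideanSpace ℝ (Fin n)) 1, ε ≤ ⟪e, x⟫_ℝ → |h x| ≤ ε :=
    fun x hx hx0 => by
      obtain ⟨h1, h2⟩ := hflat.1 x hx
      rw [max_eq_left (by linarith)] at h2
      have h3 := inner_le_norm_of_unit hf (U x)
      exact abs_le.2 ⟨by linarith, by linarith⟩
  have htrap : ∀ x : EuclideanSpace ℝ (Fin n), ‖x‖ ≤ 1 / 2 → |⟪e, x⟫_ℝ| < τ / 4 →
      ∃ a b : ℝ, b - a ≤ d * ε ∧ -ε ≤ a ∧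
        IsTrapped U e f a b (ball (x - ⟪e, x⟫_ℝ • e) τ) := fun x hx hx0 => by
    obtain ⟨a, b, ha, -, hab, hT⟩ := HT U e f ε hU he hf hε hεε₁ hflat (x - ⟪e, x⟫_ℝ • e)
      (by rw [inner_sub_smul_self he, sub_self]) ((norm_sub_inner_smul_le he x).trans hx)
    exact ⟨a, b, hab, ha, hT⟩
  have hmem : ∀ x y : EuclideanSpace ℝ (Fin n), |⟪e, x⟫_ℝ| < τ / 4 → ‖y - x‖ < τ / 2 →
      y ∈ ball (x - ⟪e, x⟫_ℝ • e) τ := fun x y hx hy => by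
    have h1 : y - (x - ⟪e, x⟫_ℝ • e) = (y - x) + ⟪e, x⟫_ℝ • e := by abel
    rw [mem_ball, dist_eq_norm, h1]
    refine (norm_add_le _ _).trans_lt ?_
    rw [norm_smul, he, mul_one, Real.norm_eq_abs]
    linarith
  have hval : ∀ {a b : ℝ} {s : Set (EuclideanSpace ℝ (Fin n))}, IsTrapped U e f a b s → -ε ≤ a →
      ∀ y ∈ s, ε < ⟪e, y⟫_ℝ → a ≤ h y ∧ h y ≤ b := fun {a b s} hT ha y hy hy0 => by
    obtain ⟨h1, h2⟩ := hT y hy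
    have h3 := (inner_le_norm_of_unit hf (U y)).trans h2
    refine ⟨by simp only [hh]; linarith, ?_⟩
    rcases le_max_iff.1 h3 with h4 | h4
    · simp only [hh]; linarith
    · linarith
  have hint : ∀ x y : EuclideanSpace ℝ (Fin n), ‖x‖ ≤ 1 / 2 + 2 * ε → τ / 4 ≤ ⟪e, x⟫_ℝ →
      ‖x - y‖ ≤ ρ → |h x - h y| ≤ d * ε := fun x y hx hx0 hxy => by
    have hb : ∀ z ∈ ball x (τ / 8), z ∈ ball (0 : EuclideanSpace ℝ (Fin n)) 1 ∧
        ε < ⟪e, z⟫_ℝ := by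
      intro z hz
      rw [mem_ball, dist_eq_norm] at hz
      constructor
      · rw [mem_ball_zero_iff]
        have := norm_add_le (z - x) x
        rw [sub_add_cancel] at this
        linarith
      · have h1 := (habs (z - x)).1
        rw [inner_sub_right] at h1
        linarith
    have h1 := norm_sub_le_of_harmonic (h := h) (x₀ := x) (R := τ / 8) (M := ε) (by positivity)
      (fun z hz => ?_) (fun z hz => hbd z (hb z hz).1 (hb z hz).2.le) (x := x) (y := y)
      (mem_closedBall_self (by positivity))
      (by rw [mem_closedBall, dist_eq_norm, norm_sub_rev]; linarith)
    · rw [finrank_euclideanSpace_fin] at h1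
      refine h1.trans ?_
      calc 4 * ((n : ℝ) + 1) * ε / (τ / 8) * ‖x - y‖ ≤ 4 * ((n : ℝ) + 1) * ε / (τ / 8) * ρ := by
            gcongr
        _ = ε * (C / (τ / 8) * ρ) := by rw [hC]; ring
        _ ≤ ε * d := by gcongr
        _ = d * ε := mul_comm _ _
    · have h2 : (fun y : EuclideanSpace ℝ (Fin n) => ⟪e, y⟫_ℝ) = quadFun 0 0 0 e 0 0 := by
        ext y; simp [quadFun]
      refine ((hU.harmonicAt (hb z hz).1 (hflat.ne_zero (hb z hz).1 (hb z hz).2)).inner_const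
        f).sub (f₂ := fun y => ⟪e, y⟫_ℝ) ?_
      rw [h2]
      exact ⟨(contDiff_quadFun _ _ _ _ _ _).contDiffAt,
        Eventually.of_forall fun y => by rw [laplacian_quadFun]; simp⟩
  have hshn : ∀ x : EuclideanSpace ℝ (Fin n), ‖x + (2 * ε) • e - x‖ = 2 * ε := fun x => by
    rw [add_sub_cancel_left, norm_smul, he, mul_one, Real.norm_of_nonneg (by positivity)]
  have hshb : ∀ x : EuclideanSpace ℝ (Fin n), ‖x‖ ≤ 1 / 2 → ‖x + (2 * ε) • e‖ ≤ 1 / 2 + 2 * ε :=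
    fun x hx => by
      have := norm_add_le (x + (2 * ε) • e - x) x
      rw [sub_add_cancel, hshn] at this
      linarith
  have hW : ∀ x y : EuclideanSpace ℝ (Fin n), ‖x‖ = 1 / 2 → 0 ≤ ⟪e, x⟫_ℝ → 0 ≤ ⟪e, y⟫_ℝ →
      ‖x - y‖ < ρ → |ε⁻¹ * h (x + (2 * ε) • e) - ε⁻¹ * h (y + (2 * ε) • e)| ≤ d :=
    fun x y hx hx0 hy0 hxy => by
      rw [← mul_sub, abs_mul, abs_of_pos (inv_pos.2 hε), inv_mul_le_iff₀ hε, mul_comm ε d]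
      -- Near the hyperplane the oscillation is controlled by the partial Harnack inequality, higher
      -- up by the interior Lipschitz estimate.
      rcases lt_or_ge ⟪e, x⟫_ℝ (τ / 4) with h1 | h1
      · have h2 : |⟪e, x⟫_ℝ| < τ / 4 := by rwa [abs_of_nonneg hx0]
        obtain ⟨a, b, hab, ha, hT⟩ := htrap x hx.le h2
        have h3 := hval hT ha _ (hmem x (x + (2 * ε) • e) h2 (by rw [hshn]; linarith))
          (by rw [inner_add_smul_self he]; linarith)
        have h4 := hval hT ha _ (hmem x (y + (2 * ε) • e) h2 (by
          have h5 : y + (2 * ε) • e - x = (y + (2 * ε) • e - y) - (x - y) := by abel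
          rw [h5]
          refine (norm_sub_le _ _).trans_lt ?_
          rw [hshn]; linarith)) (by rw [inner_add_smul_self he]; linarith)
        exact abs_le.2 ⟨by linarith, by linarith⟩
      · exact hint _ _ (hshb x hx.le) (by rw [inner_add_smul_self he]; linarith)
          (by rw [add_sub_add_right_eq_sub]; exact hxy.le)
  obtain ⟨P, hPh, hPe, hPW, hPb, hPK, hPL⟩ := H e he 1 (by simp)
    (fun x => ε⁻¹ * h (x + (2 * ε) • e))
    (fun x hx hx0 => by
      rw [mem_sphere_zero_iff_norm] at hx
      rw [Real.norm_eq_abs, abs_mul, abs_of_pos (inv_pos.2 hε), inv_mul_le_iff₀ hε, mul_one]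
      refine hbd _ ?_ ?_
      · rw [mem_ball_zero_iff]
        linarith [hshb x hx.le]
      · rw [inner_add_smul_self he]; linarith)
    (fun x hx y hy hx0 hy0 hxy => hW x y (mem_sphere_zero_iff_norm.1 hx) hx0 hy0 hxy)
    (fun x hx y hy hx0 hy0 _ _ hxy => by
      rw [one_smul]
      exact hW x y (mem_sphere_zero_iff_norm.1 hx) hx0 hy0 hxy)
  simp only [one_smul] at hPe
  refine ⟨P, hPh, hPe, fun x hx => (hPb x hx).trans (by linarith), ?_⟩
  have hPh' : ∀ x ∈ sphere (0 : EuclideanSpace ℝ (Fin n)) (1 / 2), 0 ≤ ⟪e, x⟫_ℝ →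
      |ε * P x - h (x + (2 * ε) • e)| ≤ 3 * d * ε := fun x hx hx0 => by
    have h1 := mul_le_mul_of_nonneg_left (hPW x hx hx0) hε.le
    rw [Real.norm_eq_abs, ← abs_of_pos hε, ← abs_mul, abs_of_pos hε, mul_sub,
      mul_inv_cancel_left₀ hε.ne'] at h1
    linarith
  -- Near the equator the Harnack band is compared with `ε P`; for `x` below the hyperplane this is
  -- done at its mirror image, where `P` takes the same value.
  have hplane : ∀ x ∈ sphere (0 : EuclideanSpace ℝ (Fin n)) (1 / 2), |⟪e, x⟫_ℝ| < τ / 4 →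
      ∃ a b : ℝ, IsTrapped U e f a b (ball (x - ⟪e, x⟫_ℝ • e) τ) ∧
        ε * P x ≤ a + 4 * d * ε ∧ b ≤ ε * P x + 4 * d * ε := fun x hx hx0 => by
    obtain ⟨a, b, hab, ha, hT⟩ := htrap x (mem_sphere_zero_iff_norm.1 hx).le hx0
    obtain ⟨x', hx', hx'e, hx'P, hx'0⟩ : ∃ x' ∈ sphere (0 : EuclideanSpace ℝ (Fin n)) (1 / 2),
        0 ≤ ⟪e, x'⟫_ℝ ∧ P x' = P x ∧ x' + (2 * ε) • e ∈ ball (x - ⟪e, x⟫_ℝ • e) τ := by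
      rcases le_total 0 ⟪e, x⟫_ℝ with h1 | h1
      · exact ⟨x, hx, h1, rfl, hmem x _ hx0 (by rw [hshn]; linarith)⟩
      · refine ⟨hyperplaneReflection e x, ?_, ?_, hPe x, ?_⟩
        · rw [mem_sphere_zero_iff_norm, (hyperplaneReflection e).norm_map]
          exact mem_sphere_zero_iff_norm.1 hx
        · rw [inner_hyperplaneReflection he]; linarith
        · have h2 : hyperplaneReflection e x + (2 * ε) • e - (x - ⟪e, x⟫_ℝ • e) =
              (-⟪e, x⟫_ℝ + 2 * ε) • e := by
            rw [hyperplaneReflection_apply he]; module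
          rw [mem_ball, dist_eq_norm, h2, norm_smul, he, mul_one, Real.norm_eq_abs]
          rw [abs_of_nonpos h1] at hx0
          rw [abs_of_nonneg (by linarith)]
          linarith
    have h1 := hval hT ha _ hx'0 (by rw [inner_add_smul_self he]; linarith)
    have h2 := abs_le.1 (hPh' x' hx' hx'e)
    rw [hx'P] at h2
    exact ⟨a, b, hT, by linarith, by linarith⟩
  have hfar : ∀ x ∈ sphere (0 : EuclideanSpace ℝ (Fin n)) (1 / 2), τ / 4 ≤ ⟪e, x⟫_ℝ →
      |ε * P x - h x| ≤ 4 * d * ε := fun x hx hx0 => by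
    have h1 := hint x (x + (2 * ε) • e)
      (by rw [mem_sphere_zero_iff_norm.1 hx]; linarith) hx0
      (by rw [norm_sub_rev, hshn]; linarith)
    have h2 := abs_le.1 (hPh' x hx (by linarith))
    have h3 := abs_le.1 h1
    exact abs_le.2 ⟨by linarith, by linarith⟩
  have hsb : ∀ x ∈ sphere (0 : EuclideanSpace ℝ (Fin n)) (1 / 2),
      x ∈ ball (0 : EuclideanSpace ℝ (Fin n)) 1 := fun x hx => by
    rw [mem_ball_zero_iff, mem_sphere_zero_iff_norm.1 hx]; norm_num
  have hself : ∀ x : EuclideanSpace ℝ (Fin n), |⟪e, x⟫_ℝ| < τ / 4 →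
      x ∈ ball (x - ⟪e, x⟫_ℝ • e) τ := fun x hx => hmem x x hx (by simp; positivity)
  have hdε : 0 < d * ε := by positivity
  have h8 : 8 * d = δ := by rw [hd]; ring
  rw [← h8]
  -- Three regions of the sphere: near the equator the band decides, far above `h` is close to `ε
  -- P`, and far below `U` vanishes and no point belongs to the closure of the positivity set.
  refine hflat.squeeze_of_sphere hU he hf hε hd0 hPh hPe hPK hPL (by linarith)
    (by nlinarith) (by linarith) (fun x hx => ?_) (fun x hx hxc => ?_)
  · rcases lt_or_ge |⟪e, x⟫_ℝ| (τ / 4) with h1 | h1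
    · obtain ⟨a, b, hT, ha, -⟩ := hplane x hx h1
      have := (hT x (hself x h1)).1
      linarith
    rcases le_abs.1 h1 with h2 | h2
    · have := (abs_le.1 (hfar x hx h2)).2
      simp only [hh] at this
      linarith
    · have h3 := (abs_le.1 (hPb x (sphere_subset_closedBall hx))).2
      have h4 : ε * P x ≤ ε * 2 := by gcongr; linarith
      rw [hflat.eq_zero (hsb x hx) (by linarith), inner_zero_left]
      linarith
  · rcases lt_or_ge |⟪e, x⟫_ℝ| (τ / 4) with h1 | h1
    · obtain ⟨a, b, hT, -, hb⟩ := hplane x hx h1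
      have := (hT.norm_le_of_mem_closure isOpen_ball (hself x h1) hxc).2
      linarith
    rcases le_abs.1 h1 with h2 | h2
    · have h3 := (abs_le.1 (hfar x hx h2)).1
      have h4 := (hflat.1 x (hsb x hx)).1
      have h5 := norm_le_inner_add_of_unit hf hdε.le (show 0 < τ / 8 by positivity)
        (v := U x) (by linarith) (by
          have h6 := hflat.2 x (hsb x hx)
          have h7 : ‖U x - ⟪U x, f⟫_ℝ • f‖ ^ 2 ≤ ε ^ 2 := by gcongr
          nlinarith)
      simp only [hh] at h3
      linarith
    · have := (hflat.1.norm_le_of_mem_closure isOpen_ball (hsb x hx) hxc).1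
      linarith

end EvenApproximation

/-! ### Improvement of flatness by tilting `e` and `f`. -/

section ImprovementOfFlatness

variable {n m : ℕ} {U : EuclideanSpace ℝ (Fin n) → EuclideanSpace ℝ (Fin m)}
  {e : EuclideanSpace ℝ (Fin n)} {f : EuclideanSpace ℝ (Fin m)} {ε : ℝ}

/-- Pythagoras: an orthogonal tilt of size `ε` changes the norm only to second order, so normalising
the tilted direction is harmless. -/
theorem norm_add_smul_of_orthogonal {ξ : EuclideanSpace ℝ (Fin n)} {G : ℝ} (he : ‖e‖ = 1)
    (hξ : ⟪e, ξ⟫_ℝ = 0) (hξG : ‖ξ‖ ≤ G) (ε : ℝ) :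
    1 ≤ ‖e + ε • ξ‖ ∧ ‖e + ε • ξ‖ ≤ 1 + (ε * G) ^ 2 := by
  have h1 : ‖e + ε • ξ‖ ^ 2 = 1 + ε ^ 2 * ‖ξ‖ ^ 2 := by
    rw [norm_add_sq_real, inner_smul_right, hξ, he, norm_smul, mul_pow, Real.norm_eq_abs, sq_abs]
    ring
  have h2 : ε ^ 2 * ‖ξ‖ ^ 2 ≤ (ε * G) ^ 2 := by rw [mul_pow]; gcongr
  have h3 : 0 ≤ ε ^ 2 * ‖ξ‖ ^ 2 := by positivity
  exact ⟨le_of_sq_le_sq (by linarith) (norm_nonneg _),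
    le_of_sq_le_sq (by nlinarith) (by positivity)⟩

theorem norm_sub_inner_smul_le_norm_sub {f : EuclideanSpace ℝ (Fin m)} (hf : ‖f‖ = 1)
    (v : EuclideanSpace ℝ (Fin m)) (s : ℝ) : ‖v - ⟪v, f⟫_ℝ • f‖ ≤ ‖v - s • f‖ := by
  have h1 := norm_sq_eq_inner_sq_add hf v
  have h2 : ‖v - s • f‖ ^ 2 = ‖v‖ ^ 2 - 2 * s * ⟪v, f⟫_ℝ + s ^ 2 := by
    rw [norm_sub_sq_real, inner_smul_right, norm_smul, hf, mul_one, Real.norm_eq_abs, sq_abs]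
    ring
  exact le_of_sq_le_sq (by nlinarith [sq_nonneg (s - ⟪v, f⟫_ℝ)]) (norm_nonneg _)

/-- Flatness at a smaller scale, in tilted directions, from a first order expansion. -/
theorem IsFlat.rescale_of_tilt (hflat : IsFlat U e f ε) (he : ‖e‖ = 1) (hf : ‖f‖ = 1) (hε : 0 < ε)
    (hε1 : ε ≤ 1) {ξ : EuclideanSpace ℝ (Fin n)} {c : EuclideanSpace ℝ (Fin m)} {G r : ℝ}
    (hr : 0 < r) (hr1 : r ≤ 1) (hξ : ⟪e, ξ⟫_ℝ = 0) (hc : ⟪f, c⟫_ℝ = 0) (hξG : ‖ξ‖ ≤ G)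
    (hcG : ‖c‖ ≤ G) (hεG : ε * (3 * G ^ 2 + 3 * G) ≤ r / 8)
    (hlow : ∀ x ∈ ball 0 r, ⟪e, x⟫_ℝ + ε * (⟪ξ, x⟫_ℝ - r / 8) ≤ ⟪U x, f⟫_ℝ)
    (hupp : ∀ x ∈ ball 0 r, x ∈ closure (positivitySet (ball 0 1) U) →
      ‖U x‖ ≤ ⟪e, x⟫_ℝ + ε * (⟪ξ, x⟫_ℝ + r / 8))
    (horth : ∀ x ∈ ball 0 r, 0 ≤ ⟪e, x⟫_ℝ → ‖orthPart f (U x) - (ε * ⟪e, x⟫_ℝ) • c‖ ≤ ε * (r / 8))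
    (horth' : ∀ x ∈ ball 0 r, -ε ≤ ⟪e, x⟫_ℝ → ⟪e, x⟫_ℝ ≤ 0 → ‖orthPart f (U x)‖ ≤ G * ε ^ 2) :
    ∃ (e' : EuclideanSpace ℝ (Fin n)) (f' : EuclideanSpace ℝ (Fin m)), ‖e'‖ = 1 ∧ ‖f'‖ = 1 ∧
      ‖e' - e‖ ≤ (G + G ^ 2) * ε ∧ IsFlat (rescale U 0 r) e' f' (ε / 2) := by
  have hG0 : 0 ≤ G := (norm_nonneg _).trans hξG
  obtain ⟨hN1, hN2⟩ := norm_add_smul_of_orthogonal he hξ hξG ε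
  obtain ⟨hM1, hM2⟩ := norm_add_smul_of_orthogonal hf hc hcG ε
  set N := ‖e + ε • ξ‖ with hN
  set M := ‖f + ε • c‖ with hM
  have hN0 : 0 < N := by linarith
  have hM0 : 0 < M := by linarith
  set e' := N⁻¹ • (e + ε • ξ) with he'
  set f' := M⁻¹ • (f + ε • c) with hf'
  have he'1 : ‖e'‖ = 1 := by
    rw [he', norm_smul, norm_inv, Real.norm_of_nonneg hN0.le, inv_mul_cancel₀ hN0.ne']
  have hf'1 : ‖f'‖ = 1 := by
    rw [hf', norm_smul, norm_inv, Real.norm_of_nonneg hM0.le, inv_mul_cancel₀ hM0.ne']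
  have hNe : N • e' = e + ε • ξ := by rw [he', smul_smul, mul_inv_cancel₀ hN0.ne', one_smul]
  have hMf : M • f' = f + ε • c := by rw [hf', smul_smul, mul_inv_cancel₀ hM0.ne', one_smul]
  have hball : ∀ x ∈ ball (0 : EuclideanSpace ℝ (Fin n)) r, x ∈ ball 0 1 := fun x hx =>
    ball_subset_ball hr1 hx
  have hsq : (ε * G) ^ 2 = ε * (ε * G ^ 2) := by ring
  have hlin : ∀ x ∈ ball (0 : EuclideanSpace ℝ (Fin n)) r,
      |⟪e, x⟫_ℝ + ε * ⟪ξ, x⟫_ℝ - ⟪e', x⟫_ℝ| ≤ ε * (ε * G ^ 2) := fun x hx => by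
    have h1 : ⟪e, x⟫_ℝ + ε * ⟪ξ, x⟫_ℝ = N * ⟪e', x⟫_ℝ := by
      have := congrArg (fun v => ⟪v, x⟫_ℝ) hNe
      simp only [inner_add_left, real_inner_smul_left] at this
      exact this.symm
    have h2 := abs_inner_le_of_unit he'1 x
    rw [mem_ball_zero_iff] at hx
    rw [h1, ← sub_one_mul, abs_mul, abs_of_nonneg (by linarith)]
    calc (N - 1) * |⟪e', x⟫_ℝ| ≤ (ε * G) ^ 2 * 1 := by gcongr <;> linarith
      _ = ε * (ε * G ^ 2) := by ring
  have hu : ∀ x ∈ ball (0 : EuclideanSpace ℝ (Fin n)) r,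
      |⟪U x, f'⟫_ℝ - ⟪U x, f⟫_ℝ| ≤ ε * (ε * (2 * G ^ 2 + G)) := fun x hx => by
    have hx1 := hball x hx
    have hUn : ‖U x‖ ≤ 2 := by
      refine (hflat.1 x hx1).2.trans (max_le ?_ (by norm_num))
      have := (le_abs_self _).trans (abs_inner_le_of_unit he x)
      rw [mem_ball_zero_iff] at hx1
      linarith
    have h1 : M * ⟪U x, f'⟫_ℝ = ⟪U x, f⟫_ℝ + ε * ⟪U x, c⟫_ℝ := by
      rw [← inner_smul_right, hMf, inner_add_right, inner_smul_right]
    -- Since `c` is orthogonal to `f` it sees only the part of size `ε`; tilting `f` thus changes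
    -- the main component by `O(ε²)`.
    have h2 : ⟪U x, c⟫_ℝ = ⟪orthPart f (U x), c⟫_ℝ := by
      rw [orthPart_apply, inner_sub_left, real_inner_smul_left, hc]; ring
    have h3 : |⟪U x, c⟫_ℝ| ≤ ε * G := by
      rw [h2]
      refine (abs_real_inner_le_norm _ _).trans ?_
      gcongr
      exact hflat.norm_orthPart_le hx1
    have h4 : |⟪U x, f'⟫_ℝ| ≤ 2 := by
      have := abs_real_inner_le_norm (U x) f'
      rw [hf'1, mul_one] at this
      linarith
    have h5 : ⟪U x, f'⟫_ℝ - ⟪U x, f⟫_ℝ = ε * ⟪U x, c⟫_ℝ - (M - 1) * ⟪U x, f'⟫_ℝ := by linarith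
    rw [h5]
    refine (abs_sub _ _).trans ?_
    rw [abs_mul, abs_mul, abs_of_pos hε, abs_of_nonneg (a := M - 1) (by linarith)]
    have h6 : ε * |⟪U x, c⟫_ℝ| ≤ ε * (ε * G) := by gcongr
    have h7 : (M - 1) * |⟪U x, f'⟫_ℝ| ≤ (ε * G) ^ 2 * 2 := by gcongr; linarith
    linarith
  have hG1 : ε * (ε * G ^ 2) + ε * (ε * (2 * G ^ 2 + G)) ≤ ε * (r / 8) := by
    have : ε * (ε * (3 * G ^ 2 + 3 * G)) ≤ ε * (r / 8) := by gcongr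
    have h0 : 0 ≤ ε * (ε * G) := by positivity
    linarith
  have hG2 : 3 * G * ε ^ 2 ≤ ε * (r / 8) := by
    have : ε * (ε * (3 * G ^ 2 + 3 * G)) ≤ ε * (r / 8) := by gcongr
    have h0 : 0 ≤ ε * (ε * G ^ 2) := by positivity
    linarith
  have hεr : 0 < ε * r := by positivity
  have hT : IsTrapped U e' f' (-(r * (ε / 2))) (r * (ε / 2)) (ball 0 r) := fun x hx => by
    have h1 := abs_le.1 (hlin x hx)
    have h2 := abs_le.1 (hu x hx)
    have h0 : 0 ≤ ε * (ε * G ^ 2) := by positivity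
    have h0' : 0 ≤ ε * (ε * (2 * G ^ 2 + G)) := by positivity
    constructor
    · have h3 := hlow x hx
      linarith
    · refine norm_le_max_of_closure (hball x hx) fun hxc => ?_
      have h3 := hupp x hx hxc
      linarith
  refine ⟨e', f', he'1, hf'1, ?_, ?_, fun x hx => ?_⟩
  · have h1 : e' - e = ε • ξ - (N - 1) • e' := by
      rw [sub_smul, hNe, one_smul]; abel
    rw [h1]
    refine (norm_sub_le _ _).trans ?_
    rw [norm_smul, norm_smul, he'1, Real.norm_of_nonneg hε.le, Real.norm_of_nonneg (by linarith),
      mul_one]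
    have h2 : ε * ‖ξ‖ ≤ ε * G := by gcongr
    have h3 : ε * (ε * G ^ 2) ≤ ε * (1 * G ^ 2) := by gcongr
    linarith
  · have := hT.rescale (x₀ := 0) hr
    rw [inner_zero_right, zero_add, zero_add, mul_neg, inv_mul_cancel_left₀ hr.ne'] at this
    exact this
  · rw [norm_sub_rescale hr, inv_mul_le_iff₀ hr, zero_add]
    have hx' : r • x ∈ ball (0 : EuclideanSpace ℝ (Fin n)) r := by
      simpa using add_smul_mem_ball (x₀ := 0) hr hx
    generalize r • x = y at hx'
    have hy1 := hball y hx'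
    set u := ⟪U y, f⟫_ℝ with hu'
    obtain ⟨h1, h2⟩ := hflat.1 y hy1
    have h3 := inner_le_norm_of_unit hf (U y)
    -- This multiple satisfies `(u * M) • f' = u • f + (ε * u) • c`, so what remains is `orthPart f
    -- (U y) - (ε * u) • c`. In the upper half `u` is within `ε` of `⟨e, y⟩`; in the strip below,
    -- both terms are of order `ε²`; further down `U` vanishes.
    refine (norm_sub_inner_smul_le_norm_sub hf'1 (U y) (u * M)).trans ?_
    have h4 : U y - (u * M) • f' = orthPart f (U y) - (ε * u) • c := by
      rw [mul_smul, hMf, orthPart_apply, smul_add, smul_smul, mul_comm ε u]; abel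
    rw [h4]
    rcases le_or_gt 0 ⟪e, y⟫_ℝ with h5 | h5
    · have h6 : orthPart f (U y) - (ε * u) • c =
          (orthPart f (U y) - (ε * ⟪e, y⟫_ℝ) • c) - (ε * (u - ⟪e, y⟫_ℝ)) • c := by
        rw [mul_sub, sub_smul]; abel
      rw [h6]
      refine (norm_sub_le _ _).trans ?_
      rw [max_eq_left (by linarith)] at h2
      have h7 : |u - ⟪e, y⟫_ℝ| ≤ ε := abs_le.2 ⟨by linarith, by linarith⟩
      have h8 : ‖(ε * (u - ⟪e, y⟫_ℝ)) • c‖ ≤ ε * ε * G := by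
        rw [norm_smul, norm_mul, Real.norm_of_nonneg hε.le, Real.norm_eq_abs]
        gcongr
      have h9 : 0 ≤ G * ε ^ 2 := by positivity
      linarith [horth y hx' h5]
    rcases le_or_gt (-ε) ⟪e, y⟫_ℝ with h6 | h6
    · refine (norm_sub_le _ _).trans ?_
      have h7 : |u| ≤ 2 * ε := abs_le.2 ⟨by linarith, by
        have : max (⟪e, y⟫_ℝ + ε) 0 ≤ ε := max_le (by linarith) hε.le
        linarith⟩
      have h8 : ‖(ε * u) • c‖ ≤ ε * (2 * ε) * G := by
        rw [norm_smul, norm_mul, Real.norm_of_nonneg hε.le, Real.norm_eq_abs]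
        gcongr
      linarith [horth' y hx' h6 h5.le]
    · have h7 := hflat.eq_zero hy1 h6.le
      rw [h7] at hu'
      rw [hu', h7]
      simp
      positivity

/-- Improvement of flatness: at a free boundary point, the flatness is halved at a fixed smaller
scale, up to tilting the directions. -/
theorem exists_improvement_of_flatness (n m : ℕ) : ∃ r ε₀ C : ℝ, 0 < r ∧ r ≤ 1 / 16 ∧ 0 < ε₀ ∧
    0 ≤ C ∧
    ∀ (U : EuclideanSpace ℝ (Fin n) → EuclideanSpace ℝ (Fin m)) (e : EuclideanSpace ℝ (Fin n))
      (f : EuclideanSpace ℝ (Fin m)) (ε : ℝ), IsViscositySolution (ball 0 1) U → ‖e‖ = 1 →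
      ‖f‖ = 1 → 0 < ε → ε ≤ ε₀ → IsFlat U e f ε → 0 ∈ freeBoundary (ball 0 1) U →
      ∃ (e' : EuclideanSpace ℝ (Fin n)) (f' : EuclideanSpace ℝ (Fin m)), ‖e'‖ = 1 ∧ ‖f'‖ = 1 ∧
        ‖e' - e‖ ≤ C * ε ∧ IsFlat (rescale U 0 r) e' f' (ε / 2) := by
  have hn0 : (0 : ℝ) ≤ n := Nat.cast_nonneg n
  set G : ℝ := 16 * (n + 1) with hG
  set C₁ : ℝ := 32 * (4 * (n + 1)) ^ 2 with hC₁
  have hC₁0 : 0 < C₁ := by positivity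
  -- Makes the Taylor remainder `C₁ r²` at most `r / 16`, a small fraction of the scale.
  set r : ℝ := min (1 / 16) (1 / (16 * C₁)) with hr
  have hr0 : 0 < r := by positivity
  have hr16 : r ≤ 1 / 16 := min_le_left _ _
  have hrC : C₁ * r ^ 2 ≤ r / 16 := by
    have : r ≤ 1 / (16 * C₁) := min_le_right _ _
    rw [le_div_iff₀ (by positivity)] at this
    nlinarith
  have hδ0 : 0 < r / 32 := by positivity
  obtain ⟨ε₁, hε₁, H1⟩ := exists_even_approx n m hδ0 (by linarith)
  obtain ⟨ε₂, hε₂, H2⟩ := exists_odd_approx n m hδ0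
  refine ⟨r, min (min ε₁ ε₂) (min (1 / 16) (r / (8 * (3 * G ^ 2 + 3 * G)))), G + G ^ 2, hr0, hr16,
    by positivity, by positivity, fun U e f ε hU he hf hε hεε hflat h0 => ?_⟩
  have := nontrivial_of_norm_eq_one he
  simp only [le_min_iff] at hεε
  obtain ⟨⟨hεε₁, hεε₂⟩, hε16, hεG⟩ := hεε
  rw [le_div_iff₀ (by positivity)] at hεG
  obtain ⟨P, hPh, hPe, hPb, hP⟩ := H1 U e f ε hU he hf hε hεε₁ hflat
  obtain ⟨Q, hQh, hQ0, hQb, hQ⟩ := H2 U e f ε hU he hε hεε₂ hflat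
  obtain ⟨-, hU0, h0c⟩ := (mem_freeBoundary_iff hU.continuousOn).1 h0
  have hzero : (0 : EuclideanSpace ℝ (Fin n)) ∈ closedBall 0 (1 / 2) :=
    mem_closedBall_self (by norm_num)
  have hsub : ∀ x ∈ ball (0 : EuclideanSpace ℝ (Fin n)) r, x ∈ closedBall 0 (1 / 2) := fun x hx =>
    ball_subset_closedBall (ball_subset_ball (by linarith) hx)
  have hsub8 : ∀ x ∈ ball (0 : EuclideanSpace ℝ (Fin n)) r, x ∈ closedBall 0 (1 / 2 / 8) :=
    fun x hx => ball_subset_closedBall (ball_subset_ball (by linarith) hx)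
  have hb : ∀ x ∈ ball (0 : EuclideanSpace ℝ (Fin n)) (1 / 2), x ∈ closedBall 0 (1 / 2) :=
    fun x hx => ball_subset_closedBall hx
  have hPd := norm_fderiv_le_of_harmonic (h := P) (x₀ := 0) (R := 1 / 2) (M := 2) (by norm_num)
    (fun x _ => hPh x) (fun x hx => hPb x (hb x hx))
  have hQb' : ∀ x ∈ ball (0 : EuclideanSpace ℝ (Fin n)) (1 / 2), ‖Q x‖ ≤ 2 := fun x hx =>
    (hQb x (hb x hx)).trans (by linarith)
  have hQd := norm_fderiv_le_of_harmonic (h := Q) (x₀ := 0) (R := 1 / 2) (M := 2) (by norm_num)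
    (fun x _ => hQh x) hQb'
  have hexp : ∀ x ∈ ball (0 : EuclideanSpace ℝ (Fin n)) r,
      ‖P x - P 0 - fderiv ℝ P 0 x‖ ≤ r / 16 ∧ ‖Q x - fderiv ℝ Q 0 x‖ ≤ r / 16 := fun x hx => by
    have h1 := norm_sub_fderiv_le_of_harmonic (h := P) (x₀ := 0) (R := 1 / 2) (M := 2) (by norm_num)
      (fun x _ => hPh x) (fun x hx => hPb x (hb x hx)) (hsub8 x hx)
    have h2 := norm_sub_fderiv_le_of_harmonic (h := Q) (x₀ := 0) (R := 1 / 2) (M := 2) (by norm_num)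
      (fun x _ => hQh x) hQb' (hsub8 x hx)
    rw [sub_zero, finrank_euclideanSpace_fin] at h1 h2
    rw [hQ0 0 (inner_zero_right _), sub_zero] at h2
    rw [mem_ball_zero_iff] at hx
    have h3 : 4 * (4 * ((n : ℝ) + 1)) ^ 2 * 2 / (1 / 2) ^ 2 * ‖x‖ ^ 2 ≤ r / 16 := by
      calc 4 * (4 * ((n : ℝ) + 1)) ^ 2 * 2 / (1 / 2) ^ 2 * ‖x‖ ^ 2 = C₁ * ‖x‖ ^ 2 := by
            rw [hC₁]; ring
        _ ≤ C₁ * r ^ 2 := by gcongr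
        _ ≤ r / 16 := hrC
    exact ⟨h1.trans h3, h2.trans h3⟩
  rw [finrank_euclideanSpace_fin] at hPd hQd
  have hGG : 4 * ((n : ℝ) + 1) * 2 / (1 / 2) = G := by rw [hG]; ring
  rw [hGG] at hPd hQd
  set ξ := (InnerProductSpace.toDual ℝ (EuclideanSpace ℝ (Fin n))).symm (fderiv ℝ P 0) with hξ
  have hξx : ∀ x, ⟪ξ, x⟫_ℝ = fderiv ℝ P 0 x := fun x => InnerProductSpace.toDual_symm_apply
  have hξe : ⟪e, ξ⟫_ℝ = 0 := by
    -- On the ball of radius zero the Lipschitz hypothesis holds with `K = 0`, and the estimate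
    -- becomes the exact vanishing of the normal derivative at the origin.
    have h1 := abs_fderiv_apply_le_of_even (R := 0) (K := 0) (x := 0) he
      (fun y => (hPh y).1.differentiableAt (by norm_num)) hPe
      (fun x hx y hy => by
        simp only [closedBall_zero, mem_singleton_iff] at hx hy
        simp [hx, hy]) (by simp)
    rw [zero_mul] at h1
    rw [real_inner_comm, hξx]
    exact abs_nonpos_iff.1 h1
  have hξG : ‖ξ‖ ≤ G := by rw [hξ, LinearIsometryEquiv.norm_map]; exact hPd
  have hOc : ∀ v : EuclideanSpace ℝ (Fin m), ‖orthPart f v‖ ≤ ‖v‖ := fun v => by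
    rw [orthPart_apply, real_inner_comm]
    exact norm_sub_inner_smul_le hf v
  have hOO : ∀ v : EuclideanSpace ℝ (Fin m), orthPart f (orthPart f v) = orthPart f v := fun v => by
    have : ⟪orthPart f v, f⟫_ℝ = 0 := by
      rw [orthPart_apply, inner_sub_left, real_inner_smul_left, inner_eq_of_unit hf]; ring
    rw [orthPart_apply f (orthPart f v), this, zero_smul, sub_zero]
  set L := fderiv ℝ Q 0 with hL
  -- The tilt of `f` is the normal derivative of `Q`, projected because `Q` need not take values
  -- orthogonal to `f`.
  set c := orthPart f (L e) with hc
  have hcf : ⟪f, c⟫_ℝ = 0 := by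
    rw [hc, orthPart_apply, inner_sub_right, inner_smul_right, inner_eq_of_unit hf,
      real_inner_comm]
    ring
  have hcG : ‖c‖ ≤ G := (hOc _).trans (by
    have := L.le_opNorm e
    rw [he, mul_one] at this
    exact this.trans hQd)
  have hLx : ∀ x, L x = ⟪e, x⟫_ℝ • L e := fun x => by
    set z := x - ⟪e, x⟫_ℝ • e with hz
    have hze : ⟪e, z⟫_ℝ = 0 := by rw [hz, inner_sub_smul_self he, sub_self]
    have h1 : HasDerivAt (fun s : ℝ => Q (s • z)) (L z) 0 := by
      have h2 : HasFDerivAt Q L ((0 : ℝ) • z) := by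
        rw [zero_smul]; exact ((hQh 0).1.differentiableAt (by norm_num)).hasFDerivAt
      have h3 : HasDerivAt (fun s : ℝ => s • z) z 0 := by
        simpa using (hasDerivAt_id (0 : ℝ)).smul_const z
      exact h2.comp_hasDerivAt 0 h3
    have h2 : (fun s : ℝ => Q (s • z)) = fun _ => 0 := funext fun s =>
      hQ0 _ (by rw [inner_smul_right, hze, mul_zero])
    rw [h2] at h1
    have h3 : L z = 0 := h1.unique (hasDerivAt_const _ _)
    rw [hz, map_sub, map_smul, sub_eq_zero] at h3
    exact h3
  -- The origin is a free boundary point, so both squeeze inequalities apply there with `U = 0`.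
  have hP0 : |P 0| ≤ r / 32 := by
    obtain ⟨h1, h2⟩ := hP 0 hzero
    have h2 := h2 h0c
    rw [hU0, inner_zero_left, inner_zero_right, zero_add] at h1
    rw [hU0, norm_zero, inner_zero_right, zero_add] at h2
    have h3 := nonpos_of_mul_nonpos_right h1 hε
    have h4 := nonneg_of_mul_nonneg_right h2 hε
    exact abs_le.2 ⟨by linarith, by linarith⟩
  have hP0' := abs_le.1 hP0
  refine hflat.rescale_of_tilt he hf hε (by linarith) hr0 (by linarith) hξe hcf hξG hcG
    (by linarith) (fun x hx => ?_) (fun x hx hxc => ?_) (fun x hx hx0 => ?_)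
    (fun x hx hx0 hx1 => ?_)
  · have h1 := (hP x (hsub x hx)).1
    have h2 := abs_le.1 (hexp x hx).1
    rw [hξx]
    refine le_trans ?_ h1
    have h3 := mul_le_mul_of_nonneg_left (show fderiv ℝ P 0 x - r / 8 ≤ P x - r / 32 by linarith)
      hε.le
    linarith
  · have h1 := (hP x (hsub x hx)).2 hxc
    have h2 := abs_le.1 (hexp x hx).1
    rw [hξx]
    refine h1.trans ?_
    have h3 := mul_le_mul_of_nonneg_left (show P x + r / 32 ≤ fderiv ℝ P 0 x + r / 8 by linarith)
      hε.le
    linarith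
  · have h1 : orthPart f (U x) - (ε * ⟪e, x⟫_ℝ) • c =
        orthPart f ((orthPart f (U x) - ε • Q x) + ε • (Q x - L x)) := by
      rw [hLx, map_add, map_sub, map_smul, map_smul, map_sub, map_smul, hOO, ← hc, smul_sub,
        smul_smul]
      abel
    rw [h1]
    refine (hOc _).trans ((norm_add_le _ _).trans ?_)
    have h2 := hQ x (hsub x hx) hx0
    rw [norm_smul, Real.norm_of_nonneg hε.le]
    have h3 := mul_le_mul_of_nonneg_left (hexp x hx).2 hε.le
    have h4 : 0 < ε * r := by positivity
    linarith
  · have h1 := hflat.norm_orthPart_le_linear hU he hε hε16 (x := x)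
      (mem_closedBall_zero_iff.1 (hsub x hx)) hx0
    refine h1.trans ?_
    calc 4 * ((n : ℝ) + 1) * ε * (⟪e, x⟫_ℝ + ε) ≤ 4 * ((n : ℝ) + 1) * ε * ε := by gcongr; linarith
      _ ≤ G * ε ^ 2 := by rw [hG]; nlinarith [mul_nonneg hn0 (sq_nonneg ε), sq_nonneg ε]

end ImprovementOfFlatness

/-! ### Iteration at a free boundary point: convergence of the normals. -/

section Iteration

variable {n m : ℕ} {U : EuclideanSpace ℝ (Fin n) → EuclideanSpace ℝ (Fin m)}
  {e : EuclideanSpace ℝ (Fin n)} {f : EuclideanSpace ℝ (Fin m)} {ε : ℝ}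

theorem mem_freeBoundary_rescale (hU : ContinuousOn U (ball 0 1)) {x₀ x : EuclideanSpace ℝ (Fin n)}
    {r : ℝ} (hr : 0 < r) (hb : ball x₀ r ⊆ ball 0 1)
    (hx : x ∈ ball (0 : EuclideanSpace ℝ (Fin n)) 1)
    (hxF : x₀ + r • x ∈ freeBoundary (ball 0 1) U) :
    x ∈ freeBoundary (ball 0 1) (rescale U x₀ r) := by
  obtain ⟨-, h0, hc⟩ := (mem_freeBoundary_iff hU).1 hxF
  rw [mem_freeBoundary_iff (continuousOn_rescale hU hr hb)]
  have hA : Continuous fun z : EuclideanSpace ℝ (Fin n) => r⁻¹ • (z - x₀) := by fun_prop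
  have hAx : r⁻¹ • (x₀ + r • x - x₀) = x := by simp [smul_smul, hr.ne']
  refine ⟨hx, by simp [rescale, h0], ?_⟩
  have h1 := isOpen_ball.inter_closure ⟨add_smul_mem_ball (x₀ := x₀) hr hx, hc⟩
  have h2 := map_mem_closure (f := fun z => r⁻¹ • (z - x₀))
    (t := positivitySet (ball 0 1) (rescale U x₀ r)) hA h1 fun z hz => ?_
  · rwa [hAx] at h2
  · obtain ⟨hz1, hz2⟩ := hz
    rw [mem_positivitySet_iff] at hz2 ⊢
    constructor
    · rw [mem_ball, dist_eq_norm] at hz1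
      rw [mem_ball_zero_iff, norm_smul, Real.norm_of_nonneg (by positivity), inv_mul_lt_iff₀ hr,
        mul_one]
      exact hz1
    · rw [rescale_ne_zero_iff hr]
      simpa [smul_smul, hr.ne'] using hz2.2

theorem rescale_rescale (U : EuclideanSpace ℝ (Fin n) → EuclideanSpace ℝ (Fin m)) (r s : ℝ) :
    rescale (rescale U 0 r) 0 s = rescale U 0 (r * s) := by
  ext1 x
  simp [rescale, smul_smul, mul_comm]

theorem exists_seq_of_step {α : Type*} {p : ℕ → α → Prop} {R : ℕ → α → α → Prop} {a : α}
    (h0 : p 0 a) (hs : ∀ k a, p k a → ∃ b, p (k + 1) b ∧ R k a b) :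
    ∃ s : ℕ → α, s 0 = a ∧ ∀ k, p k (s k) ∧ R k (s k) (s (k + 1)) := by
  choose! nxt h1 h2 using hs
  set s : ℕ → α := fun k => Nat.rec a (fun k b => nxt k b) k with hs'
  have hp : ∀ k, p k (s k) := fun k => by
    induction k with
    | zero => exact h0
    | succ k ih => exact h1 k _ ih
  exact ⟨s, rfl, fun k => ⟨hp k, h2 k _ (hp k)⟩⟩

theorem exists_pow_le_lt {r z : ℝ} (hr1 : r < 1) (hz : 0 < z) (hz1 : z < 1) :
    ∃ k : ℕ, r ^ (k + 1) ≤ z ∧ z < r ^ k := by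
  have hex : ∃ k : ℕ, r ^ k ≤ z := (exists_pow_lt_of_lt_one hz hr1).imp fun _ h => h.le
  classical
  have h0 : Nat.find hex ≠ 0 := fun h => by
    have := Nat.find_spec hex
    rw [h, pow_zero] at this
    linarith
  obtain ⟨k, hk⟩ := Nat.exists_eq_succ_of_ne_zero h0
  refine ⟨k, ?_, ?_⟩
  · have := Nat.find_spec hex
    rwa [hk] at this
  · exact not_le.1 (Nat.find_min hex (by omega))

/-- At each flat free boundary point the free boundary is trapped between the graphs of two
`C^{1,α}` functions. -/
theorem exists_normal_of_flat (n m : ℕ) : ∃ α : ℝ≥0, 0 < α ∧ α < 1 ∧ ∃ ε₀ C : ℝ, 0 < ε₀ ∧ 0 ≤ C ∧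
    ∀ (U : EuclideanSpace ℝ (Fin n) → EuclideanSpace ℝ (Fin m)) (e : EuclideanSpace ℝ (Fin n))
      (f : EuclideanSpace ℝ (Fin m)) (ε : ℝ), IsViscositySolution (ball 0 1) U → ‖e‖ = 1 →
      ‖f‖ = 1 → 0 < ε → ε ≤ ε₀ → IsFlat U e f ε → 0 ∈ freeBoundary (ball 0 1) U →
      ∃ ν : EuclideanSpace ℝ (Fin n), ‖ν‖ = 1 ∧ ‖ν - e‖ ≤ C * ε ∧
        ∀ x ∈ freeBoundary (ball 0 1) U, |⟪ν, x⟫_ℝ| ≤ C * ε * (‖x‖ ^ (α : ℝ) * ‖x‖) := by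
  obtain ⟨r, ε₀, C, hr, hr16, hε₀, hC, H⟩ := exists_improvement_of_flatness n m
  have hr1 : r < 1 := by linarith
  have hα0 : 0 < Real.logb r (1 / 2) :=
    Real.logb_pos_of_base_lt_one hr hr1 (by norm_num) (by norm_num)
  have hα1 : Real.logb r (1 / 2) < 1 := by
    rw [Real.logb_lt_iff_lt_rpow_of_base_lt_one hr hr1 (by norm_num), Real.rpow_one]
    linarith
  -- The exponent with `r ^ α = 1 / 2`, so that halving at each scale is decay of order `α`; it is
  -- less than one because `r < 1 / 2`.
  set α : ℝ := Real.logb r (1 / 2) with hα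
  have hrα : r ^ α = 1 / 2 := Real.rpow_logb hr hr1.ne (by norm_num)
  refine ⟨⟨α, hα0.le⟩, hα0, hα1, ε₀, 2 * (r⁻¹ + 2 * C), hε₀, by positivity,
    fun U e f ε hU he hf hε hεε hflat h0 => ?_⟩
  have hsub : ∀ k : ℕ, ball (0 : EuclideanSpace ℝ (Fin n)) (r ^ k) ⊆ ball 0 1 := fun k =>
    ball_subset_ball (pow_le_one₀ hr.le hr1.le)
  have hFk : ∀ (k : ℕ), ∀ x ∈ freeBoundary (ball 0 1) U, ‖x‖ < r ^ k →
      (r ^ k)⁻¹ • x ∈ freeBoundary (ball 0 1) (rescale U 0 (r ^ k)) := fun k x hx hxk => by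
    have hrk : 0 < r ^ k := by positivity
    refine mem_freeBoundary_rescale hU.continuousOn hrk (hsub k) ?_ ?_
    · rw [mem_ball_zero_iff, norm_smul, Real.norm_of_nonneg (by positivity), inv_mul_lt_iff₀ hrk,
        mul_one]
      exact hxk
    · rwa [zero_add, smul_smul, mul_inv_cancel₀ hrk.ne', one_smul]
  obtain ⟨s, hs0, hs⟩ := exists_seq_of_step
    (p := fun k (q : EuclideanSpace ℝ (Fin n) × EuclideanSpace ℝ (Fin m)) =>
      ‖q.1‖ = 1 ∧ ‖q.2‖ = 1 ∧ IsFlat (rescale U 0 (r ^ k)) q.1 q.2 (ε / 2 ^ k))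
    (R := fun k q q' => ‖q'.1 - q.1‖ ≤ C * (ε / 2 ^ k)) (a := (e, f))
    ⟨he, hf, by
      have : rescale U 0 1 = U := by ext1 x; simp [rescale]
      rw [pow_zero, pow_zero, div_one, this]
      exact hflat⟩
    (fun k q ⟨hq1, hq2, hq3⟩ => by
      have hrk : 0 < r ^ k := by positivity
      obtain ⟨e', f', he', hf', hee, hfl⟩ := H (rescale U 0 (r ^ k)) q.1 q.2 (ε / 2 ^ k)
        (hU.rescale hrk (hsub k)) hq1 hq2 (by positivity)
        ((div_le_self hε.le (one_le_pow₀ (by norm_num))).trans hεε) hq3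
        (by simpa using hFk k 0 h0 (by rw [norm_zero]; exact hrk))
      refine ⟨(e', f'), ⟨he', hf', ?_⟩, hee⟩
      rw [rescale_rescale, ← pow_succ] at hfl
      rwa [pow_succ 2, ← div_div])
  have hu : ∀ k, dist (s k).1 (s (k + 1)).1 ≤ 2 * (C * ε) / 2 / 2 ^ k := fun k => by
    rw [dist_eq_norm, norm_sub_rev]
    refine (hs k).2.trans_eq ?_
    field_simp
  obtain ⟨ν, hν⟩ := cauchySeq_tendsto_of_complete (cauchySeq_of_le_geometric_two hu)
  have hdist : ∀ k, ‖ν - (s k).1‖ ≤ 2 * (C * ε) / 2 ^ k := fun k => by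
    rw [norm_sub_rev, ← dist_eq_norm]
    exact dist_le_of_le_geometric_two_of_tendsto hu hν k
  have hCε : 0 ≤ r⁻¹ * ε := by positivity
  refine ⟨ν, ?_, ?_, fun x hx => ?_⟩
  · refine tendsto_nhds_unique hν.norm ?_
    simp only [(hs _).1.1]
    exact tendsto_const_nhds
  · have h1 := hdist 0
    rw [hs0, pow_zero, div_one] at h1
    have : 0 ≤ C * ε := by positivity
    linarith
  · by_cases hx0 : x = 0
    · simp [hx0]
    have hxp : 0 < ‖x‖ := norm_pos_iff.2 hx0
    -- At the scale of `x`, flatness bounds the component along the `k`-th normal by `r ^ k * (ε / 2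
    -- ^ k)`, and passing to the limit normal costs `2 * (C * ε) / 2 ^ k * ‖x‖`. Both are of order
    -- `‖x‖ ^ (1 + α)`.
    obtain ⟨k, hk1, hk2⟩ := exists_pow_le_lt hr1 hxp (mem_ball_zero_iff.1 hx.1)
    have hrk : 0 < r ^ k := by positivity
    obtain ⟨h1, h2, h3⟩ := (hs k).1
    have h4 := h3.abs_inner_le (hU.rescale hrk (hsub k)) (hFk k x hx hk2)
    rw [inner_smul_right, abs_mul, abs_of_pos (inv_pos.2 hrk), inv_mul_le_iff₀ hrk] at h4
    have h5 : |⟪ν - (s k).1, x⟫_ℝ| ≤ 2 * (C * ε) / 2 ^ k * ‖x‖ :=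
      (abs_real_inner_le_norm _ _).trans (by gcongr; exact hdist k)
    have h6 : ⟪ν, x⟫_ℝ = ⟪(s k).1, x⟫_ℝ + ⟪ν - (s k).1, x⟫_ℝ := by rw [inner_sub_left]; ring
    have h7 : r ^ k ≤ r⁻¹ * ‖x‖ := by
      rw [le_inv_mul_iff₀ hr, ← pow_succ']
      exact hk1
    have h8 : 1 / 2 ^ k ≤ 2 * ‖x‖ ^ α := by
      have h9 : (r ^ (k + 1)) ^ α ≤ ‖x‖ ^ α := Real.rpow_le_rpow (by positivity) hk1 hα0.le
      rw [← Real.rpow_natCast_mul hr.le, mul_comm, Real.rpow_mul_natCast hr.le, hrα, pow_succ,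
        one_div_pow] at h9
      linarith
    have h10 : r ^ k * (ε / 2 ^ k) ≤ r⁻¹ * ‖x‖ * (ε / 2 ^ k) := by gcongr
    change _ ≤ _ * (‖x‖ ^ α * ‖x‖)
    rw [h6]
    refine (abs_add_le _ _).trans ?_
    calc |⟪(s k).1, x⟫_ℝ| + |⟪ν - (s k).1, x⟫_ℝ|
        ≤ r⁻¹ * ‖x‖ * (ε / 2 ^ k) + 2 * (C * ε) / 2 ^ k * ‖x‖ := by linarith
      _ = (r⁻¹ + 2 * C) * ε * ‖x‖ * (1 / 2 ^ k) := by ring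
      _ ≤ (r⁻¹ + 2 * C) * ε * ‖x‖ * (2 * ‖x‖ ^ α) := by gcongr
      _ = 2 * (r⁻¹ + 2 * C) * ε * (‖x‖ ^ α * ‖x‖) := by ring

end Iteration

/-! ### From tangent planes with uniform error to a `C^{1,α}` graph. -/

section Regularity

theorem two_mul_rpow_mul_le {d α : ℝ} (hd : 0 ≤ d) (hα1 : α ≤ 1) :
    (2 * d) ^ α * (2 * d) ≤ 4 * (d ^ α * d) := by
  have h1 : (2 : ℝ) ^ α ≤ 2 := by
    simpa using Real.rpow_le_rpow_of_exponent_le (show (1 : ℝ) ≤ 2 by norm_num) hα1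
  have h2 : 0 ≤ d ^ α * d := by positivity
  rw [Real.mul_rpow (by norm_num) hd]
  nlinarith

/-- A function with first order expansions whose errors are of order `1 + α` is of class `C^{1,α}`. -/
theorem isC1AlphaOn_of_expansion {G : Type*} [NormedAddCommGroup G] [NormedSpace ℝ G] {g : G → ℝ}
    {α : ℝ≥0} (hα0 : 0 < α) (hα1 : α ≤ 1) {L : G → G →L[ℝ] ℝ} {A B : ℝ} (hA : 0 ≤ A)
    (hB : ∀ y₀ ∈ ball (0 : G) (5 / 8), ‖L y₀‖ ≤ B)
    (hL : ∀ y₀ ∈ ball (0 : G) (5 / 8), ∀ y ∈ ball (0 : G) (5 / 8), ‖y - y₀‖ < 1 / 8 →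
      |g y - g y₀ - L y₀ (y - y₀)| ≤ A * (‖y - y₀‖ ^ (α : ℝ) * ‖y - y₀‖)) :
    IsC1AlphaOn α g (ball 0 (1 / 2)) := by
  have hα0' : (0 : ℝ) < α := hα0
  have hα1' : (α : ℝ) ≤ 1 := hα1
  have hB0 : 0 ≤ B := (norm_nonneg _).trans (hB 0 (mem_ball_self (by norm_num)))
  have hd : ∀ y₀ ∈ ball (0 : G) (5 / 8), HasFDerivAt g (L y₀) y₀ := fun y₀ hy₀ => by
    refine HasFDerivAt.of_isLittleO (Asymptotics.isLittleO_iff.2 fun c hc => ?_)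
    have h1 : Tendsto (fun y => A * ‖y - y₀‖ ^ (α : ℝ)) (𝓝 y₀) (𝓝 0) := by
      have h2 : Continuous fun y : G => A * ‖y - y₀‖ ^ (α : ℝ) :=
        continuous_const.mul ((continuous_id.sub continuous_const).norm.rpow_const
          fun _ => Or.inr hα0'.le)
      have h3 := h2.tendsto y₀
      rwa [sub_self, norm_zero, Real.zero_rpow hα0'.ne', mul_zero] at h3
    filter_upwards [h1.eventually (gt_mem_nhds hc), isOpen_ball.mem_nhds hy₀,
      ball_mem_nhds y₀ (show (0 : ℝ) < 1 / 8 by norm_num)] with y hy1 hy2 hy3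
    rw [mem_ball, dist_eq_norm] at hy3
    refine (hL y₀ hy₀ y hy2 hy3).trans ?_
    rw [← mul_assoc]
    gcongr
  have hsub : ball (0 : G) (1 / 2) ⊆ ball 0 (5 / 8) := ball_subset_ball (by norm_num)
  refine ⟨fun y hy => (hd y (hsub hy)).differentiableAt.differentiableWithinAt,
    (6 * A + 32 * B).toNNReal, fun y₁ hy₁ y₂ hy₂ => ?_⟩
  rw [(hd y₁ (hsub hy₁)).fderiv, (hd y₂ (hsub hy₂)).fderiv]
  have key : dist (L y₁) (L y₂) ≤ (6 * A + 32 * B) * dist y₁ y₂ ^ (α : ℝ) := by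
    rw [dist_eq_norm, dist_eq_norm]
    set d := ‖y₁ - y₂‖ with hd'
    have hd0 : 0 ≤ d := norm_nonneg _
    have hdα : 0 ≤ d ^ (α : ℝ) := by positivity
    rcases le_or_gt (1 / 16) d with h1 | h1
    · have h2 : (1 : ℝ) / 16 ≤ d ^ (α : ℝ) := by
        have h3 : ((1 : ℝ) / 16) ^ (1 : ℝ) ≤ (1 / 16) ^ (α : ℝ) :=
          Real.rpow_le_rpow_of_exponent_ge (by norm_num) (by norm_num) hα1'
        rw [Real.rpow_one] at h3
        exact h3.trans (Real.rpow_le_rpow (by norm_num) h1 hα0'.le)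
      have h4 := norm_sub_le (L y₁) (L y₂)
      have h5 := hB y₁ (hsub hy₁)
      have h6 := hB y₂ (hsub hy₂)
      have h7 : 0 ≤ A * d ^ (α : ℝ) := by positivity
      nlinarith
    rcases hd0.eq_or_lt with h2 | h2
    · rw [hd', eq_comm, norm_eq_zero, sub_eq_zero] at h2
      rw [h2, sub_self, norm_zero]
      positivity
    refine ContinuousLinearMap.opNorm_le_of_unit_norm (by positivity) fun w hw => ?_
    -- The expansions at `y₁` and `y₂` are compared at `y₂ + v`, at distance at most `2 d` from
    -- both. The difference `L y₁ - L y₂` applied to `v` is a combination of three remainders, which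
    -- contribute `4 + 1 + 1` to the constant.
    set v := d • w with hv
    have hvn : ‖v‖ = d := by rw [hv, norm_smul, hw, mul_one, Real.norm_of_nonneg hd0]
    rw [mem_ball_zero_iff] at hy₁ hy₂
    have hy₃ : y₂ + v ∈ ball (0 : G) (5 / 8) := by
      rw [mem_ball_zero_iff]
      have := norm_add_le y₂ v
      linarith
    have h31 : ‖y₂ + v - y₁‖ ≤ 2 * d := by
      have h3 : y₂ + v - y₁ = v - (y₁ - y₂) := by abel
      rw [h3]
      refine (norm_sub_le _ _).trans ?_
      rw [hvn]
      linarith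
    have e1 := hL y₁ (by rw [mem_ball_zero_iff]; linarith) _ hy₃ (by linarith)
    have e2 := hL y₁ (by rw [mem_ball_zero_iff]; linarith) y₂ (by rw [mem_ball_zero_iff]; linarith)
      (by rw [norm_sub_rev]; linarith)
    have e3 := hL y₂ (by rw [mem_ball_zero_iff]; linarith) _ hy₃
      (by rw [add_sub_cancel_left, hvn]; linarith)
    rw [norm_sub_rev y₂ y₁] at e2
    rw [add_sub_cancel_left, hvn] at e3
    have e4 : ‖y₂ + v - y₁‖ ^ (α : ℝ) * ‖y₂ + v - y₁‖ ≤ 4 * (d ^ (α : ℝ) * d) := by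
      refine le_trans ?_ (two_mul_rpow_mul_le hd0 hα1')
      gcongr
    have e5 := e1.trans (mul_le_mul_of_nonneg_left e4 hA)
    have e6 : d * ((L y₁ - L y₂) w) =
        L y₁ (y₂ + v - y₁) - L y₁ (y₂ - y₁) - L y₂ v := by
      have h3 : y₂ + v - y₁ = v + (y₂ - y₁) := by abel
      rw [h3, map_add, hv, map_smul, map_smul, sub_apply, smul_eq_mul, smul_eq_mul]
      ring
    have e7 : d * |(L y₁ - L y₂) w| ≤ d * (6 * A * d ^ (α : ℝ)) := by
      rw [← abs_of_pos h2, ← abs_mul, abs_of_pos h2, e6]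
      rw [abs_le] at e2 e3 e5 ⊢
      constructor <;> linarith
    have e8 := le_of_mul_le_mul_left e7 h2
    have e9 : 0 ≤ 32 * B * d ^ (α : ℝ) := by positivity
    rw [Real.norm_eq_abs]
    linarith
  rw [edist_dist, edist_dist, ENNReal.ofReal_rpow_of_nonneg dist_nonneg hα0'.le]
  change _ ≤ ENNReal.ofReal _ * _
  rw [← ENNReal.ofReal_mul (by positivity)]
  exact ENNReal.ofReal_le_ofReal key

variable {n : ℕ} {e : EuclideanSpace ℝ (Fin n)} {F : Set (EuclideanSpace ℝ (Fin n))} {α : ℝ≥0}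
  {η : ℝ}

theorem norm_add_smul_le (he : ‖e‖ = 1) (y : EuclideanSpace ℝ (Fin n)) (τ : ℝ) :
    ‖y + τ • e‖ ≤ ‖y‖ + |τ| := by
  have := norm_add_le y (τ • e)
  rwa [norm_smul, he, mul_one, Real.norm_eq_abs] at this

/-- A closed slab-like set with `C^{1,α}` tangent planes at all its points is a `C^{1,α}` graph. -/
theorem isC1AlphaGraphInBall_of_normal (he : ‖e‖ = 1) (hα0 : 0 < α) (hα1 : α ≤ 1) (hη : 0 ≤ η)
    (hη1 : η ≤ 1 / 16)
    (hF : ∀ x₀ ∈ F, ‖x₀‖ < 3 / 4 → ∃ ν : EuclideanSpace ℝ (Fin n), ‖ν‖ = 1 ∧ ‖ν - e‖ ≤ η ∧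
      ∀ x ∈ F, ‖x - x₀‖ < 1 / 4 → |⟪ν, x - x₀⟫_ℝ| ≤ η * (‖x - x₀‖ ^ (α : ℝ) * ‖x - x₀‖))
    (hFe : ∀ x ∈ F, |⟪e, x⟫_ℝ| ≤ η)
    (hex : ∀ y : EuclideanSpace ℝ (Fin n), ⟪e, y⟫_ℝ = 0 → ‖y‖ < 5 / 8 → ∃ τ : ℝ, y + τ • e ∈ F) :
    IsC1AlphaGraphInBall α e F (1 / 2) := by
  have hα0' : (0 : ℝ) < α := hα0
  have hα1' : (α : ℝ) ≤ 1 := hα1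
  set H := (ℝ ∙ e)ᗮ with hH
  have hHe : ∀ y : H, ⟪e, (y : EuclideanSpace ℝ (Fin n))⟫_ℝ = 0 := fun y =>
    Submodule.mem_orthogonal_singleton_iff_inner_right.1 y.2
  have hcoord : ∀ (y : H) (τ : ℝ), ⟪e, (y : EuclideanSpace ℝ (Fin n)) + τ • e⟫_ℝ = τ :=
    fun y τ => by rw [inner_add_smul_self he, hHe, zero_add]
  choose! g hg using fun (y : H) (hy : ‖y‖ < 5 / 8) => hex y (hHe y) hy
  have hgη : ∀ y : H, ‖y‖ < 5 / 8 → |g y| ≤ η := fun y hy => by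
    have := hFe _ (hg y hy)
    rwa [hcoord] at this
  have hgn : ∀ y : H, ‖y‖ < 5 / 8 → ‖(y : EuclideanSpace ℝ (Fin n)) + g y • e‖ < 3 / 4 :=
    fun y hy => by
      have h1 := norm_add_smul_le he (y : EuclideanSpace ℝ (Fin n)) (g y)
      have h2 := hgη y hy
      have h3 : ‖(y : EuclideanSpace ℝ (Fin n))‖ = ‖y‖ := rfl
      linarith
  have hνe : ∀ ν : EuclideanSpace ℝ (Fin n), ‖ν - e‖ ≤ η → 1 / 2 ≤ ⟪ν, e⟫_ℝ := fun ν hν => by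
    have h1 := neg_le_of_abs_le (abs_inner_le_of_unit he (ν - e))
    rw [inner_sub_right, inner_eq_of_unit he, real_inner_comm] at h1
    linarith
  have hνy : ∀ (ν : EuclideanSpace ℝ (Fin n)) (y : H), ‖ν - e‖ ≤ η →
      |⟪ν, (y : EuclideanSpace ℝ (Fin n))⟫_ℝ| ≤ η * ‖y‖ := fun ν y hν => by
    have h1 := abs_real_inner_le_norm (ν - e) (y : EuclideanSpace ℝ (Fin n))
    rw [inner_sub_left, hHe, sub_zero] at h1
    exact h1.trans (by gcongr; rfl)
  -- Since `ν` is close to `e`, a chord almost orthogonal to `ν` is not steep. With `v = 0` this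
  -- shows that the chosen height `g y` is the only one over `y`.
  have hlip : ∀ x₀ ∈ F, ∀ x ∈ F, ‖x₀‖ < 3 / 4 → ‖x - x₀‖ < 1 / 4 → ∀ (v : H) (τ : ℝ),
      x - x₀ = v + τ • e → |τ| ≤ ‖v‖ := fun x₀ hx₀ x hx hx₀n hxx v τ hv => by
    obtain ⟨ν, hν1, hν, h⟩ := hF x₀ hx₀ hx₀n
    have h1 := h x hx hxx
    have h2 : ‖x - x₀‖ ^ (α : ℝ) ≤ 1 :=
      Real.rpow_le_one (norm_nonneg _) (by linarith) hα0'.le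
    have h3 : ‖x - x₀‖ ≤ ‖v‖ + |τ| := by
      rw [hv]; exact norm_add_smul_le he _ τ
    have h4 : |⟪ν, x - x₀⟫_ℝ| ≤ η * (1 * (‖v‖ + |τ|)) := h1.trans (by gcongr)
    rw [hv, inner_add_right, inner_smul_right] at h4
    have h5 := hνy ν v hν
    have h6 := hνe ν hν
    have h7 : |τ * ⟪ν, e⟫_ℝ| ≤ η * (1 * (‖v‖ + |τ|)) + η * ‖v‖ := by
      rw [abs_le] at h4 h5 ⊢
      constructor <;> linarith
    rw [abs_mul, abs_of_nonneg (show 0 ≤ ⟪ν, e⟫_ℝ by linarith)] at h7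
    have h8 : |τ| * (1 / 2) ≤ |τ| * ⟪ν, e⟫_ℝ := by gcongr
    have h9 : η * (‖v‖ + |τ|) ≤ 1 / 16 * (‖v‖ + |τ|) := by gcongr
    have h10 : η * ‖v‖ ≤ 1 / 16 * ‖v‖ := by gcongr
    have h11 := norm_nonneg v
    linarith
  have hexp : ∀ y₀ : H, ‖y₀‖ < 5 / 8 → ∃ L : H →L[ℝ] ℝ, ‖L‖ ≤ 2 ∧ ∀ y ∈ ball (0 : H) (5 / 8),
      ‖y - y₀‖ < 1 / 8 →
      |g y - g y₀ - L (y - y₀)| ≤ 8 * η * (‖y - y₀‖ ^ (α : ℝ) * ‖y - y₀‖) := fun y₀ hy₀ => by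
    set x₀ := (y₀ : EuclideanSpace ℝ (Fin n)) + g y₀ • e with hx₀
    obtain ⟨ν, hν1, hν, h⟩ := hF x₀ (hg y₀ hy₀) (hgn y₀ hy₀)
    have hN := hνe ν hν
    set N := ⟪ν, e⟫_ℝ with hN'
    have hN0 : 0 < N := by linarith
    have hNi : N⁻¹ ≤ 2 := by
      rw [inv_le_comm₀ hN0 (by norm_num)]; linarith
    have hLx : ∀ y : H, ((-N⁻¹) • (innerSL ℝ ν).comp H.subtypeL) y =
        -(N⁻¹ * ⟪ν, (y : EuclideanSpace ℝ (Fin n))⟫_ℝ) := fun y => by simp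
    -- The slope of the plane orthogonal to `ν`, written as a graph over `H`.
    refine ⟨(-N⁻¹) • (innerSL ℝ ν).comp H.subtypeL, ?_, fun y hy hyy => ?_⟩
    · refine ContinuousLinearMap.opNorm_le_bound _ (by norm_num) fun y => ?_
      rw [hLx, norm_neg, norm_mul, norm_inv, Real.norm_of_nonneg hN0.le, Real.norm_eq_abs]
      have h1 := abs_inner_le_of_unit hν1 (y : EuclideanSpace ℝ (Fin n))
      gcongr
      exact h1
    · rw [mem_ball_zero_iff] at hy
      set x := (y : EuclideanSpace ℝ (Fin n)) + g y • e with hx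
      have hxx : x - x₀ = ((y - y₀ : H) : EuclideanSpace ℝ (Fin n)) + (g y - g y₀) • e := by
        rw [hx, hx₀, Submodule.coe_sub, sub_smul]; abel
      have h1 : ‖x - x₀‖ ≤ ‖y - y₀‖ + |g y - g y₀| := by
        rw [hxx]; exact norm_add_smul_le he _ _
      have h2 : |g y - g y₀| ≤ 2 * η := by
        have h3 := abs_le.1 (hgη y hy)
        have h4 := abs_le.1 (hgη y₀ hy₀)
        exact abs_le.2 ⟨by linarith, by linarith⟩
      by_cases hxn : ‖x - x₀‖ < 1 / 4
      · have h3 := hlip x₀ (hg y₀ hy₀) x (hg y hy) (hgn y₀ hy₀) hxn (y - y₀) _ hxx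
        have h4 := h x (hg y hy) hxn
        set d := ‖y - y₀‖ with hd
        have hd0 : 0 ≤ d := norm_nonneg _
        have h5 : ‖x - x₀‖ ≤ 2 * d := by linarith
        have h6 : ‖x - x₀‖ ^ (α : ℝ) * ‖x - x₀‖ ≤ 4 * (d ^ (α : ℝ) * d) := by
          refine le_trans ?_ (two_mul_rpow_mul_le hd0 hα1')
          gcongr
        have h7 := h4.trans (mul_le_mul_of_nonneg_left h6 hη)
        have h8 : g y - g y₀ - ((-N⁻¹) • (innerSL ℝ ν).comp H.subtypeL) (y - y₀) =
            N⁻¹ * ⟪ν, x - x₀⟫_ℝ := by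
          rw [hLx, hxx, inner_add_right, inner_smul_right, ← hN']
          field_simp
          ring
        rw [h8, abs_mul, abs_of_pos (inv_pos.2 hN0)]
        calc N⁻¹ * |⟪ν, x - x₀⟫_ℝ| ≤ 2 * (η * (4 * (d ^ (α : ℝ) * d))) := by gcongr
          _ = 8 * η * (d ^ (α : ℝ) * d) := by ring
      · exact absurd (by linarith) hxn
  choose! L hLB hL using hexp
  refine ⟨g, isC1AlphaOn_of_expansion hα0 hα1 (L := L) (A := 8 * η) (B := 2) (by positivity)
    (fun y hy => hLB y (mem_ball_zero_iff.1 hy)) (fun y hy => hL y (mem_ball_zero_iff.1 hy)), ?_⟩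
  ext x
  constructor
  · rintro ⟨hxF, hxb⟩
    refine ⟨?_, hxb⟩
    rw [mem_ball_zero_iff] at hxb
    have hyH : x - ⟪e, x⟫_ℝ • e ∈ H := by
      rw [hH, Submodule.mem_orthogonal_singleton_iff_inner_right, inner_sub_smul_self he, sub_self]
    set y : H := ⟨x - ⟪e, x⟫_ℝ • e, hyH⟩ with hy
    have hyn : ‖y‖ < 5 / 8 := by
      have : ‖y‖ ≤ ‖x‖ := norm_sub_inner_smul_le he x
      linarith
    refine ⟨y, ?_⟩
    have h1 : (y : EuclideanSpace ℝ (Fin n)) + g y • e - x =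
        ((0 : H) : EuclideanSpace ℝ (Fin n)) + (g y - ⟪e, x⟫_ℝ) • e := by
      change x - ⟪e, x⟫_ℝ • e + g y • e - x = _
      rw [Submodule.coe_zero, zero_add, sub_smul]; abel
    have h2 : |g y - ⟪e, x⟫_ℝ| ≤ 2 * η := by
      have h3 := abs_le.1 (hgη y hyn)
      have h4 := abs_le.1 (hFe x hxF)
      exact abs_le.2 ⟨by linarith, by linarith⟩
    have h3 : ‖(y : EuclideanSpace ℝ (Fin n)) + g y • e - x‖ < 1 / 4 := by
      rw [h1]
      refine (norm_add_smul_le he _ _).trans_lt ?_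
      simp only [Submodule.coe_zero, norm_zero]
      linarith
    have h4 := hlip x hxF _ (hg y hyn) (by linarith) h3 0 _ h1
    rw [norm_zero, abs_nonpos_iff] at h4
    rw [h4, zero_smul, add_zero, Submodule.coe_zero, sub_eq_zero] at h1
    exact h1
  · rintro ⟨⟨y, rfl⟩, hxb⟩
    refine ⟨hg y ?_, hxb⟩
    rw [mem_ball_zero_iff] at hxb
    have h1 := norm_sub_inner_smul_le he ((y : EuclideanSpace ℝ (Fin n)) + g y • e)
    rw [hcoord, add_sub_cancel_right] at h1
    have h3 : ‖(y : EuclideanSpace ℝ (Fin n))‖ = ‖y‖ := rfl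
    dsimp only at hxb
    linarith

end Regularity

/-! ### From the hypotheses of the theorem to flatness at every free boundary point. -/

section FlatSolutions

variable {n m : ℕ} {U : EuclideanSpace ℝ (Fin n) → EuclideanSpace ℝ (Fin m)}
  {e : EuclideanSpace ℝ (Fin n)} {f : EuclideanSpace ℝ (Fin m)} {ε : ℝ}

/-- The doubling comes from the strip `-ε ≤ ⟨e, x⟩ ≤ 0`, where `‖U x‖ ≤ ε` must be bounded by `⟨e,
x⟩ + 2 * ε`. Below the strip the upper bound has to be zero, which only `h0` provides. -/
theorem isFlat_of_close (hf : ‖f‖ = 1) (hε : 0 ≤ ε)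
    (h : ∀ x ∈ ball (0 : EuclideanSpace ℝ (Fin n)) 1, ‖U x - max ⟪x, e⟫_ℝ 0 • f‖ ≤ ε)
    (h0 : ∀ x ∈ ball (0 : EuclideanSpace ℝ (Fin n)) 1, ⟪x, e⟫_ℝ < -ε → ‖U x‖ = 0) :
    IsFlat U e f (2 * ε) := by
  have hcomm : ∀ x, ⟪x, e⟫_ℝ = ⟪e, x⟫_ℝ := fun x => real_inner_comm e x
  simp only [hcomm] at h h0
  refine ⟨fun x hx => ⟨?_, ?_⟩, fun x hx => ?_⟩
  · have h1 := neg_le_of_abs_le (abs_inner_le_of_unit hf (U x - max ⟪e, x⟫_ℝ 0 • f))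
    rw [inner_sub_smul_self hf, real_inner_comm (U x) f] at h1
    linarith [h x hx, le_max_left ⟪e, x⟫_ℝ 0]
  · rcases lt_or_ge ⟪e, x⟫_ℝ (-ε) with h1 | h1
    · rw [h0 x hx h1]
      exact le_max_right _ _
    · have h2 := norm_add_le (U x - max ⟪e, x⟫_ℝ 0 • f) (max ⟪e, x⟫_ℝ 0 • f)
      rw [sub_add_cancel, norm_smul, hf, mul_one, Real.norm_of_nonneg (le_max_right _ _)] at h2
      refine le_max_of_le_left (h2.trans ?_)
      have h3 := h x hx
      rcases max_cases ⟪e, x⟫_ℝ 0 with ⟨h4, -⟩ | ⟨h4, -⟩ <;> rw [h4] at h3 ⊢ <;> linarith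
  · refine (norm_sub_inner_smul_le_norm_sub hf (U x) (max ⟪e, x⟫_ℝ 0)).trans ?_
    linarith [h x hx]

/-- A free boundary point has height at most `ε`, so recentring there shifts the band by at most
`ε`. -/
theorem IsFlat.rescale_of_mem_freeBoundary (hflat : IsFlat U e f ε)
    (hU : IsViscositySolution (ball 0 1) U) {x₀ : EuclideanSpace ℝ (Fin n)} {r : ℝ} (hr : 0 < r)
    (hb : ball x₀ r ⊆ ball 0 1) (hx₀ : x₀ ∈ freeBoundary (ball 0 1) U) :
    IsFlat (rescale U x₀ r) e f (r⁻¹ * (2 * ε)) := by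
  have h1 := abs_le.1 (hflat.abs_inner_le hU hx₀)
  have hε : 0 ≤ ε := (abs_nonneg _).trans (hflat.abs_inner_le hU hx₀)
  constructor
  · refine ((hflat.1.mono hb le_rfl le_rfl).rescale hr).mono subset_rfl ?_ ?_
    · rw [← mul_neg]
      gcongr
      linarith
    · gcongr
      linarith
  · intro x hx
    rw [norm_sub_rescale hr]
    gcongr
    linarith [hflat.2 _ (hb (add_smul_mem_ball hr hx))]

/-- The segment over `y` in direction `e` joins the zero set to the positivity set. If it missed the
free boundary, connectedness would keep all of it in the positivity set. -/
theorem IsFlat.exists_mem_freeBoundary (hflat : IsFlat U e f ε)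
    (hU : IsViscositySolution (ball 0 1) U) (he : ‖e‖ = 1) (hε : 0 < ε)
    {y : EuclideanSpace ℝ (Fin n)} (hy : ⟪e, y⟫_ℝ = 0) (hyn : ‖y‖ + 2 * ε < 1) :
    ∃ τ : ℝ, y + τ • e ∈ freeBoundary (ball 0 1) U := by
  have hcoord : ∀ τ : ℝ, ⟪e, y + τ • e⟫_ℝ = τ := fun τ => by
    rw [inner_add_smul_self he, hy, zero_add]
  have hb : ∀ τ ∈ Icc (-(2 * ε)) (2 * ε), y + τ • e ∈ ball (0 : EuclideanSpace ℝ (Fin n)) 1 :=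
    fun τ hτ => by
      rw [mem_ball_zero_iff]
      have := abs_le.2 hτ
      linarith [norm_add_smul_le he y τ]
  set Ω := positivitySet (ball 0 1) U with hΩ
  have hΩo : IsOpen Ω := isOpen_positivitySet hU.continuousOn
  have hc : Continuous fun τ : ℝ => y + τ • e := by fun_prop
  have hseg : IsPreconnected ((fun τ : ℝ => y + τ • e) '' Icc (-(2 * ε)) (2 * ε)) :=
    isPreconnected_Icc.image _ hc.continuousOn
  by_contra! hno
  have hr : 2 * ε ∈ Icc (-(2 * ε)) (2 * ε) := ⟨by linarith, le_rfl⟩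
  have hl : -(2 * ε) ∈ Icc (-(2 * ε)) (2 * ε) := ⟨le_rfl, by linarith⟩
  have hsub := hseg.subset_of_closure_inter_subset hΩo
    ⟨_, mem_image_of_mem _ hr, mem_positivitySet_iff.2
      ⟨hb _ hr, hflat.ne_zero (hb _ hr) (by rw [hcoord]; linarith)⟩⟩
    (by
      rintro _ ⟨hxc, τ, hτ, rfl⟩
      by_contra hxΩ
      refine hno τ ((mem_freeBoundary_iff hU.continuousOn).2 ⟨hb τ hτ, ?_, hxc⟩)
      by_contra h0
      exact hxΩ (mem_positivitySet_iff.2 ⟨hb τ hτ, h0⟩))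
  exact (mem_positivitySet_iff.1 (hsub (mem_image_of_mem _ hl))).2
    (hflat.eq_zero (hb _ hl) (by rw [hcoord]; linarith))

end FlatSolutions

theorem theorem1p2 (n m : ℕ) :
    ∃ ε : ℝ, 0 < ε ∧ ∃ α : ℝ≥0, 0 < α ∧ α < 1 ∧
      ∀ (U : EuclideanSpace ℝ (Fin n) → EuclideanSpace ℝ (Fin m))
        (e : EuclideanSpace ℝ (Fin n)) (f : EuclideanSpace ℝ (Fin m)),
        IsViscositySolution (ball 0 1) U →
        ‖e‖ = 1 → ‖f‖ = 1 →
        (∀ x ∈ ball (0 : EuclideanSpace ℝ (Fin n)) 1, ‖U x - max ⟪x, e⟫_ℝ 0 • f‖ ≤ ε) →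
        (∀ x ∈ ball (0 : EuclideanSpace ℝ (Fin n)) 1, ⟪x, e⟫_ℝ < -ε → ‖U x‖ = 0) →
        IsC1AlphaGraphInBall α e (freeBoundary (ball 0 1) U) (1 / 2) := by
  obtain ⟨α, hα0, hα1, ε₀, C, hε₀, hC, H⟩ := exists_normal_of_flat n m
  -- Closeness `ε` gives flatness `2 ε` in the unit ball and `16 ε` in balls of radius `1/4` about
  -- free boundary points; the second bound brings the tangent plane constants below `1/16`.
  refine ⟨min (ε₀ / 16) (1 / (1024 * (C + 1))), by positivity, α, hα0, hα1,
    fun U e f hU he hf hclose hzero => ?_⟩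
  set ε := min (ε₀ / 16) (1 / (1024 * (C + 1))) with hε
  have hε0 : 0 < ε := by positivity
  have hε1 : 16 * ε ≤ ε₀ := by
    have : ε ≤ ε₀ / 16 := min_le_left _ _
    linarith
  have hεC : C * (16 * ε) * 4 + 64 * ε ≤ 1 / 16 := by
    have : ε ≤ 1 / (1024 * (C + 1)) := min_le_right _ _
    rw [le_div_iff₀ (by positivity)] at this
    linarith
  have hCε : 0 ≤ C * (16 * ε) := by positivity
  have hflat := isFlat_of_close hf hε0.le hclose hzero
  have hα0' : (0 : ℝ) < α := hα0
  have hα1' : (α : ℝ) ≤ 1 := hα1.le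
  refine isC1AlphaGraphInBall_of_normal he hα0 hα1.le (η := 1 / 16) (by norm_num) le_rfl
    (fun x₀ hx₀ hx₀n => ?_) (fun x hx => ?_) (fun y hy hyn => ?_)
  · have h4 : (0 : ℝ) < 1 / 4 := by norm_num
    have hb : ball x₀ (1 / 4) ⊆ ball 0 1 := ball_subset_ball' (by rw [dist_zero_right]; linarith)
    have hfl := hflat.rescale_of_mem_freeBoundary hU h4 hb hx₀
    rw [show ((1 : ℝ) / 4)⁻¹ * (2 * (2 * ε)) = 16 * ε by ring] at hfl
    obtain ⟨ν, hν1, hν, hνF⟩ := H _ e f _ (hU.rescale h4 hb) he hf (by positivity) hε1 hfl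
      (mem_freeBoundary_rescale hU.continuousOn h4 hb (mem_ball_self one_pos) (by simpa using hx₀))
    refine ⟨ν, hν1, by linarith, fun x hx hxx => ?_⟩
    have hz : (4 : ℝ) • (x - x₀) ∈ ball (0 : EuclideanSpace ℝ (Fin n)) 1 := by
      rw [mem_ball_zero_iff, norm_smul, Real.norm_of_nonneg (by norm_num)]
      linarith
    have h1 := hνF _ (mem_freeBoundary_rescale hU.continuousOn h4 hb hz (by
      rw [smul_smul]; simpa using hx))
    rw [inner_smul_right, abs_mul, abs_of_pos (by norm_num), norm_smul,
      Real.norm_of_nonneg (by norm_num), Real.mul_rpow (by norm_num) (norm_nonneg _)] at h1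
    have h2 : (4 : ℝ) ^ (α : ℝ) ≤ 4 := by
      simpa using Real.rpow_le_rpow_of_exponent_le (show (1 : ℝ) ≤ 4 by norm_num) hα1'
    set d := ‖x - x₀‖ with hd
    have hdα : 0 ≤ d ^ (α : ℝ) * d := by positivity
    have h3 : C * (16 * ε) * (4 ^ (α : ℝ) * d ^ (α : ℝ) * (4 * d)) ≤
        4 * ((C * (16 * ε) * 4) * (d ^ (α : ℝ) * d)) := by
      calc C * (16 * ε) * (4 ^ (α : ℝ) * d ^ (α : ℝ) * (4 * d))
          ≤ C * (16 * ε) * (4 * d ^ (α : ℝ) * (4 * d)) := by gcongr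
        _ = 4 * ((C * (16 * ε) * 4) * (d ^ (α : ℝ) * d)) := by ring
    have h5 : (C * (16 * ε) * 4) * (d ^ (α : ℝ) * d) ≤ 1 / 16 * (d ^ (α : ℝ) * d) := by
      gcongr
      linarith
    linarith
  · have := hflat.abs_inner_le hU hx
    linarith
  · exact hflat.exists_mem_freeBoundary hU he (by positivity) hy (by linarith)
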